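/- Let $(M^n,g)$, $n\ge 1$, be a compact smooth Riemannian manifold with smooth (possibly empty) boundary $\partial M$, let $\nu$ be the inward unit normal along $\partial M$ and $\iota:\partial M\to M$ the inclusion, and let $d\mu_g$ denote the Riemannian measure of $M$ and also that of $\partial M$ with the induced metric. Let $F$ be a Lipschitz vector field on $M$, let $p\ge 0$, and let $\omega\in\Omega^p(M)$ be a differential $p$-form, smooth up to the boundary. Then $F$ is differentiable almost everywhere, all the integrands below are integrable, and $$ \begin{aligned} &\int_{M}\langle \Delta \omega , F\lrcorner d \omega \rangle\, d\mu_g +\int_M \langle \delta \omega , F\lrcorner \Delta \omega \rangle\, d\mu_g \\ &=-\frac12\int_{\partial M} \left(|d \omega|^2 +|\delta \omega|^2\right) \langle F,\nu \rangle\, d\mu_g + \int_{\partial M} \langle F \wedge \iota^* (\delta \omega), \nu \lrcorner d \omega \rangle\, d\mu_g +\int_{\partial M} \langle \iota^* (F\lrcorner d \omega), \nu \lrcorner d \omega \rangle\, d\mu_g \\ &\quad+ \int_{\partial M} \langle \iota^* (F\lrcorner \delta \omega), \nu \lrcorner \delta \omega \rangle\, d\mu_g-\frac12\int_{M} \left(|d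 \omega|^2 +|\delta \omega|^2\right) \operatorname{div} F\, d\mu_g+ \int_{M} \langle \delta \omega, dF \lrcorner d \omega \rangle\, d\mu_g \\ &\quad+ \int_{M} \langle T_F^{[p+1]} d \omega, d \omega \rangle\, d\mu_g+ \int_{M} \langle T_F^{[p-1]} \delta \omega, \delta \omega \rangle\, d\mu_g . \end{aligned} $$ Here $\langle\cdot,\cdot\rangle$ is the natural inner product of forms (for which the products $e_{i_1}\wedge\dots\wedge e_{i_k}$, $i_1<\dots<i_k$, of an orthonormal basis are orthonormal), $\nabla$ is the Levi-Civita connection, $\delta=-\sum_i e_i\lrcorner\nabla_{e_i}$ for a local orthonormal frame $(e_i)$, $\Delta=d\delta+\delta d$, $\operatorname{div}F=\operatorname{tr}(X\mapsto \nabla_XF)$, $(T_F^{[k]}\alpha)(X_1,\dots,X_k)=\sum_{l=1}^k\alpha(X_1,\dots,\nabla_{X_l}F,\dots,X_k)$, and $dF=\sum_i e_i\wedge\nabla_{e_i}F$ with $(X\wedge Y)\lrcorner\alpha=Y\lrcorner (X\lrcorner\alpha)$. Tangent vectors are identified with covectors through $g$, forms on $\partial M$ are identified with the forms along $\partial M$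 that vanish when $\nu$ is inserted, and forms of negative degree are $0$. -/

import Mathlib

open Set MeasureTheory
open scoped Manifold ContDiff

noncomputable section

namespace Rellich

/-- The model vector space `ℝⁿ`, `n = m + 1`, with its Euclidean norm. -/
abbrev Model (m : ℕ) : Type := EuclideanSpace ℝ (Fin (m + 1))

/-! ### Linear algebra of exterior forms on one vector space -/

section Algebra

variable {m : ℕ}

/-- The standard basis of the model space.  In the tangent space at `x`, which Mathlib identifies
with the model space through the preferred chart at `x`, this is the coordinate basis of that
chart. -/
def coordVec (i : Fin (m + 1)) : Model m := EuclideanSpace.single i 1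

/-- The interior product `v ⌟ α`, that is `α(v, ·, …, ·)`.  There are no forms of degree `-1`:
for `α` of degree `0` the result is `0`. -/
def interiorProd (v : Model m) : {k : ℕ} → Model m [⋀^Fin k]→L[ℝ] ℝ → Model m [⋀^Fin (k - 1)]→L[ℝ] ℝ
  | 0, _ => 0
  | _ + 1, α => α.curryLeft v

/-- The exterior product `θ ∧ α` of a covector `θ` with a form `α` of degree `k - 1`:
`(θ ∧ α)(v₁, …, v_k) = ∑ i, (-1)^(i-1) θ(v_i) α(v₁, …, v̂_i, …, v_k)`; it is `0` for `k = 0`,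
where there is no form `α`. -/
def wedgeCovector (θ : Model m →L[ℝ] ℝ) :
    {k : ℕ} → Model m [⋀^Fin (k - 1)]→L[ℝ] ℝ → Model m [⋀^Fin k]→L[ℝ] ℝ
  | 0, _ => 0
  | k + 1, α =>
      ContinuousAlternatingMap.alternatizeUncurryFin
        (θ.smulRight (show Model m [⋀^Fin k]→L[ℝ] ℝ from α))

theorem derivationAction_aux (A : Model m →L[ℝ] Model m) {k : ℕ}
    (α : Model m [⋀^Fin k]→L[ℝ] ℝ) (v : Fin k → Model m) :
    (∑ l : Fin k, α.toContinuousMultilinearMap.compContinuousLinearMap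
      (Function.update (fun _ => ContinuousLinearMap.id ℝ (Model m)) l A)) v =
      ∑ l : Fin k, α (Function.update v l (A (v l))) := by
  rw [sum_apply]
  refine Finset.sum_congr rfl fun l _ => ?_
  rw [ContinuousMultilinearMap.compContinuousLinearMap_apply]
  change α _ = α _
  congr 1
  funext i
  rcases eq_or_ne i l with rfl | h
  · simp
  · simp [Function.update_of_ne h]

/-- The action of an endomorphism on forms as a derivation:
`(v₁, …, v_k) ↦ ∑ l, α(v₁, …, A v_l, …, v_k)`. -/
def derivationAction (A : Model m →L[ℝ] Model m) {k : ℕ} (α : Model m [⋀^Fin k]→L[ℝ] ℝ) :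
    Model m [⋀^Fin k]→L[ℝ] ℝ where
  toContinuousMultilinearMap :=
    ∑ l : Fin k, α.toContinuousMultilinearMap.compContinuousLinearMap
      (Function.update (fun _ => ContinuousLinearMap.id ℝ (Model m)) l A)
  map_eq_zero_of_eq' := by
    intro v i j hij hne
    rw [MultilinearMap.toFun_eq_coe, ContinuousMultilinearMap.coe_coe, derivationAction_aux]
    rw [← Finset.sum_subset (Finset.subset_univ {i, j}), Finset.sum_pair hne]
    · have h : Function.update v j (A (v j)) =
          Function.update v i (A (v i)) ∘ Equiv.swap i j := by
        funext l
        rcases eq_or_ne l i with rfl | hi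
        · simp [Function.update_of_ne hne, Function.update_of_ne hne.symm, hij]
        · rcases eq_or_ne l j with rfl | hj
          · simp [hij]
          · simp [Function.update_of_ne hi, Function.update_of_ne hj,
              Equiv.swap_apply_of_ne_of_ne hi hj]
      rw [h]
      exact (congrArg _ (α.toAlternatingMap.map_swap _ hne)).trans (add_neg_cancel _)
    · intro l _ hl
      simp only [Finset.mem_insert, Finset.mem_singleton, not_or] at hl
      refine α.map_eq_zero_of_eq _ ?_ hne
      rw [Function.update_of_ne (Ne.symm hl.1), Function.update_of_ne (Ne.symm hl.2), hij]

theorem derivationAction_apply (A : Model m →L[ℝ] Model m) {k : ℕ}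
    (α : Model m [⋀^Fin k]→L[ℝ] ℝ) (v : Fin k → Model m) :
    derivationAction A α v = ∑ l : Fin k, α (Function.update v l (A (v l))) :=
  derivationAction_aux A α v

end Algebra

/-! ### Manifolds with boundary, their forms and their charts -/

section Manifold

variable {m : ℕ} {M : Type*} [TopologicalSpace M] [ChartedSpace (EuclideanHalfSpace (m + 1)) M]

/-- Vector fields on `M`, without any regularity. -/
abbrev VField (m : ℕ) (M : Type*) [TopologicalSpace M]
    [ChartedSpace (EuclideanHalfSpace (m + 1)) M] : Type _ :=
  ∀ x : M, TangentSpace (𝓡∂ (m + 1)) x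

/-- Differential forms of degree `k` on `M`, without any regularity. -/
abbrev DForm (m : ℕ) (M : Type*) [TopologicalSpace M]
    [ChartedSpace (EuclideanHalfSpace (m + 1)) M] (k : ℕ) : Type _ :=
  ∀ x : M, TangentSpace (𝓡∂ (m + 1)) x [⋀^Fin k]→L[ℝ] ℝ

/-- Smooth Riemannian metrics on `M`. -/
abbrev RiemMetric (m : ℕ) (M : Type*) [TopologicalSpace M]
    [ChartedSpace (EuclideanHalfSpace (m + 1)) M] [IsManifold (𝓡∂ (m + 1)) ∞ M] : Type _ :=
  Bundle.ContMDiffRiemannianMetric (𝓡∂ (m + 1)) ∞ (Model m)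
    (fun x : M => TangentSpace (𝓡∂ (m + 1)) x)

/-- The differential at `y` of the inverse of the preferred chart at `x₀`: it maps the standard
basis vectors to the coordinate vector fields of the chart. -/
def chartFrame (x₀ : M) (y : Model m) :
    Model m →L[ℝ] TangentSpace (𝓡∂ (m + 1)) ((extChartAt (𝓡∂ (m + 1)) x₀).symm y) :=
  mfderivWithin 𝓘(ℝ, Model m) (𝓡∂ (m + 1)) (extChartAt (𝓡∂ (m + 1)) x₀).symm
    (range (𝓡∂ (m + 1))) y

/-- The expression of a form in the preferred chart at `x₀`. -/
def localForm {k : ℕ} (η : DForm m M k) (x₀ : M) (y : Model m) : Model m [⋀^Fin k]→L[ℝ] ℝ :=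
  (η ((extChartAt (𝓡∂ (m + 1)) x₀).symm y)).compContinuousLinearMap (chartFrame x₀ y)

/-- The expression of a vector field in the preferred chart at `x₀`. -/
def localVField (F : VField m M) (x₀ : M) (y : Model m) : Model m :=
  VectorField.mpullbackWithin 𝓘(ℝ, Model m) (𝓡∂ (m + 1)) (extChartAt (𝓡∂ (m + 1)) x₀).symm F
    (range (𝓡∂ (m + 1))) y

/-- The form is smooth up to the boundary: its expression in every chart is `C^∞`. -/
def IsSmoothForm {k : ℕ} (η : DForm m M k) : Prop :=
  ∀ x₀ : M, ContDiffOn ℝ ∞ (localForm η x₀) (extChartAt (𝓡∂ (m + 1)) x₀).target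

/-- The vector field is locally Lipschitz: its components in every chart are.  On a compact
manifold these are the Lipschitz vector fields. -/
def IsLipschitzVField (F : VField m M) : Prop :=
  ∀ x₀ : M, LocallyLipschitzOn (extChartAt (𝓡∂ (m + 1)) x₀).target (localVField F x₀)

/-- The vector field is differentiable at `x`, as seen in the preferred chart at `x`. -/
def IsDifferentiableVFieldAt (F : VField m M) (x : M) : Prop :=
  DifferentiableWithinAt ℝ (localVField F x) (range (𝓡∂ (m + 1)))
    (extChartAt (𝓡∂ (m + 1)) x x)

/-- The exterior derivative, computed at `x` in the preferred chart at `x`. -/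
def extD {k : ℕ} (η : DForm m M k) : DForm m M (k + 1) := fun x =>
  (extDerivWithin (localForm η x) (range (𝓡∂ (m + 1))) (extChartAt (𝓡∂ (m + 1)) x x) :
    Model m [⋀^Fin (k + 1)]→L[ℝ] ℝ)

/-- The interior product `F ⌟ α` of a vector field with a form of degree `k`. -/
def contract (F : VField m M) {k : ℕ} (α : DForm m M k) : DForm m M (k - 1) := fun x =>
  interiorProd (m := m) (F x) (α x)

end Manifold

/-! ### The metric: musical isomorphism, inner products, Levi-Civita connection -/

section Riemannian

variable {m : ℕ} {M : Type*} [TopologicalSpace M] [ChartedSpace (EuclideanHalfSpace (m + 1)) M]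
  [IsManifold (𝓡∂ (m + 1)) ∞ M] (g : RiemMetric m M)

/-- The metric on `T_x M`, as a bilinear form. -/
def metricAt (x : M) : Model m →L[ℝ] Model m →L[ℝ] ℝ := g.inner x

/-- The function `⟨F, G⟩`. -/
def innerV (F G : VField m M) (x : M) : ℝ := metricAt g x (F x) (G x)

/-- The metric in the preferred chart at `x₀`. -/
def localMetric (x₀ : M) (y : Model m) : Model m →L[ℝ] Model m →L[ℝ] ℝ :=
  (metricAt g ((extChartAt (𝓡∂ (m + 1)) x₀).symm y)).bilinearComp
    (chartFrame x₀ y) (chartFrame x₀ y)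

/-- The matrix `(g_ij)` in the preferred chart at `x₀`. -/
def localGram (x₀ : M) (y : Model m) : Matrix (Fin (m + 1)) (Fin (m + 1)) ℝ :=
  Matrix.of fun i j => localMetric g x₀ y (coordVec i) (coordVec j)

/-- The inverse matrix `(g^ij)` at `x`, in the coordinate basis of `T_x M`. -/
def gInv (x : M) : Matrix (Fin (m + 1)) (Fin (m + 1)) ℝ :=
  (Matrix.of fun i j => metricAt g x (coordVec i) (coordVec j))⁻¹

/-- The natural inner product of forms of degree `k`, for which the products
`e_{i₁} ∧ ⋯ ∧ e_{i_k}`, `i₁ < ⋯ < i_k`, of an orthonormal basis are orthonormal: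
`(1 / k!) ∑ g^{i₁ j₁} ⋯ g^{i_k j_k} α_{i₁ … i_k} β_{j₁ … j_k}`. -/
def innerForm {k : ℕ} (α β : DForm m M k) (x : M) : ℝ :=
  ((k.factorial : ℝ))⁻¹ * ∑ I : Fin k → Fin (m + 1), ∑ J : Fin k → Fin (m + 1),
    (∏ l, gInv g x (I l) (J l)) * (α x (fun l => coordVec (I l)) * β x (fun l => coordVec (J l)))

/-- The function `|α|²`. -/
def normSq {k : ℕ} (α : DForm m M k) (x : M) : ℝ := innerForm g α α x

/-- The exterior product `F ∧ α`, where the vector field `F` is identified with the `1`-form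
`F^♭ = ⟨F, ·⟩` and `α` has degree `k - 1`. -/
def wedge (F : VField m M) {k : ℕ} (α : DForm m M (k - 1)) : DForm m M k := fun x =>
  wedgeCovector (metricAt g x (F x)) (α x)

/-- The derivative at `x` of the metric coefficients in the preferred chart at `x`: the value at
`(w, u, v)` is `∂_w (g(u, v))` for constant `u`, `v`. -/
def metricDeriv (x : M) : Model m →L[ℝ] Model m →L[ℝ] Model m →L[ℝ] ℝ :=
  fderivWithin ℝ (localMetric g x) (range (𝓡∂ (m + 1))) (extChartAt (𝓡∂ (m + 1)) x x)

/-- The Christoffel symbols at `x` in the preferred chart at `x`: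
`Γ(u, v) = ∑ i j, (1/2) g^ij (∂_u g(v, ∂_i) + ∂_v g(u, ∂_i) - ∂_i g(u, v)) ∂_j`. -/
def christoffel (x : M) : Model m →L[ℝ] Model m →L[ℝ] Model m :=
  LinearMap.toContinuousBilinearMap <| LinearMap.mk₂ ℝ
    (fun u v => ∑ i, ∑ j, (2⁻¹ * gInv g x i j * (metricDeriv g x u v (coordVec i) +
      metricDeriv g x v u (coordVec i) - metricDeriv g x (coordVec i) u v)) •
        (coordVec j : Model m))
    (by
      intro u u' v
      simp only [map_add, add_apply, ← Finset.sum_add_distrib, ← add_smul]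
      exact Finset.sum_congr rfl fun i _ => Finset.sum_congr rfl fun j _ => by ring_nf)
    (by
      intro c u v
      simp only [map_smul, smul_apply, Finset.smul_sum, smul_smul, smul_eq_mul]
      exact Finset.sum_congr rfl fun i _ => Finset.sum_congr rfl fun j _ => by ring_nf)
    (by
      intro u v v'
      simp only [map_add, add_apply, ← Finset.sum_add_distrib, ← add_smul]
      exact Finset.sum_congr rfl fun i _ => Finset.sum_congr rfl fun j _ => by ring_nf)
    (by
      intro c u v
      simp only [map_smul, smul_apply, Finset.smul_sum, smul_smul, smul_eq_mul]
      exact Finset.sum_congr rfl fun i _ => Finset.sum_congr rfl fun j _ => by ring_nf)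

/-- The covariant derivative `v ↦ ∇_v F` of a vector field at `x` for the Levi-Civita connection,
meaningful where `F` is differentiable: `∇_v F = ∂_v F + Γ(v, F)`. -/
def nablaV (F : VField m M) (x : M) : Model m →L[ℝ] Model m :=
  fderivWithin ℝ (localVField F x) (range (𝓡∂ (m + 1))) (extChartAt (𝓡∂ (m + 1)) x x) +
    (christoffel g x).flip (F x)

/-- The covariant derivative `∇_u η` of a form at `x` for the Levi-Civita connection:
`(∇_u η)(v₁, …, v_k) = ∂_u (η(v₁, …, v_k)) - ∑ l, η(v₁, …, Γ(u, v_l), …, v_k)`. -/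
def nablaForm {k : ℕ} (η : DForm m M k) (x : M) (u : Model m) : Model m [⋀^Fin k]→L[ℝ] ℝ :=
  fderivWithin ℝ (localForm η x) (range (𝓡∂ (m + 1))) (extChartAt (𝓡∂ (m + 1)) x x) u -
    derivationAction (christoffel g x u) (η x)

/-- The codifferential `δη = - ∑ e_i ⌟ ∇_{e_i} η`, that is `- ∑ g^ij ∂_i ⌟ ∇_{∂_j} η`; it is `0`
in degree `0`. -/
def codiff {k : ℕ} (η : DForm m M k) : DForm m M (k - 1) := fun x =>
  (-∑ i, ∑ j, gInv g x i j • interiorProd (coordVec i) (nablaForm g η x (coordVec j)) :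
    Model m [⋀^Fin (k - 1)]→L[ℝ] ℝ)

/-- The Hodge Laplacian `Δ = dδ + δd`; in degree `0` the first summand is absent. -/
def hodgeLaplacian : {k : ℕ} → DForm m M k → DForm m M k
  | 0, η => codiff g (extD η)
  | k + 1, η => fun x =>
      ((show Model m [⋀^Fin (k + 1)]→L[ℝ] ℝ from extD (codiff g η) x) +
        (show Model m [⋀^Fin (k + 1)]→L[ℝ] ℝ from codiff g (extD η) x) :
          Model m [⋀^Fin (k + 1)]→L[ℝ] ℝ)

/-- The divergence of a vector field, the trace of `v ↦ ∇_v F`. -/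
def divergence (F : VField m M) (x : M) : ℝ :=
  LinearMap.trace ℝ (Model m) (nablaV g F x)

/-- The operator `T_F^{[k]}`: `(T_F α)(v₁, …, v_k) = ∑ l, α(v₁, …, ∇_{v_l} F, …, v_k)`. -/
def opT (F : VField m M) {k : ℕ} (α : DForm m M k) : DForm m M k := fun x =>
  derivationAction (nablaV g F x) (α x)

/-- The form `dF ⌟ α`, where `dF = ∑ e_i ∧ ∇_{e_i} F = ∑ g^ij ∂_i ∧ ∇_{∂_j} F` and
`(X ∧ Y) ⌟ α = Y ⌟ (X ⌟ α) = α(X, Y, ·, …, ·)`. -/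
def contractDF (F : VField m M) {k : ℕ} (α : DForm m M k) : DForm m M (k - 1 - 1) := fun x =>
  (∑ i, ∑ j, gInv g x i j • interiorProd (nablaV g F x (coordVec j)) (interiorProd (coordVec i) (α x)) :
    Model m [⋀^Fin (k - 1 - 1)]→L[ℝ] ℝ)

/-! ### The boundary -/

/-- The inward unit normal `ν`.  At a boundary point `x` the tangent space of the boundary is
`{v | v 0 = 0}` and `v` points inward when `0 < v 0`; thus `ν` is the normalized gradient
`∑ i, g^{i0} ∂_i / √g^{00}` of the coordinate `0`.  Only its values on the boundary matter. -/
def unitNormal : VField m M := fun x =>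
  ((Real.sqrt (gInv g x 0 0))⁻¹ • ∑ i, gInv g x i 0 • coordVec i : Model m)

/-- The pullback `ι^* α` of a form to the boundary.  A form on `T_x ∂M` is identified with the
form on `T_x M` obtained by composition with the orthogonal projection `v ↦ v - ⟨v, ν⟩ ν` onto
`T_x ∂M`; this identification preserves inner products. -/
def tangentialPart {k : ℕ} (α : DForm m M k) : DForm m M k := fun x =>
  ContinuousAlternatingMap.compContinuousLinearMap (M := Model m) (M' := Model m) (α x)
    (ContinuousLinearMap.id ℝ (Model m) -
      (metricAt g x (unitNormal g x)).smulRight (show Model m from unitNormal g x))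

/-- The inclusion `z ↦ (0, z)` of `ℝ^(n-1)` onto the boundary hyperplane of the half-space. -/
def boundaryInclusion (z : EuclideanSpace ℝ (Fin m)) : Model m :=
  WithLp.toLp 2 (Fin.cons 0 z.ofLp)

/-! ### The Riemannian measures -/

variable [MeasurableSpace M]

/-- The Riemannian measure of the domain of the preferred chart at `x₀`: the image of
`√det(g_ij) dy` under the inverse of the chart. -/
def chartVolume (x₀ : M) : Measure M :=
  ((volume.restrict (extChartAt (𝓡∂ (m + 1)) x₀).target).withDensity
    fun y => ENNReal.ofReal (Real.sqrt (localGram g x₀ y).det)).map (extChartAt (𝓡∂ (m + 1)) x₀).symm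

/-- The Riemannian measure of `M`.  The measures `chartVolume g x₀` agree where the chart domains
overlap, so that the least measure above all of them is the one that restricts to each of them. -/
def riemVolume : Measure M := ⨆ x₀ : M, chartVolume g x₀

/-- The Riemannian measure of the boundary part of the domain of the preferred chart at `x₀`, as a
measure on `M`: the image of `√det(g_ij)_{i, j ≥ 1} dz` under `z ↦ chart⁻¹(0, z)`. -/
def chartBoundaryVolume (x₀ : M) : Measure M :=
  ((volume.restrict (boundaryInclusion ⁻¹' (extChartAt (𝓡∂ (m + 1)) x₀).target)).withDensity
    fun z => ENNReal.ofReal (Real.sqrt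
      ((localGram g x₀ (boundaryInclusion z)).submatrix Fin.succ Fin.succ).det)).map
        fun z => (extChartAt (𝓡∂ (m + 1)) x₀).symm (boundaryInclusion z)

/-- The Riemannian measure of `∂M` with the induced metric, as a measure on `M` that is
concentrated on `∂M`. -/
def boundaryVolume : Measure M := ⨆ x₀ : M, chartBoundaryVolume g x₀

end Riemannian

end Rellich

end

open Rellich

/-! Write α = dω and β = δω. The identity is the divergence theorem ∫_M div X = -∫_∂M ⟨X, ν⟩, with ν
pointing inward, for the vector field X dual to ½(|α|² + |β|²)F - ⟨F ⌟ α, · ⌟ α⟩ - ⟨F ⌟ β, · ⌟ β⟩ -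
⟨F ∧ β, · ⌟ α⟩ (`rellichField`). Its normal component is the boundary integrand
(`apply_rellichField`): each tangential projection ι^* is harmless there, because the form it is
paired with is annihilated by ν.

The divergence of X comes from one formula, `trace_covV_pairField`: the field dual to ⟨· ∧ φ, γ⟩ has
divergence ⟨dφ, γ⟩ - ⟨φ, δγ⟩. For φ = F ⌟ γ it is combined with d(F ⌟ γ) + F ⌟ dγ = ∇_F γ + T_F γ,
and the term ∇_F γ cancels against the derivative of ½|γ|² along F
(`IsMetricNear.trace_covV_energy`). For φ = F ∧ β it produces dF ⌟ α together with the missing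
halves of the Laplacian terms (`IsMetricNear.trace_covV_mixed`). Finally dα = 0, δβ = 0 and dβ + δα
= Δω leave exactly the interior integrand (`IsMetricNear.trace_covV_rellichField`).

These computations take place on the model half-space, for a metric field with its Christoffel
symbols. The inner product of forms is controlled by a recursion on the degree, `mul_formInner`. The
operators on M are evaluated at each point in the preferred chart of that same point. That they are
given by the same formulas throughout a single chart follows from the naturality of the Levi-Civita
connection under coordinate changes (`IsChange.christoffelL_eq`, `IsChange.covD_eq`).

Since F is only Lipschitz, so is X in a chart, and the divergence theorem is needed for Lipschitz
functions on the half-space. It is proved by integrating difference quotients and passing to the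
limit with Rademacher's theorem and dominated convergence (`integral_fderivWithin_halfSpace`). A
partition of unity globalizes it, the derivatives of the cutoffs adding up to zero. The measures,
defined as suprema, restrict to the chart measures because the latter agree on overlaps
(`iSup_restrict_eq`). -/

namespace Rellich

noncomputable section

/-! ### Algebra of forms on the model space -/

section FormAlgebra

variable {m k : ℕ}

/-- Forms of degree `k` on the model space. -/
abbrev Frm (m k : ℕ) : Type := Model m [⋀^Fin k]→L[ℝ] ℝ

/-- The coordinate covectors. -/
def coordCovec (i : Fin (m + 1)) : Model m →L[ℝ] ℝ := EuclideanSpace.proj i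

@[simp] theorem coordCovec_apply (i : Fin (m + 1)) (v : Model m) : coordCovec i v = v i := rfl

theorem coordVec_apply (i j : Fin (m + 1)) :
    (coordVec i : Model m) j = if j = i then 1 else 0 := by
  simp [coordVec]

theorem sum_coord_smul (v : Model m) : ∑ i, v i • (coordVec i : Model m) = v := by
  ext j
  simp [coordVec_apply]

theorem sum_coord_smul_map {W : Type*} [AddCommGroup W] [Module ℝ W]
    (f : Model m →ₗ[ℝ] W) (v : Model m) : ∑ i, v i • f (coordVec i) = f v := by
  conv_rhs => rw [← sum_coord_smul v]
  simp

theorem sum_coord_mul_map (f : Model m →L[ℝ] ℝ) (v : Model m) :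
    ∑ i, v i * f (coordVec i) = f v := by
  simpa using sum_coord_smul_map (f : Model m →ₗ[ℝ] ℝ) v

/-- Finite dimension makes all the bilinear operations on forms continuous at once, through
`LinearMap.toContinuousBilinearMap`; this gives their product rules and smoothness. -/
instance : FiniteDimensional ℝ (Frm m k) := by
  let f : Frm m k →ₗ[ℝ] MultilinearMap ℝ (fun _ : Fin k => Model m) ℝ :=
    { toFun := fun α => α.toAlternatingMap.toMultilinearMap
      map_add' := fun _ _ => rfl
      map_smul' := fun _ _ => rfl }
  refine FiniteDimensional.of_injective f fun α β h => ?_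
  ext v
  exact congrArg (fun φ : MultilinearMap ℝ (fun _ : Fin k => Model m) ℝ => φ v) h

/-- The induction device of the algebraic part: an identity of forms is contracted with an arbitrary
vector, which lowers the degree by one. -/
theorem form_ext_curryLeft {α β : Frm m (k + 1)}
    (h : ∀ v, α.curryLeft v = β.curryLeft v) : α = β := by
  ext w
  have := congrArg (fun φ : Frm m k => φ (Fin.tail w)) (h (w 0))
  simpa [Matrix.vecCons] using this

theorem form_ext_interiorProd {α β : Frm m (k + 1)}
    (h : ∀ v, interiorProd v α = interiorProd v β) : α = β :=
  form_ext_curryLeft h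

theorem form_ext_zero {α β : Frm m 0} (h : α 0 = β 0) : α = β := by
  ext w
  rw [Subsingleton.elim w 0, h]

/-! #### Linearity of the interior product, the exterior product and the derivation action -/

theorem interiorProd_succ (v : Model m) (α : Frm m (k + 1)) :
    interiorProd v α = α.curryLeft v := rfl

theorem interiorProd_zero_degree (v : Model m) (α : Frm m 0) : interiorProd v α = 0 := rfl

theorem interiorProd_add_left (v w : Model m) (α : Frm m k) :
    interiorProd (v + w) α = interiorProd v α + interiorProd w α := by
  cases k with
  | zero => simp [interiorProd]
  | succ k => simp [interiorProd]

theorem interiorProd_smul_left (c : ℝ) (v : Model m) (α : Frm m k) :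
    interiorProd (c • v) α = c • interiorProd v α := by
  cases k with
  | zero => simp [interiorProd]
  | succ k => simp [interiorProd]

theorem interiorProd_add_right (v : Model m) (α β : Frm m k) :
    interiorProd v (α + β) = interiorProd v α + interiorProd v β := by
  cases k with
  | zero => simp [interiorProd]
  | succ k => simp [interiorProd]

theorem interiorProd_smul_right (c : ℝ) (v : Model m) (α : Frm m k) :
    interiorProd v (c • α) = c • interiorProd v α := by
  cases k with
  | zero => simp [interiorProd]
  | succ k => simp [interiorProd]

/-- The interior product as a continuous bilinear map. -/
def interiorL (m k : ℕ) : Model m →L[ℝ] Frm m k →L[ℝ] Frm m (k - 1) :=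
  LinearMap.toContinuousBilinearMap <| LinearMap.mk₂ ℝ (fun v α => interiorProd v α)
    interiorProd_add_left interiorProd_smul_left interiorProd_add_right
    (fun c v α => interiorProd_smul_right c v α)

@[simp] theorem interiorL_apply (v : Model m) (α : Frm m k) :
    interiorL m k v α = interiorProd v α := rfl

theorem wedgeCovector_apply (θ : Model m →L[ℝ] ℝ) (α : Frm m k) (v : Fin (k + 1) → Model m) :
    wedgeCovector (k := k + 1) θ α v =
      ∑ i, (-1) ^ i.val * (θ (v i) * α (i.removeNth v)) := by
  simp [wedgeCovector, ContinuousAlternatingMap.alternatizeUncurryFin_apply]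

theorem wedgeCovector_add_left (θ θ' : Model m →L[ℝ] ℝ) (α : Frm m (k - 1)) :
    wedgeCovector (k := k) (θ + θ') α = wedgeCovector θ α + wedgeCovector θ' α := by
  cases k with
  | zero => simp [wedgeCovector]
  | succ k =>
    ext v
    rw [ContinuousAlternatingMap.add_apply]
    iterate 3 rw [wedgeCovector_apply]
    rw [← Finset.sum_add_distrib]
    exact Finset.sum_congr rfl fun i _ => by rw [add_apply]; ring

theorem wedgeCovector_smul_left (c : ℝ) (θ : Model m →L[ℝ] ℝ) (α : Frm m (k - 1)) :
    wedgeCovector (k := k) (c • θ) α = c • wedgeCovector θ α := by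
  cases k with
  | zero => simp [wedgeCovector]
  | succ k =>
    ext v
    rw [ContinuousAlternatingMap.smul_apply]
    iterate 2 rw [wedgeCovector_apply]
    rw [Finset.smul_sum]
    exact Finset.sum_congr rfl fun i _ => by rw [smul_apply, smul_eq_mul, smul_eq_mul]; ring

theorem wedgeCovector_add_right (θ : Model m →L[ℝ] ℝ) (α β : Frm m (k - 1)) :
    wedgeCovector (k := k) θ (α + β) = wedgeCovector θ α + wedgeCovector θ β := by
  cases k with
  | zero => simp [wedgeCovector]
  | succ k =>
    ext v
    rw [ContinuousAlternatingMap.add_apply]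
    iterate 3 rw [wedgeCovector_apply]
    rw [← Finset.sum_add_distrib]
    refine Finset.sum_congr rfl fun i _ => ?_
    rw [← mul_add, ← mul_add]
    rfl

theorem wedgeCovector_smul_right (c : ℝ) (θ : Model m →L[ℝ] ℝ) (α : Frm m (k - 1)) :
    wedgeCovector (k := k) θ (c • α) = c • wedgeCovector θ α := by
  cases k with
  | zero => simp [wedgeCovector]
  | succ k =>
    ext v
    rw [ContinuousAlternatingMap.smul_apply]
    iterate 2 rw [wedgeCovector_apply]
    rw [Finset.smul_sum]
    refine Finset.sum_congr rfl fun i _ => ?_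
    have : (c • α) (i.removeNth v) = c * (show Frm m k from α) (i.removeNth v) := rfl
    rw [this, smul_eq_mul]
    ring

/-- The exterior product with a covector as a continuous bilinear map. -/
def wedgeL (m k : ℕ) : (Model m →L[ℝ] ℝ) →L[ℝ] Frm m (k - 1) →L[ℝ] Frm m k :=
  LinearMap.toContinuousBilinearMap <| LinearMap.mk₂ ℝ (fun θ α => wedgeCovector θ α)
    wedgeCovector_add_left wedgeCovector_smul_left wedgeCovector_add_right
    (fun c θ α => wedgeCovector_smul_right c θ α)

@[simp] theorem wedgeL_apply (θ : Model m →L[ℝ] ℝ) (α : Frm m (k - 1)) :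
    wedgeL m k θ α = wedgeCovector θ α := rfl

/-- The derivation action as a continuous bilinear map. -/
def derivationL (m k : ℕ) : (Model m →L[ℝ] Model m) →L[ℝ] Frm m k →L[ℝ] Frm m k :=
  LinearMap.toContinuousBilinearMap <| LinearMap.mk₂ ℝ (fun A α => derivationAction A α)
    (by
      intro A B α
      ext v
      simp [derivationAction_apply, Finset.sum_add_distrib])
    (by
      intro c A α
      ext v
      simp [derivationAction_apply, Finset.mul_sum])
    (by
      intro A α β
      ext v
      simp [derivationAction_apply, Finset.sum_add_distrib])
    (by
      intro c A α
      ext v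
      simp [derivationAction_apply, Finset.mul_sum])

@[simp] theorem derivationL_apply (A : Model m →L[ℝ] Model m) (α : Frm m k) :
    derivationL m k A α = derivationAction A α := rfl

/-! #### Contraction identities -/

/-- In the alternating sum the term that feeds `v` to `θ` stands alone; in the others `v` remains
the first argument of `α`, and the shift of the index by one gives the minus sign. -/
theorem interiorProd_wedgeCovector (v : Model m) (θ : Model m →L[ℝ] ℝ) (α : Frm m k) :
    interiorProd v (wedgeCovector (k := k + 1) θ α) =
      θ v • α - wedgeCovector (k := k) θ (interiorProd v α) := by
  rw [interiorProd_succ]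
  ext w
  rw [ContinuousAlternatingMap.curryLeft_apply_apply, wedgeCovector_apply, Fin.sum_univ_succ]
  rw [ContinuousAlternatingMap.sub_apply, ContinuousAlternatingMap.smul_apply]
  cases k with
  | zero =>
    simp [wedgeCovector]
  | succ k =>
    rw [wedgeCovector_apply, sub_eq_add_neg, ← Finset.sum_neg_distrib]
    congr 1
    · simp [Matrix.vecCons]
    · refine Finset.sum_congr rfl fun j _ => ?_
      have h : (Fin.succ j).removeNth (Matrix.vecCons v w) = Matrix.vecCons v (j.removeNth w) := by
        funext l
        refine Fin.cases ?_ (fun l => ?_) l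
        · simp [Fin.removeNth]
        · simp [Fin.removeNth]
      rw [h, interiorProd_succ, ContinuousAlternatingMap.curryLeft_apply_apply]
      simp [pow_succ]

/-- Polarization of `w ⌟ (w ⌟ α) = 0` at `w = u + v`. -/
theorem interiorProd_interiorProd (u v : Model m) (α : Frm m k) :
    interiorProd u (interiorProd v α) = -interiorProd v (interiorProd u α) := by
  match k, α with
  | 0, α => simp [interiorProd]
  | 1, α =>
    change (0 : Frm m 0) = -(0 : Frm m 0)
    simp
  | k + 2, α =>
    simp only [interiorProd_succ]
    have h := α.curryLeft_same (u + v)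
    have hu := α.curryLeft_same u
    have hv := α.curryLeft_same v
    have : ∀ a b : Model m, interiorProd a (interiorProd b α) = (α.curryLeft b).curryLeft a :=
      fun _ _ => rfl
    rw [← this] at h hu hv
    simp only [interiorProd_add_left, interiorProd_add_right] at h
    rw [hu, hv] at h
    rw [eq_neg_iff_add_eq_zero]
    have h' : interiorProd u (interiorProd v α) + interiorProd v (interiorProd u α) = 0 := by
      rw [← h]; abel
    exact h'

theorem interiorProd_derivationAction (v : Model m) (A : Model m →L[ℝ] Model m) (α : Frm m k) :
    interiorProd v (derivationAction A α) =
      derivationAction A (interiorProd v α) + interiorProd (A v) α := by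
  cases k with
  | zero => ext w; simp [interiorProd, derivationAction_apply]
  | succ k =>
    ext w
    simp only [interiorProd_succ]
    rw [ContinuousAlternatingMap.curryLeft_apply_apply, ContinuousAlternatingMap.add_apply]
    erw [derivationAction_apply]
    rw [ContinuousAlternatingMap.curryLeft_apply_apply,
      derivationAction_apply, Fin.sum_univ_succ, add_comm]
    congr 1
    · refine Finset.sum_congr rfl fun j _ => ?_
      erw [ContinuousAlternatingMap.curryLeft_apply_apply]
      congr 1
      simp [Matrix.vecCons, Fin.cons_update]
    · simp [Matrix.vecCons, Fin.update_cons_zero]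

theorem derivationAction_zero_degree (A : Model m →L[ℝ] Model m) (α : Frm m 0) :
    derivationAction A α = 0 := by
  ext w; simp [derivationAction_apply]

theorem derivationAction_wedgeCovector (A : Model m →L[ℝ] Model m) (θ : Model m →L[ℝ] ℝ)
    (α : Frm m (k - 1)) :
    derivationAction A (wedgeCovector (k := k) θ α) =
      wedgeCovector (k := k) (θ.comp A) α + wedgeCovector (k := k) θ (derivationAction A α) := by
  induction k with
  | zero =>
    rw [derivationAction_zero_degree]; simp [wedgeCovector]
  | succ k ih =>
    refine form_ext_interiorProd fun v => ?_
    have e1 := interiorProd_derivationAction v A (wedgeCovector (k := k + 1) θ α)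
    have e2 := interiorProd_wedgeCovector v θ α
    have e3 := interiorProd_wedgeCovector (A v) θ α
    have e4 := interiorProd_wedgeCovector v (θ.comp A) α
    have e5 := interiorProd_wedgeCovector v θ (derivationAction A α)
    have e6 := interiorProd_derivationAction v A (show Frm m k from α)
    have e7 := ih (interiorProd v (show Frm m k from α))
    rw [interiorProd_add_right, e1, e2, e3, e4, e5]
    erw [e6]
    rw [← derivationL_apply, map_sub, map_smul, derivationL_apply, derivationL_apply,
      wedgeCovector_add_right]
    erw [e7]
    have : ∀ a b c d e : Frm m k, a - (b + c) + (d - e) = d - b + (a - (c + e)) := by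
      intros; abel
    exact this _ _ _ _ _

/-- After contraction with `v`, the terms in which `v` meets the coordinate covectors add up to `A v
⌟ α`, and the rest is the same sum for `v ⌟ α`. With `A = ∇F` this is how the operator `T_F` arises
from `d(F ⌟ α)`. -/
theorem sum_wedge_interiorProd (A : Model m →L[ℝ] Model m) (α : Frm m k) :
    ∑ i, wedgeCovector (k := k) (coordCovec i) (interiorProd (A (coordVec i)) α) =
      derivationAction A α := by
  induction k with
  | zero =>
    rw [derivationAction_zero_degree]; simp [wedgeCovector]
  | succ k ih =>
    refine form_ext_interiorProd fun v => ?_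
    rw [← interiorL_apply, map_sum, interiorProd_derivationAction]
    have e : ∀ i, interiorL m (k + 1) v (wedgeCovector (k := k + 1) (coordCovec i)
        (interiorProd (A (coordVec i)) α)) =
        v i • α.curryLeft (A (coordVec i)) +
          (wedgeCovector (k := k) (coordCovec i) (interiorProd (A (coordVec i))
            (interiorProd v α)) : Frm m k) := by
      intro i
      have h1 := interiorProd_wedgeCovector v (coordCovec i) (α.curryLeft (A (coordVec i)))
      have h2 : interiorProd v (α.curryLeft (A (coordVec i))) =
          -interiorProd (A (coordVec i)) (interiorProd v α) :=
        interiorProd_interiorProd v (A (coordVec i)) α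
      rw [h2, ← wedgeL_apply, ← wedgeL_apply, map_neg, sub_neg_eq_add] at h1
      exact h1
    rw [Finset.sum_congr rfl fun i _ => e i, Finset.sum_add_distrib]
    have h := sum_coord_smul_map
      ((α.curryLeft ∘L A : Model m →L[ℝ] Frm m k) : Model m →ₗ[ℝ] Frm m k) v
    exact (add_comm (_ : Frm m k) _).trans (congrArg₂ (· + ·) (ih (interiorProd v α)) h)

/-- By linearity, from `L = ∑ dx^i ⊗ L(∂_i)`. It turns the exterior derivative into a sum of
exterior products. -/
theorem alternatizeUncurryFin_eq_sum (L : Model m →L[ℝ] Frm m k) :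
    ContinuousAlternatingMap.alternatizeUncurryFin L =
      ∑ i, wedgeCovector (k := k + 1) (coordCovec i) (L (coordVec i)) := by
  have h : L = ∑ i, (coordCovec i).smulRight (L (coordVec i)) := by
    ext1 v
    rw [sum_apply]
    simpa using (sum_coord_smul_map (L : Model m →ₗ[ℝ] Frm m k) v).symm
  conv_lhs => rw [h]
  rw [← ContinuousAlternatingMap.alternatizeUncurryFinCLM_apply, map_sum]
  rfl

/-! #### Pullbacks by linear maps -/

/-- The pullback of a form by a linear map. -/
abbrev pull (A : Model m →L[ℝ] Model m) (α : Frm m k) : Frm m k := α.compContinuousLinearMap A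

theorem pull_apply (A : Model m →L[ℝ] Model m) (α : Frm m k) (v : Fin k → Model m) :
    pull A α v = α (fun i => A (v i)) := rfl

theorem interiorProd_pull (A : Model m →L[ℝ] Model m) (v : Model m) (α : Frm m k) :
    interiorProd v (pull A α) = pull A (interiorProd (A v) α) := by
  cases k with
  | zero => ext w; simp [interiorProd]
  | succ k => exact ContinuousAlternatingMap.curryLeft_compContinuousLinearMap α A v

theorem wedgeCovector_pull (A : Model m →L[ℝ] Model m) (θ : Model m →L[ℝ] ℝ)
    (α : Frm m (k - 1)) :
    wedgeCovector (k := k) (θ.comp A) (pull A α) = pull A (wedgeCovector θ α) := by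
  cases k with
  | zero => ext w; simp [wedgeCovector]
  | succ k =>
    ext v
    rw [pull_apply]
    erw [wedgeCovector_apply, wedgeCovector_apply]
    exact Finset.sum_congr rfl fun i _ => rfl

theorem derivationAction_pull (A B B' : Model m →L[ℝ] Model m) (h : A.comp B = B'.comp A)
    (α : Frm m k) : derivationAction B (pull A α) = pull A (derivationAction B' α) := by
  ext v
  rw [derivationAction_apply, pull_apply, derivationAction_apply]
  refine Finset.sum_congr rfl fun l _ => ?_
  rw [pull_apply]
  congr 1
  funext i
  rcases eq_or_ne i l with rfl | hi
  · simpa using congrArg (fun C : Model m →L[ℝ] Model m => C (v i)) h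
  · simp [Function.update_of_ne hi]

theorem pull_add (A : Model m →L[ℝ] Model m) (α β : Frm m k) :
    pull A (α + β) = pull A α + pull A β := rfl

theorem pull_smul (A : Model m →L[ℝ] Model m) (c : ℝ) (α : Frm m k) :
    pull A (c • α) = c • pull A α := rfl

/-- The pullback as a linear map in the form. -/
def pullL (A : Model m →L[ℝ] Model m) (k : ℕ) : Frm m k →ₗ[ℝ] Frm m k where
  toFun := pull A
  map_add' := pull_add A
  map_smul' := pull_smul A

@[simp] theorem pullL_apply (A : Model m →L[ℝ] Model m) (α : Frm m k) :
    pullL A k α = pull A α := rfl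

/-! #### The inner product of forms -/

/-- The inner product of forms for the inverse metric matrix `gi`. -/
def formInner (gi : Matrix (Fin (m + 1)) (Fin (m + 1)) ℝ) (α β : Frm m k) : ℝ :=
  ((k.factorial : ℝ))⁻¹ * ∑ I : Fin k → Fin (m + 1), ∑ J : Fin k → Fin (m + 1),
    (∏ l, gi (I l) (J l)) * (α (fun l => coordVec (I l)) * β (fun l => coordVec (J l)))

variable (gi : Matrix (Fin (m + 1)) (Fin (m + 1)) ℝ)

/-- The inner product of forms as a continuous bilinear map. -/
def formInnerL (k : ℕ) : Frm m k →L[ℝ] Frm m k →L[ℝ] ℝ :=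
  LinearMap.toContinuousBilinearMap <| LinearMap.mk₂ ℝ (fun α β => formInner gi α β)
    (by
      intro α β γ
      simp only [formInner, ContinuousAlternatingMap.add_apply]
      rw [← mul_add, ← Finset.sum_add_distrib]
      simp only [← Finset.sum_add_distrib, add_mul, mul_add])
    (by
      intro c α β
      simp only [formInner, ContinuousAlternatingMap.smul_apply, smul_eq_mul, Finset.mul_sum]
      exact Finset.sum_congr rfl fun _ _ => Finset.sum_congr rfl fun _ _ => by ring)
    (by
      intro α β γ
      simp only [formInner, ContinuousAlternatingMap.add_apply]
      rw [← mul_add, ← Finset.sum_add_distrib]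
      simp only [← Finset.sum_add_distrib, mul_add])
    (by
      intro c α β
      simp only [formInner, ContinuousAlternatingMap.smul_apply, smul_eq_mul, Finset.mul_sum]
      exact Finset.sum_congr rfl fun _ _ => Finset.sum_congr rfl fun _ _ => by ring)

@[simp] theorem formInnerL_apply (α β : Frm m k) : formInnerL gi k α β = formInner gi α β := rfl

theorem formInner_zero_degree (α β : Frm m 0) : formInner gi α β = α 0 * β 0 := by
  have h : ∀ (γ : Frm m 0) (v : Fin 0 → Model m), γ v = γ 0 := fun γ v =>
    congrArg γ (Subsingleton.elim _ _)
  unfold formInner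
  rw [Fintype.sum_unique, Fintype.sum_unique, h α, h β]
  simp

theorem formInner_zero_left (β : Frm m k) : formInner gi 0 β = 0 := by
  simp [formInner]

theorem formInner_zero_right (β : Frm m k) : formInner gi β 0 = 0 := by
  simp [formInner]

/-- The first index is split off from both multi-indices, and `k / k! = 1 / (k - 1)!`. This
recursion replaces orthonormal bases of forms: adjointness, naturality and metric compatibility are
all proved from it by induction on the degree. -/
theorem mul_formInner (α β : Frm m k) :
    (k : ℝ) * formInner gi α β = ∑ i, ∑ j, gi i j *
      formInner gi (interiorProd (coordVec i) α) (interiorProd (coordVec j) β) := by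
  cases k with
  | zero =>
    simp [interiorProd_zero_degree, formInner_zero_left]
  | succ k =>
    have hsum : ∀ f : (Fin (k + 1) → Fin (m + 1)) → ℝ,
        ∑ I, f I = ∑ i, ∑ I : Fin k → Fin (m + 1), f (Fin.cons i I) := by
      intro f
      rw [← Fintype.sum_prod_type']
      exact (Fintype.sum_equiv (Fin.consEquiv fun _ => Fin (m + 1)) _ _ fun _ => rfl).symm
    have hcons : ∀ (i : Fin (m + 1)) (I : Fin k → Fin (m + 1)),
        (fun l => (coordVec ((Fin.cons i I : Fin (k + 1) → Fin (m + 1)) l) : Model m)) =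
          Matrix.vecCons (coordVec i) fun l => coordVec (I l) := by
      intro i I
      funext l
      refine Fin.cases ?_ (fun l => ?_) l <;> simp
    have hfac : ((k + 1 : ℕ) : ℝ) * (((k + 1).factorial : ℝ))⁻¹ = ((k.factorial : ℝ))⁻¹ := by
      rw [Nat.factorial_succ]
      push_cast
      field_simp
    rw [formInner, ← mul_assoc, hfac, hsum]
    simp only [hsum, Fin.prod_univ_succ, Fin.cons_zero, Fin.cons_succ, hcons]
    rw [Finset.mul_sum]
    refine Finset.sum_congr rfl fun i _ => ?_
    rw [Finset.sum_comm, Finset.mul_sum]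
    refine Finset.sum_congr rfl fun j _ => ?_
    change _ = gi i j * (((k.factorial : ℝ))⁻¹ * _)
    rw [mul_left_comm]
    congr 1
    rw [Finset.mul_sum]
    refine Finset.sum_congr rfl fun I _ => ?_
    rw [Finset.mul_sum]
    exact Finset.sum_congr rfl fun J _ => by
      simp only [interiorProd_succ, mul_assoc]
      rfl

theorem formInner_comm (hgi : gi.IsSymm) (α β : Frm m k) :
    formInner gi α β = formInner gi β α := by
  simp only [formInner]
  congr 1
  rw [Finset.sum_comm]
  refine Finset.sum_congr rfl fun I _ => Finset.sum_congr rfl fun J _ => ?_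
  rw [mul_comm (α _)]
  congr 1
  exact Finset.prod_congr rfl fun l _ => hgi.apply _ _

/-- The vector dual to a covector. -/
def sharp (θ : Model m →L[ℝ] ℝ) : Model m := ∑ i, ∑ j, (gi i j * θ (coordVec i)) • coordVec j

/-- Exterior and interior multiplication are adjoint. In the recursion, contracting `θ ∧ α` gives
one copy of the right-hand side from the terms `θ(∂_i) α`, and the remaining terms give `k` more
copies by induction; the total is divided by `k + 1`. -/
theorem formInner_wedgeCovector (θ : Model m →L[ℝ] ℝ) (α : Frm m (k - 1)) (β : Frm m k) :
    formInner gi (wedgeCovector (k := k) θ α) β = formInner gi α (interiorProd (sharp gi θ) β) := by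
  induction k with
  | zero =>
    simp [interiorProd_zero_degree, formInner_zero_right, formInner_zero_left, wedgeCovector]
  | succ k ih =>
    have hk : ((k + 1 : ℕ) : ℝ) ≠ 0 := by positivity
    apply mul_left_cancel₀ hk
    rw [mul_formInner]
    have e : ∀ i j, gi i j * formInner gi (interiorProd (coordVec i)
        (wedgeCovector (k := k + 1) θ α)) (interiorProd (coordVec j) β) =
        formInner gi (show Frm m k from α)
            (interiorProd ((gi i j * θ (coordVec i)) • coordVec j) β) +
          gi i j * formInner gi (interiorProd (coordVec i) (show Frm m k from α))
            (interiorProd (coordVec j) (interiorProd (sharp gi θ) β)) := by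
      intro i j
      erw [interiorProd_wedgeCovector (coordVec i) θ α]
      rw [interiorProd_smul_left]
      have h2 := ih (interiorProd (coordVec i) (show Frm m k from α)) (interiorProd (coordVec j) β)
      -- Moving the vector dual to `θ` next to `β` costs a sign, which cancels the one from
      -- contracting an exterior product.
      rw [interiorProd_interiorProd] at h2
      rw [← formInnerL_apply, ← formInnerL_apply] at h2
      erw [← formInnerL_apply, ← formInnerL_apply, ← formInnerL_apply]
      rw [map_sub, sub_apply, map_smul, map_smul, smul_apply]
      erw [h2]
      rw [map_neg]
      simp only [smul_eq_mul]
      erw [formInnerL_apply]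
      ring
    simp only [e, Finset.sum_add_distrib]
    rw [← mul_formInner gi (show Frm m k from α)]
    push_cast
    rw [add_mul, one_mul, add_comm]
    congr 1
    rw [sharp]
    simp only [← formInnerL_apply gi, ← interiorL_apply, map_sum, sum_apply]
    rfl

end FormAlgebra

end

end Rellich

namespace Rellich

noncomputable section

/-! ### Algebra of a metric on the model space -/

section MetricAlgebra

variable {m k : ℕ} {W : Type*} [AddCommGroup W] [Module ℝ W]

/-- The trace of a bilinear map with respect to the inverse metric matrix `gi`. -/
def trace2 (gi : Matrix (Fin (m + 1)) (Fin (m + 1)) ℝ)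
    (B : Model m →ₗ[ℝ] Model m →ₗ[ℝ] W) : W :=
  ∑ i, ∑ j, gi i j • B (coordVec i) (coordVec j)

theorem bilin_apply_coord (B : Model m →ₗ[ℝ] Model m →ₗ[ℝ] W) (u v : Model m) :
    B u v = ∑ a, ∑ b, (u a * v b) • B (coordVec a) (coordVec b) := by
  rw [← sum_coord_smul_map B u, LinearMap.sum_apply]
  refine Finset.sum_congr rfl fun a _ => ?_
  rw [LinearMap.smul_apply, ← sum_coord_smul_map (B (coordVec a)) v, Finset.smul_sum]
  exact Finset.sum_congr rfl fun b _ => smul_smul _ _ _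

/-- The relation between the inverse metric matrices of a metric and of its pullback by `A`. -/
def GiRel (A : Model m →L[ℝ] Model m) (gi gi' : Matrix (Fin (m + 1)) (Fin (m + 1)) ℝ) : Prop :=
  ∀ a b, gi' a b = ∑ i, ∑ j, gi i j * (A (coordVec i) a * A (coordVec j) b)

/-- The relation says that the contravariant tensor `gi` is pushed forward by `A`, so that
contracting it against a pulled-back bilinear map is contracting the image tensor. -/
theorem trace2_natural {A : Model m →L[ℝ] Model m}
    {gi gi' : Matrix (Fin (m + 1)) (Fin (m + 1)) ℝ} (h : GiRel A gi gi')
    (B : Model m →ₗ[ℝ] Model m →ₗ[ℝ] W) :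
    ∑ i, ∑ j, gi i j • B (A (coordVec i)) (A (coordVec j)) = trace2 gi' B := by
  have e : ∀ i j, gi i j • B (A (coordVec i)) (A (coordVec j)) =
      ∑ a, ∑ b, (gi i j * (A (coordVec i) a * A (coordVec j) b)) •
        B (coordVec a) (coordVec b) := by
    intro i j
    rw [bilin_apply_coord B]
    simp only [Finset.smul_sum, smul_smul]
  simp only [e, trace2, h _ _, Finset.sum_smul]
  calc _ = ∑ i, ∑ a, ∑ j, ∑ b, (gi i j * (A (coordVec i) a * A (coordVec j) b)) •
        B (coordVec a) (coordVec b) := Finset.sum_congr rfl fun i _ => Finset.sum_comm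
    _ = ∑ a, ∑ i, ∑ j, ∑ b, (gi i j * (A (coordVec i) a * A (coordVec j) b)) •
        B (coordVec a) (coordVec b) := Finset.sum_comm
    _ = ∑ a, ∑ i, ∑ b, ∑ j, (gi i j * (A (coordVec i) a * A (coordVec j) b)) •
        B (coordVec a) (coordVec b) :=
      Finset.sum_congr rfl fun a _ => Finset.sum_congr rfl fun i _ => Finset.sum_comm
    _ = _ := Finset.sum_congr rfl fun a _ => Finset.sum_comm

/-- By induction through `mul_formInner`: a contraction of a pullback is the pullback of a
contraction with the image vector, and the resulting trace is natural. -/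
theorem formInner_pull {A : Model m →L[ℝ] Model m}
    {gi gi' : Matrix (Fin (m + 1)) (Fin (m + 1)) ℝ} (h : GiRel A gi gi') (α β : Frm m k) :
    formInner gi (pull A α) (pull A β) = formInner gi' α β := by
  induction k with
  | zero =>
    have h0 : (fun i => A ((0 : Fin 0 → Model m) i)) = 0 := Subsingleton.elim _ _
    rw [formInner_zero_degree, formInner_zero_degree, pull_apply, pull_apply, h0]
  | succ k ih =>
    have hk : ((k + 1 : ℕ) : ℝ) ≠ 0 := by positivity
    apply mul_left_cancel₀ hk
    rw [mul_formInner, mul_formInner]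
    simp only [interiorProd_pull]
    have := trace2_natural h (LinearMap.mk₂ ℝ
      (fun u v => formInnerL gi' k (interiorL m (k + 1) u α) (interiorL m (k + 1) v β))
      (by intros; simp only [map_add, add_apply]) (by intros; simp only [map_smul, smul_apply])
      (by intros; simp only [map_add, add_apply]) (by intros; simp only [map_smul, smul_apply]))
    simp only [trace2, LinearMap.mk₂_apply, smul_eq_mul] at this
    refine Eq.trans ?_ this
    exact Finset.sum_congr rfl fun i _ => Finset.sum_congr rfl fun j _ =>
      congrArg _ (ih _ _)

/-- The matrix of a bilinear form in the standard basis. -/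
def gram (G : Model m →L[ℝ] Model m →L[ℝ] ℝ) : Matrix (Fin (m + 1)) (Fin (m + 1)) ℝ :=
  Matrix.of fun i j => G (coordVec i) (coordVec j)

/-- The matrix of an endomorphism in the standard basis. -/
def endMatrix (A : Model m →L[ℝ] Model m) : Matrix (Fin (m + 1)) (Fin (m + 1)) ℝ :=
  Matrix.of fun a i => A (coordVec i) a

theorem endMatrix_mul (A B : Model m →L[ℝ] Model m) :
    endMatrix (A.comp B) = endMatrix A * endMatrix B := by
  ext a i
  simp only [endMatrix, Matrix.of_apply, Matrix.mul_apply, ContinuousLinearMap.comp_apply]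
  have := sum_coord_mul_map ((coordCovec a).comp A) (B (coordVec i))
  simp only [ContinuousLinearMap.comp_apply, coordCovec_apply] at this
  rw [← this]
  exact Finset.sum_congr rfl fun b _ => mul_comm _ _

theorem endMatrix_id : endMatrix (ContinuousLinearMap.id ℝ (Model m)) = 1 := by
  ext a i
  simp [endMatrix, coordVec_apply, Matrix.one_apply]

theorem endMatrix_eq_toMatrix (A : Model m →L[ℝ] Model m) :
    endMatrix A = LinearMap.toMatrix (EuclideanSpace.basisFun (Fin (m + 1)) ℝ).toBasis
      (EuclideanSpace.basisFun (Fin (m + 1)) ℝ).toBasis (A : Model m →ₗ[ℝ] Model m) := by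
  ext a i
  simp [endMatrix, LinearMap.toMatrix_apply, coordVec]

theorem det_endMatrix (A : Model m →L[ℝ] Model m) : (endMatrix A).det = A.det := by
  rw [endMatrix_eq_toMatrix, LinearMap.det_toMatrix]

theorem trace_endMatrix (A : Model m →L[ℝ] Model m) :
    (endMatrix A).trace = LinearMap.trace ℝ (Model m) A := by
  rw [endMatrix_eq_toMatrix, ← LinearMap.trace_eq_matrix_trace]

theorem trace_eq_sum (A : Model m →L[ℝ] Model m) :
    LinearMap.trace ℝ (Model m) A = ∑ i, A (coordVec i) i := by
  rw [← trace_endMatrix]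
  rfl

theorem gram_bilinearComp (G : Model m →L[ℝ] Model m →L[ℝ] ℝ) (A : Model m →L[ℝ] Model m) :
    gram (G.bilinearComp A A) = (endMatrix A).transpose * gram G * endMatrix A := by
  ext i j
  simp only [gram, endMatrix, Matrix.of_apply, Matrix.mul_apply, Matrix.transpose_apply,
    ContinuousLinearMap.bilinearComp_apply]
  have := bilin_apply_coord (LinearMap.mk₂ ℝ (fun u v => G u v) (by simp) (by simp) (by simp)
    (by simp)) (A (coordVec i)) (A (coordVec j))
  simp only [LinearMap.mk₂_apply, smul_eq_mul] at this
  rw [this, Finset.sum_comm]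
  refine Finset.sum_congr rfl fun b _ => ?_
  rw [Finset.sum_mul]
  exact Finset.sum_congr rfl fun a _ => by ring

theorem isUnit_det_endMatrix {A B : Model m →L[ℝ] Model m}
    (h : A.comp B = ContinuousLinearMap.id ℝ (Model m)) : IsUnit (endMatrix A).det := by
  have : endMatrix A * endMatrix B = 1 := by rw [← endMatrix_mul, h, endMatrix_id]
  exact (Matrix.isUnit_iff_isUnit_det _).1 (IsUnit.of_mul_eq_one _ this)

/-- The Gram matrix of the pullback is `Aᵀ g A`; inverting gives `g⁻¹ = A (Aᵀ g A)⁻¹ Aᵀ`. A right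
inverse of `A` suffices because the matrices are square. -/
theorem giRel_gram {A B : Model m →L[ℝ] Model m}
    (h : A.comp B = ContinuousLinearMap.id ℝ (Model m)) (G : Model m →L[ℝ] Model m →L[ℝ] ℝ) :
    GiRel A (gram (G.bilinearComp A A))⁻¹ (gram G)⁻¹ := by
  have hu := isUnit_det_endMatrix h
  have hu' : IsUnit (endMatrix A).transpose.det := by rwa [Matrix.det_transpose]
  have e : (gram G)⁻¹ = endMatrix A * (gram (G.bilinearComp A A))⁻¹ * (endMatrix A).transpose := by
    rw [gram_bilinearComp, Matrix.mul_inv_rev, Matrix.mul_inv_rev, ← mul_assoc,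
      Matrix.mul_nonsing_inv _ hu, one_mul, mul_assoc, Matrix.nonsing_inv_mul _ hu', mul_one]
  intro a b
  rw [e]
  simp only [Matrix.mul_apply, Matrix.transpose_apply, Finset.sum_mul]
  rw [Finset.sum_comm]
  exact Finset.sum_congr rfl fun i _ => Finset.sum_congr rfl fun j _ => by
    simp only [endMatrix, Matrix.of_apply]; ring

/-- The bilinear form is an inner product. -/
structure IsMetric (G : Model m →L[ℝ] Model m →L[ℝ] ℝ) : Prop where
  symm : ∀ u v, G u v = G v u
  pos : ∀ v, v ≠ 0 → 0 < G v v

variable {G : Model m →L[ℝ] Model m →L[ℝ] ℝ}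

theorem IsMetric.pull (hG : IsMetric G) {A : Model m →L[ℝ] Model m}
    (hA : Function.Injective A) : IsMetric (G.bilinearComp A A) where
  symm u v := by simpa using hG.symm _ _
  pos v hv := by simpa using hG.pos (A v) (by simpa using hA.ne (a₂ := 0) hv)

theorem IsMetric.ext_left (hG : IsMetric G) {u v : Model m} (h : ∀ w, G u w = G v w) :
    u = v := by
  by_contra hne
  have h1 := hG.pos (u - v) (sub_ne_zero.2 hne)
  rw [map_sub G, sub_apply, h, sub_self] at h1
  exact lt_irrefl _ h1

theorem gram_quadratic (v : Fin (m + 1) → ℝ) :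
    dotProduct v ((gram G).mulVec v) = G (WithLp.toLp 2 v) (WithLp.toLp 2 v) := by
  have := bilin_apply_coord (LinearMap.mk₂ ℝ (fun u v => G u v) (by simp) (by simp) (by simp)
    (by simp)) (WithLp.toLp 2 v) (WithLp.toLp 2 v)
  simp only [LinearMap.mk₂_apply, smul_eq_mul] at this
  rw [this]
  simp only [dotProduct, Matrix.mulVec, gram, Matrix.of_apply, Finset.mul_sum]
  exact Finset.sum_congr rfl fun i _ => Finset.sum_congr rfl fun j _ => by ring

theorem IsMetric.posDef_gram (hG : IsMetric G) : (gram G).PosDef := by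
  refine Matrix.PosDef.of_dotProduct_mulVec_pos ?_ fun v hv => ?_
  · ext i j
    simp [gram, hG.symm]
  · rw [star_trivial, gram_quadratic]
    exact hG.pos _ (by simpa using hv)

theorem IsMetric.det_pos (hG : IsMetric G) : 0 < (gram G).det := hG.posDef_gram.det_pos

theorem IsMetric.posDef_inv (hG : IsMetric G) : ((gram G)⁻¹).PosDef := hG.posDef_gram.inv

theorem IsMetric.isSymm_inv (hG : IsMetric G) : ((gram G)⁻¹).IsSymm := by
  have := hG.posDef_inv.isHermitian
  ext i j
  simpa using congrFun (congrFun this i) j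

theorem IsMetric.inv_diag_pos (hG : IsMetric G) (i : Fin (m + 1)) : 0 < (gram G)⁻¹ i i :=
  hG.posDef_inv.diag_pos

/-- On coordinate vectors this is the matrix identity `g⁻¹ g = 1`. -/
theorem IsMetric.apply_sharp (hG : IsMetric G) (θ : Model m →L[ℝ] ℝ) (w : Model m) :
    G (sharp (gram G)⁻¹ θ) w = θ w := by
  have key : ∀ l, G (sharp (gram G)⁻¹ θ) (coordVec l) = θ (coordVec l) := by
    intro l
    simp only [sharp, map_sum, map_smul, sum_apply, smul_apply, smul_eq_mul]
    have h1 : (gram G)⁻¹ * gram G = 1 := Matrix.nonsing_inv_mul _ hG.det_pos.ne'.isUnit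
    have h2 : ∀ i, ∑ j, (gram G)⁻¹ i j * θ (coordVec i) * G (coordVec j) (coordVec l) =
        θ (coordVec i) * (1 : Matrix (Fin (m + 1)) (Fin (m + 1)) ℝ) i l := by
      intro i
      rw [← h1, Matrix.mul_apply, Finset.mul_sum]
      exact Finset.sum_congr rfl fun j _ => by simp only [gram, Matrix.of_apply]; ring
    rw [Finset.sum_congr rfl fun i _ => h2 i]
    simp [Matrix.one_apply]
  rw [← sum_coord_mul_map (G (sharp (gram G)⁻¹ θ)) w, ← sum_coord_mul_map θ w]
  simp only [key]

theorem IsMetric.sharp_flat (hG : IsMetric G) (v : Model m) : sharp (gram G)⁻¹ (G v) = v :=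
  hG.ext_left fun w => hG.apply_sharp (G v) w

theorem sharp_coordCovec (gi : Matrix (Fin (m + 1)) (Fin (m + 1)) ℝ) (i : Fin (m + 1)) :
    sharp gi (coordCovec i) = ∑ j, gi i j • coordVec j := by
  simp only [sharp, coordCovec_apply, coordVec_apply]
  rw [Finset.sum_eq_single i]
  · simp
  · intro b _ hb
    simp [hb.symm]
  · simp

/-! #### Christoffel symbols -/

/-- The symbols `Γ` are those of the Levi-Civita connection of a metric with value `G` and
derivative `D`. -/
structure IsLeviCivita (G : Model m →L[ℝ] Model m →L[ℝ] ℝ)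
    (D : Model m →L[ℝ] Model m →L[ℝ] Model m →L[ℝ] ℝ)
    (Γ : Model m →L[ℝ] Model m →L[ℝ] Model m) : Prop where
  symm : ∀ u v, Γ u v = Γ v u
  compat : ∀ w u v, D w u v = G (Γ w u) v + G u (Γ w v)

variable {D : Model m →L[ℝ] Model m →L[ℝ] Model m →L[ℝ] ℝ}

theorem IsLeviCivita.koszul (hG : IsMetric G) {Γ : Model m →L[ℝ] Model m →L[ℝ] Model m}
    (h : IsLeviCivita G D Γ) (u v w : Model m) :
    G (Γ u v) w = 2⁻¹ * (D u v w + D v u w - D w u v) := by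
  rw [h.compat u v w, h.compat v u w, h.compat w u v, h.symm v u, h.symm w u, h.symm w v,
    hG.symm v (Γ u w)]
  ring

/-- The Koszul formula determines `G(Γ(u, v), w)` from `D`. Uniqueness later yields the
transformation law of the Christoffel symbols without computing with their explicit formula. -/
theorem IsLeviCivita.unique (hG : IsMetric G) {Γ Γ' : Model m →L[ℝ] Model m →L[ℝ] Model m}
    (h : IsLeviCivita G D Γ) (h' : IsLeviCivita G D Γ') : Γ = Γ' := by
  ext1 u
  ext1 v
  exact hG.ext_left fun w => by rw [h.koszul hG, h'.koszul hG]

/-- The Christoffel symbols of a metric with inverse matrix `gi` and derivative `D`. -/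
def christ (gi : Matrix (Fin (m + 1)) (Fin (m + 1)) ℝ)
    (D : Model m →L[ℝ] Model m →L[ℝ] Model m →L[ℝ] ℝ) :
    Model m →L[ℝ] Model m →L[ℝ] Model m :=
  LinearMap.toContinuousBilinearMap <| LinearMap.mk₂ ℝ
    (fun u v => ∑ i, ∑ j, (2⁻¹ * gi i j * (D u v (coordVec i) +
      D v u (coordVec i) - D (coordVec i) u v)) • (coordVec j : Model m))
    (by
      intro u u' v
      simp only [map_add, add_apply, ← Finset.sum_add_distrib, ← add_smul]
      exact Finset.sum_congr rfl fun i _ => Finset.sum_congr rfl fun j _ => by ring_nf)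
    (by
      intro c u v
      simp only [map_smul, smul_apply, Finset.smul_sum, smul_smul, smul_eq_mul]
      exact Finset.sum_congr rfl fun i _ => Finset.sum_congr rfl fun j _ => by ring_nf)
    (by
      intro u v v'
      simp only [map_add, add_apply, ← Finset.sum_add_distrib, ← add_smul]
      exact Finset.sum_congr rfl fun i _ => Finset.sum_congr rfl fun j _ => by ring_nf)
    (by
      intro c u v
      simp only [map_smul, smul_apply, Finset.smul_sum, smul_smul, smul_eq_mul]
      exact Finset.sum_congr rfl fun i _ => Finset.sum_congr rfl fun j _ => by ring_nf)

theorem christ_apply (gi : Matrix (Fin (m + 1)) (Fin (m + 1)) ℝ) (u v : Model m) :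
    christ gi D u v = ∑ i, ∑ j, (2⁻¹ * gi i j * (D u v (coordVec i) +
      D v u (coordVec i) - D (coordVec i) u v)) • (coordVec j : Model m) := rfl

/-- The symbols are, by construction, the vector dual to the covector on the right. -/
theorem apply_christ (hG : IsMetric G) (u v w : Model m) :
    G (christ (gram G)⁻¹ D u v) w = 2⁻¹ * (D u v w + D v u w - D w u v) := by
  have h : christ (gram G)⁻¹ D u v =
      sharp (gram G)⁻¹ ((2⁻¹ : ℝ) • (D u v + D v u - (D.flip u).flip v)) := by
    rw [christ_apply, sharp]
    refine Finset.sum_congr rfl fun i _ => Finset.sum_congr rfl fun j _ => ?_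
    congr 1
    simp only [smul_apply, add_apply, sub_apply, ContinuousLinearMap.flip_apply, smul_eq_mul]
    ring
  rw [h, hG.apply_sharp]
  simp only [smul_apply, add_apply, sub_apply, ContinuousLinearMap.flip_apply, smul_eq_mul]

theorem isLeviCivita_christ (hG : IsMetric G) (hD : ∀ w u v, D w u v = D w v u) :
    IsLeviCivita G D (christ (gram G)⁻¹ D) where
  symm u v := hG.ext_left fun w => by
    rw [apply_christ hG, apply_christ hG, hD w u v]; ring
  compat w u v := by
    rw [hG.symm u, apply_christ hG, apply_christ hG, hD u w v, hD v w u, hD w v u]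
    ring

end MetricAlgebra

end

end Rellich

namespace Rellich

noncomputable section

/-! ### Covariant derivatives on the model space -/

section Calculus

variable {m k : ℕ} {s : Set (Model m)} {y : Model m} {Γ : Model m →L[ℝ] Model m →L[ℝ] Model m}

/-- The covariant derivative at `y` of a field of forms, for a connection with symbols `Γ` at
`y`. -/
def covD (s : Set (Model m)) (Γ : Model m →L[ℝ] Model m →L[ℝ] Model m) (w : Model m → Frm m k)
    (y : Model m) : Model m →L[ℝ] Frm m k :=
  fderivWithin ℝ w s y - ((derivationL m k).flip (w y)).comp Γ

theorem covD_apply (w : Model m → Frm m k) (u : Model m) :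
    covD s Γ w y u = fderivWithin ℝ w s y u - derivationAction (Γ u) (w y) := rfl

/-- The covariant derivative at `y` of a vector field. -/
def covV (s : Set (Model m)) (Γ : Model m →L[ℝ] Model m →L[ℝ] Model m) (f : Model m → Model m)
    (y : Model m) : Model m →L[ℝ] Model m :=
  fderivWithin ℝ f s y + Γ.flip (f y)

theorem covV_apply (f : Model m → Model m) (u : Model m) :
    covV s Γ f y u = fderivWithin ℝ f s y u + Γ u (f y) := rfl

theorem covV_const (v u : Model m) :
    covV s Γ (fun _ => v) y u = Γ u v := by
  rw [covV_apply]
  simp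

theorem fderivWithin_bilin_apply {E F G : Type*} [NormedAddCommGroup E] [NormedSpace ℝ E]
    [NormedAddCommGroup F] [NormedSpace ℝ F] [NormedAddCommGroup G] [NormedSpace ℝ G]
    (B : E →L[ℝ] F →L[ℝ] G) (hs : UniqueDiffWithinAt ℝ s y) {f : Model m → E} {g : Model m → F}
    (hf : DifferentiableWithinAt ℝ f s y) (hg : DifferentiableWithinAt ℝ g s y) (u : Model m) :
    fderivWithin ℝ (fun z => B (f z) (g z)) s y u =
      B (f y) (fderivWithin ℝ g s y u) + B (fderivWithin ℝ f s y u) (g y) := by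
  rw [B.fderivWithin_of_bilinear hf hg hs]
  rfl

theorem covD_interiorProd (hs : UniqueDiffWithinAt ℝ s y) {f : Model m → Model m}
    {α : Model m → Frm m k} (hf : DifferentiableWithinAt ℝ f s y)
    (hα : DifferentiableWithinAt ℝ α s y) (u : Model m) :
    covD s Γ (fun z => interiorProd (f z) (α z)) y u =
      interiorProd (covV s Γ f y u) (α y) + interiorProd (f y) (covD s Γ α y u) := by
  have h := fderivWithin_bilin_apply (interiorL m k) hs hf hα u
  simp only [interiorL_apply] at h
  rw [covD_apply, covD_apply, covV_apply, h, interiorProd_add_left]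
  simp only [← interiorL_apply, map_sub]
  simp only [interiorL_apply]
  rw [interiorProd_derivationAction]
  abel

theorem covD_wedgeCovector (hs : UniqueDiffWithinAt ℝ s y) {θ : Model m → Model m →L[ℝ] ℝ}
    {φ : Model m → Frm m (k - 1)} (hθ : DifferentiableWithinAt ℝ θ s y)
    (hφ : DifferentiableWithinAt ℝ φ s y) (u : Model m) :
    covD s Γ (fun z => wedgeCovector (k := k) (θ z) (φ z)) y u =
      wedgeCovector (fderivWithin ℝ θ s y u - (θ y).comp (Γ u)) (φ y) +
        wedgeCovector (θ y) (covD s Γ φ y u) := by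
  have h := fderivWithin_bilin_apply (wedgeL m k) hs hθ hφ u
  simp only [wedgeL_apply] at h
  rw [covD_apply, covD_apply, h]
  simp only [← wedgeL_apply, map_sub, sub_apply]
  simp only [wedgeL_apply]
  rw [derivationAction_wedgeCovector]
  abel

/-- Expanding `C(∂_i)` in the basis and renaming indices matches each term from the derivative of
`g^{ij}` with one from the action of `C` on an argument of `P`. It expresses that the contraction
with a parallel inverse metric commutes with covariant differentiation. -/
theorem sum_deriv_inverse_cancel (gi : Matrix (Fin (m + 1)) (Fin (m + 1)) ℝ)
    (C : Model m →L[ℝ] Model m) (P : Model m →ₗ[ℝ] Model m →ₗ[ℝ] ℝ) :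
    ∑ i, ∑ j, ((-(∑ a, C (coordVec a) i * gi a j) - ∑ a, gi i a * C (coordVec a) j) *
      P (coordVec i) (coordVec j) +
      gi i j * (P (C (coordVec i)) (coordVec j) + P (coordVec i) (C (coordVec j)))) = 0 := by
  have e1 : ∀ i j, P (C (coordVec i)) (coordVec j) =
      ∑ a, C (coordVec i) a * P (coordVec a) (coordVec j) := fun i j => by
    simpa using (sum_coord_smul_map (P.flip (coordVec j)) (C (coordVec i))).symm
  have e2 : ∀ i j, P (coordVec i) (C (coordVec j)) =
      ∑ a, C (coordVec j) a * P (coordVec i) (coordVec a) := fun i j => by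
    simpa using (sum_coord_smul_map (P (coordVec i)) (C (coordVec j))).symm
  have s1 : ∑ i, ∑ j, gi i j * P (C (coordVec i)) (coordVec j) =
      ∑ i, ∑ j, (∑ a, C (coordVec a) i * gi a j) * P (coordVec i) (coordVec j) := by
    simp only [e1, Finset.mul_sum, Finset.sum_mul]
    calc _ = ∑ i, ∑ a, ∑ j, gi i j * (C (coordVec i) a * P (coordVec a) (coordVec j)) :=
          Finset.sum_congr rfl fun i _ => Finset.sum_comm
      _ = ∑ a, ∑ i, ∑ j, gi i j * (C (coordVec i) a * P (coordVec a) (coordVec j)) :=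
          Finset.sum_comm
      _ = ∑ a, ∑ j, ∑ i, gi i j * (C (coordVec i) a * P (coordVec a) (coordVec j)) :=
          Finset.sum_congr rfl fun i _ => Finset.sum_comm
      _ = _ := Finset.sum_congr rfl fun i _ => Finset.sum_congr rfl fun j _ =>
          Finset.sum_congr rfl fun a _ => by ring
  have s2 : ∑ i, ∑ j, gi i j * P (coordVec i) (C (coordVec j)) =
      ∑ i, ∑ j, (∑ a, gi i a * C (coordVec a) j) * P (coordVec i) (coordVec j) := by
    simp only [e2, Finset.mul_sum, Finset.sum_mul]
    refine Finset.sum_congr rfl fun i _ => ?_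
    rw [Finset.sum_comm]
    exact Finset.sum_congr rfl fun j _ => Finset.sum_congr rfl fun a _ => by ring
  simp only [mul_add, sub_mul, neg_mul, Finset.sum_add_distrib, Finset.sum_sub_distrib,
    Finset.sum_neg_distrib, s1, s2]
  ring

/-- The derivative of the inverse metric matrix `gi` is the one of a metric that is parallel for
the connection with symbols `Γ` at `y`. -/
structure IsParallelInv (s : Set (Model m)) (Γ : Model m →L[ℝ] Model m →L[ℝ] Model m)
    (gi : Model m → Matrix (Fin (m + 1)) (Fin (m + 1)) ℝ) (y : Model m) : Prop where
  diff : ∀ i j, DifferentiableWithinAt ℝ (fun z => gi z i j) s y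
  deriv : ∀ i j u, fderivWithin ℝ (fun z => gi z i j) s y u =
    -(∑ a, Γ u (coordVec a) i * gi y a j) - ∑ a, gi y i a * Γ u (coordVec a) j

/-- Metric compatibility on forms, by induction on the degree: in `mul_formInner` the derivatives of
`g^{ij}` cancel against the terms `Γ(u, ∂_i)` coming from the covariant derivative of the coordinate
fields. -/
theorem hasFDerivWithinAt_formInner (hs : UniqueDiffWithinAt ℝ s y)
    {gi : Model m → Matrix (Fin (m + 1)) (Fin (m + 1)) ℝ} (hgi : IsParallelInv s Γ gi y)
    {α β : Model m → Frm m k} (hα : DifferentiableWithinAt ℝ α s y)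
    (hβ : DifferentiableWithinAt ℝ β s y) :
    HasFDerivWithinAt (fun z => formInner (gi z) (α z) (β z))
      (((formInnerL (gi y) k).flip (β y)).comp (covD s Γ α y) +
        (formInnerL (gi y) k (α y)).comp (covD s Γ β y)) s y := by
  induction k with
  | zero =>
    have h := (formInnerL (gi y) 0).hasFDerivWithinAt_of_bilinear hα.hasFDerivWithinAt
      hβ.hasFDerivWithinAt
    have e : (fun z => formInner (gi z) (α z) (β z)) =
        fun z => formInnerL (gi y) 0 (α z) (β z) := by
      funext z
      rw [formInnerL_apply, formInner_zero_degree, formInner_zero_degree]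
    rw [e]
    refine h.congr_fderiv ?_
    ext u
    have hz : ∀ w : Model m → Frm m 0, covD s Γ w y u = fderivWithin ℝ w s y u := fun w => by
      rw [covD_apply, derivationAction_zero_degree, sub_zero]
    simp only [add_apply, ContinuousLinearMap.comp_apply, ContinuousLinearMap.flip_apply, hz,
      ContinuousLinearMap.precompR_apply, ContinuousLinearMap.precompL_apply]
    exact add_comm _ _
  | succ k ih =>
    have hk : ((k + 1 : ℕ) : ℝ) ≠ 0 := by positivity
    have hd : ∀ (i : Fin (m + 1)) (w : Model m → Frm m (k + 1)),
        DifferentiableWithinAt ℝ w s y →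
        DifferentiableWithinAt ℝ (fun z => (interiorProd (coordVec i) (w z) : Frm m k)) s y :=
      fun i w hw => (interiorL m (k + 1) (coordVec i)).differentiableAt.comp_differentiableWithinAt
        y hw
    have e : (fun z => formInner (gi z) (α z) (β z)) = fun z => ((k + 1 : ℕ) : ℝ)⁻¹ *
        ∑ i, ∑ j, gi z i j * formInner (gi z) (interiorProd (coordVec i) (α z) : Frm m k)
          (interiorProd (coordVec j) (β z) : Frm m k) := by
      funext z
      rw [eq_inv_mul_iff_mul_eq₀ hk]
      exact mul_formInner _ _ _
    rw [e]
    have h := HasFDerivWithinAt.const_mul (HasFDerivWithinAt.fun_sum (u := Finset.univ)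
      fun i _ => HasFDerivWithinAt.fun_sum (u := Finset.univ) fun j _ =>
        (hgi.diff i j).hasFDerivWithinAt.mul (ih (hd i α hα) (hd j β hβ))) ((k + 1 : ℕ) : ℝ)⁻¹
    refine h.congr_fderiv ?_
    ext u
    have c1 : ∀ (i : Fin (m + 1)) (w : Model m → Frm m (k + 1)),
        DifferentiableWithinAt ℝ w s y →
        covD s Γ (fun z => (interiorProd (coordVec i) (w z) : Frm m k)) y u =
          (interiorProd (Γ u (coordVec i)) (w y) : Frm m k) +
            (interiorProd (coordVec i) (covD s Γ w y u) : Frm m k) := by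
      intro i w hw
      have := covD_interiorProd (Γ := Γ) hs
        (differentiableWithinAt_const (coordVec i : Model m)) hw u
      rw [covV_const] at this
      exact this
    have hP := sum_deriv_inverse_cancel (gi y) (Γ u) (LinearMap.mk₂ ℝ
      (fun u v => formInnerL (gi y) k (interiorL m (k + 1) u (α y)) (interiorL m (k + 1) v (β y)))
      (by intros; simp only [map_add, add_apply]) (by intros; simp only [map_smul, smul_apply])
      (by intros; simp only [map_add, add_apply]) (by intros; simp only [map_smul, smul_apply]))
    simp only [LinearMap.mk₂_apply] at hP
    have r1 : ((k + 1 : ℕ) : ℝ) * formInner (gi y) (covD s Γ α y u) (β y) =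
        ∑ i, ∑ j, gi y i j * formInner (k := k) (gi y) (interiorProd (coordVec i)
          (covD s Γ α y u)) (interiorProd (coordVec j) (β y)) := mul_formInner _ _ _
    have r2 : ((k + 1 : ℕ) : ℝ) * formInner (gi y) (α y) (covD s Γ β y u) =
        ∑ i, ∑ j, gi y i j * formInner (k := k) (gi y) (interiorProd (coordVec i) (α y))
          (interiorProd (coordVec j) (covD s Γ β y u)) := mul_formInner _ _ _
    simp only [smul_apply, sum_apply, add_apply, ContinuousLinearMap.comp_apply,
      ContinuousLinearMap.flip_apply, smul_eq_mul, formInnerL_apply]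
    rw [inv_mul_eq_iff_eq_mul₀ hk, mul_add, r1, r2, ← Finset.sum_add_distrib, ← sub_eq_zero,
      ← Finset.sum_sub_distrib]
    refine Eq.trans (Finset.sum_congr rfl fun i _ => ?_) hP
    rw [← Finset.sum_add_distrib, ← Finset.sum_sub_distrib]
    refine Finset.sum_congr rfl fun j _ => ?_
    rw [c1 i α hα, c1 j β hβ, hgi.deriv i j u]
    simp only [← formInnerL_apply, map_add, add_apply, interiorL_apply]
    generalize (interiorProd (coordVec i) (covD s Γ α y u) : Frm m k) = X
    generalize (interiorProd (coordVec j) (covD s Γ β y u) : Frm m k) = Y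
    ring

theorem differentiableWithinAt_formInner (hs : UniqueDiffWithinAt ℝ s y)
    {gi : Model m → Matrix (Fin (m + 1)) (Fin (m + 1)) ℝ} (hgi : IsParallelInv s Γ gi y)
    {α β : Model m → Frm m k} (hα : DifferentiableWithinAt ℝ α s y)
    (hβ : DifferentiableWithinAt ℝ β s y) :
    DifferentiableWithinAt ℝ (fun z => formInner (gi z) (α z) (β z)) s y :=
  (hasFDerivWithinAt_formInner hs hgi hα hβ).differentiableWithinAt

theorem fderivWithin_formInner (hs : UniqueDiffWithinAt ℝ s y)
    {gi : Model m → Matrix (Fin (m + 1)) (Fin (m + 1)) ℝ} (hgi : IsParallelInv s Γ gi y)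
    {α β : Model m → Frm m k} (hα : DifferentiableWithinAt ℝ α s y)
    (hβ : DifferentiableWithinAt ℝ β s y) (u : Model m) :
    fderivWithin ℝ (fun z => formInner (gi z) (α z) (β z)) s y u =
      formInner (gi y) (covD s Γ α y u) (β y) + formInner (gi y) (α y) (covD s Γ β y u) := by
  rw [(hasFDerivWithinAt_formInner hs hgi hα hβ).fderivWithin hs]
  rfl

/-! #### Exterior derivative, codifferential and divergence -/

theorem fderivCompContinuousLinearMap_id (α : Frm m k) (A : Model m →L[ℝ] Model m) :
    α.fderivCompContinuousLinearMap (ContinuousLinearMap.id ℝ (Model m)) A =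
      derivationAction A α := by
  ext v
  rw [ContinuousAlternatingMap.fderivCompContinuousLinearMap_apply, derivationAction_apply]
  refine Finset.sum_congr rfl fun l _ => ?_
  congr 1
  funext i
  rcases eq_or_ne i l with rfl | h
  · simp
  · simp [Function.update_of_ne h]

/-- Partial and covariant derivatives differ by terms containing `Γ(u, v)`; these disappear on
alternation because `Γ` is symmetric. -/
theorem extDerivWithin_eq_sum (hΓ : ∀ u v, Γ u v = Γ v u) (w : Model m → Frm m k) :
    extDerivWithin w s y =
      ∑ i, wedgeCovector (k := k + 1) (coordCovec i) (covD s Γ w y (coordVec i)) := by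
  rw [← alternatizeUncurryFin_eq_sum, extDerivWithin]
  have h := ContinuousAlternatingMap.alternatizeUncurryFin_fderivCompContinuousLinearMap_eq_zero
    (w y) (ContinuousLinearMap.id ℝ (Model m)) hΓ
  have e : fderivWithin ℝ w s y = covD s Γ w y + (w y).fderivCompContinuousLinearMap
      (ContinuousLinearMap.id ℝ (Model m)) ∘L Γ := by
    ext1 u
    rw [add_apply, covD_apply, ContinuousLinearMap.comp_apply, fderivCompContinuousLinearMap_id]
    abel
  rw [e, ContinuousAlternatingMap.alternatizeUncurryFin_add, h, add_zero]

/-- The codifferential of a field of forms. -/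
def codL (s : Set (Model m)) (Γ : Model m →L[ℝ] Model m →L[ℝ] Model m)
    (gi : Matrix (Fin (m + 1)) (Fin (m + 1)) ℝ) (w : Model m → Frm m k) (y : Model m) :
    Frm m (k - 1) :=
  -∑ i, ∑ j, gi i j • interiorProd (coordVec i) (covD s Γ w y (coordVec j))

/-- The vector field with components `⟨dx^i ∧ φ, α⟩`. -/
def pairField (gi : Matrix (Fin (m + 1)) (Fin (m + 1)) ℝ) (φ : Frm m (k - 1)) (α : Frm m k) :
    Model m :=
  ∑ i, formInner gi (wedgeCovector (k := k) (coordCovec i) φ) α • coordVec i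

theorem sum_smul_coordVec_apply (c : Fin (m + 1) → ℝ) (i : Fin (m + 1)) :
    (∑ j, c j • (coordVec j : Model m)) i = c i := by
  simp [coordVec_apply]

theorem pairField_apply (gi : Matrix (Fin (m + 1)) (Fin (m + 1)) ℝ) (φ : Frm m (k - 1))
    (α : Frm m k) (i : Fin (m + 1)) : pairField gi φ α i =
      formInner gi (wedgeCovector (k := k) (coordCovec i) φ) α :=
  sum_smul_coordVec_apply _ _

theorem wedgeCovector_eq_sum (θ : Model m →L[ℝ] ℝ) (φ : Frm m (k - 1)) :
    wedgeCovector (k := k) θ φ =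
      ∑ i, θ (coordVec i) • wedgeCovector (k := k) (coordCovec i) φ := by
  have h : θ = ∑ i, θ (coordVec i) • coordCovec i := by
    ext1 v
    rw [sum_apply, ← sum_coord_mul_map θ v]
    exact Finset.sum_congr rfl fun i _ => mul_comm _ _
  conv_lhs => rw [h]
  simp only [← wedgeL_apply, map_sum, map_smul, sum_apply, smul_apply]

theorem differentiableWithinAt_wedgeCovector {θ : Model m → Model m →L[ℝ] ℝ}
    {φ : Model m → Frm m (k - 1)} (hθ : DifferentiableWithinAt ℝ θ s y)
    (hφ : DifferentiableWithinAt ℝ φ s y) :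
    DifferentiableWithinAt ℝ (fun z => wedgeCovector (k := k) (θ z) (φ z)) s y :=
  ((wedgeL m k).hasFDerivWithinAt_of_bilinear hθ.hasFDerivWithinAt
    hφ.hasFDerivWithinAt).differentiableWithinAt

theorem differentiableWithinAt_interiorProd {f : Model m → Model m}
    {α : Model m → Frm m k} (hf : DifferentiableWithinAt ℝ f s y)
    (hα : DifferentiableWithinAt ℝ α s y) :
    DifferentiableWithinAt ℝ (fun z => interiorProd (f z) (α z)) s y :=
  ((interiorL m k).hasFDerivWithinAt_of_bilinear hf.hasFDerivWithinAt
    hα.hasFDerivWithinAt).differentiableWithinAt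

theorem differentiableWithinAt_pairField (hs : UniqueDiffWithinAt ℝ s y)
    {gi : Model m → Matrix (Fin (m + 1)) (Fin (m + 1)) ℝ} (hgi : IsParallelInv s Γ gi y)
    {φ : Model m → Frm m (k - 1)} {α : Model m → Frm m k}
    (hφ : DifferentiableWithinAt ℝ φ s y) (hα : DifferentiableWithinAt ℝ α s y) :
    DifferentiableWithinAt ℝ (fun z => pairField (gi z) (φ z) (α z)) s y :=
  DifferentiableWithinAt.fun_sum fun _ _ => (differentiableWithinAt_formInner hs hgi
    (differentiableWithinAt_wedgeCovector (differentiableWithinAt_const _) hφ) hα).smul_const _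

theorem trace_covV (hs : UniqueDiffWithinAt ℝ s y) (hΓ : ∀ u v, Γ u v = Γ v u)
    {f : Model m → Model m} (hf : DifferentiableWithinAt ℝ f s y) :
    LinearMap.trace ℝ (Model m) (covV s Γ f y) =
      ∑ i, fderivWithin ℝ (fun z => f z i) s y (coordVec i) +
        LinearMap.trace ℝ (Model m) (Γ (f y)) := by
  rw [trace_eq_sum, trace_eq_sum, ← Finset.sum_add_distrib]
  refine Finset.sum_congr rfl fun i _ => ?_
  have h : fderivWithin ℝ (fun z => f z i) s y = (coordCovec i).comp (fderivWithin ℝ f s y) :=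
    ((coordCovec i).hasFDerivAt.comp_hasFDerivWithinAt y hf.hasFDerivWithinAt).fderivWithin hs
  rw [h, covV_apply, hΓ]
  rfl

/-- The divergence of `⟨dx^i ∧ φ, α⟩ ∂_i` is `⟨dφ, α⟩ - ⟨φ, δα⟩`. -/
theorem trace_covV_pairField (hs : UniqueDiffWithinAt ℝ s y) (hΓ : ∀ u v, Γ u v = Γ v u)
    {gi : Model m → Matrix (Fin (m + 1)) (Fin (m + 1)) ℝ} (hgi : IsParallelInv s Γ gi y)
    (hsymm : (gi y).IsSymm)
    {φ : Model m → Frm m (k - 1)} {α : Model m → Frm m k}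
    (hφ : DifferentiableWithinAt ℝ φ s y) (hα : DifferentiableWithinAt ℝ α s y) :
    LinearMap.trace ℝ (Model m) (covV s Γ (fun z => pairField (gi z) (φ z) (α z)) y) =
      formInner (gi y) (∑ i, wedgeCovector (k := k) (coordCovec i) (covD s Γ φ y (coordVec i)))
        (α y) - formInner (gi y) (φ y) (codL s Γ (gi y) α y) := by
  rw [trace_covV hs hΓ (differentiableWithinAt_pairField hs hgi hφ hα)]
  simp only [pairField_apply]
  have h1 : ∀ i, fderivWithin ℝ (fun z => formInner (gi z)
      (wedgeCovector (k := k) (coordCovec i) (φ z)) (α z)) s y (coordVec i) =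
      formInner (gi y) (wedgeCovector (coordCovec i) (covD s Γ φ y (coordVec i))) (α y) -
        formInner (gi y) (wedgeCovector (k := k) ((coordCovec i).comp (Γ (coordVec i))) (φ y))
          (α y) +
        formInner (gi y) (φ y) (interiorProd (sharp (gi y) (coordCovec i))
          (covD s Γ α y (coordVec i))) := by
    intro i
    rw [fderivWithin_formInner hs hgi
      (differentiableWithinAt_wedgeCovector (differentiableWithinAt_const _) hφ) hα,
      covD_wedgeCovector hs (differentiableWithinAt_const _) hφ, ← formInner_wedgeCovector]
    simp only [fderivWithin_const_apply, zero_apply, zero_sub]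
    rw [← wedgeL_apply, map_neg, neg_apply, ← formInnerL_apply, map_add, map_neg, add_apply,
      neg_apply]
    simp only [wedgeL_apply, formInnerL_apply]
    ring
  -- The derivatives of the constant covectors `dx^i` contribute precisely the trace of `Γ` that
  -- occurs in the coordinate expression of the divergence, so the two cancel.
  have h2 : ∑ i, formInner (gi y) (wedgeCovector (k := k)
      ((coordCovec i).comp (Γ (coordVec i))) (φ y)) (α y) =
      LinearMap.trace ℝ (Model m) (Γ (pairField (gi y) (φ y) (α y))) := by
    simp only [wedgeCovector_eq_sum ((coordCovec _).comp _), ← formInnerL_apply, map_sum,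
      map_smul, sum_apply, smul_apply, smul_eq_mul]
    rw [trace_eq_sum]
    refine Finset.sum_congr rfl fun i _ => ?_
    simp only [pairField, map_sum, map_smul, sum_apply, smul_apply]
    rw [WithLp.ofLp_sum, Finset.sum_apply]
    refine Finset.sum_congr rfl fun j _ => ?_
    rw [ContinuousLinearMap.comp_apply, coordCovec_apply, hΓ (coordVec i), mul_comm]
    rfl
  -- By adjointness `dx^i` becomes the contraction with its dual vector, which reassembles the
  -- codifferential; symmetry of `gi` is needed to exchange the two indices.
  have h3 : ∑ i, formInner (gi y) (φ y) (interiorProd (sharp (gi y) (coordCovec i))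
      (covD s Γ α y (coordVec i))) = -formInner (gi y) (φ y) (codL s Γ (gi y) α y) := by
    rw [codL]
    simp only [← formInnerL_apply, map_neg, neg_neg, map_sum, sharp_coordCovec]
    rw [Finset.sum_comm]
    refine Finset.sum_congr rfl fun i _ => ?_
    simp only [← interiorL_apply, map_sum, sum_apply, map_smul, smul_apply]
    exact Finset.sum_congr rfl fun j _ => by rw [hsymm.apply]
  rw [Finset.sum_congr rfl fun i _ => h1 i, Finset.sum_add_distrib, Finset.sum_sub_distrib, h2,
    h3]
  have h4 : ∑ i, formInner (gi y) (wedgeCovector (k := k) (coordCovec i)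
      (covD s Γ φ y (coordVec i))) (α y) = formInner (gi y)
        (∑ i, wedgeCovector (k := k) (coordCovec i) (covD s Γ φ y (coordVec i))) (α y) := by
    simp only [← formInnerL_apply, map_sum, sum_apply]
  rw [h4]
  ring

end Calculus

end

end Rellich

namespace Rellich

noncomputable section

/-! ### Calculus of a metric on the model space -/

section MatrixCalculus

/-! ### Determinants and inverses of matrix-valued functions. -/

variable {E : Type*} [NormedAddCommGroup E] [NormedSpace ℝ E] {ι : Type*} [Fintype ι]
  [DecidableEq ι] {s : Set E} {y : E} {n : WithTop ℕ∞}

theorem contDiffWithinAt_det {A : E → Matrix ι ι ℝ}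
    (hA : ∀ i j, ContDiffWithinAt ℝ n (fun z => A z i j) s y) :
    ContDiffWithinAt ℝ n (fun z => (A z).det) s y := by
  simp only [Matrix.det_apply']
  exact ContDiffWithinAt.sum fun σ _ =>
    contDiffWithinAt_const.mul (contDiffWithinAt_prod fun i _ => hA _ _)

/-- Cramer's rule: the entries are cofactors, which are themselves determinants, divided by the
determinant. -/
theorem contDiffWithinAt_matrix_inv {A : E → Matrix ι ι ℝ}
    (hA : ∀ i j, ContDiffWithinAt ℝ n (fun z => A z i j) s y) (hy : (A y).det ≠ 0) (i j : ι) :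
    ContDiffWithinAt ℝ n (fun z => (A z)⁻¹ i j) s y := by
  simp only [Matrix.inv_def, Ring.inverse_eq_inv', Matrix.smul_apply, smul_eq_mul]
  refine (contDiffWithinAt_det hA).inv hy |>.mul ?_
  simp only [Matrix.adjugate_apply]
  refine contDiffWithinAt_det fun a b => ?_
  by_cases h : a = j
  · subst h
    simp only [Matrix.updateRow_self]
    exact contDiffWithinAt_const
  · simp only [Matrix.updateRow_ne h]
    exact hA _ _

/-- Jacobi's formula, from the product rule in the Leibniz expansion. -/
theorem hasFDerivWithinAt_det {A : E → Matrix ι ι ℝ} {A' : ι → ι → E →L[ℝ] ℝ}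
    (hA : ∀ i j, HasFDerivWithinAt (fun z => A z i j) (A' i j) s y) :
    HasFDerivWithinAt (fun z => (A z).det) (∑ i, ∑ j, (A y).adjugate i j • A' j i) s y := by
  have h : HasFDerivWithinAt (fun z => (A z).det)
      (∑ σ : Equiv.Perm ι, ((Equiv.Perm.sign σ : ℤ) : ℝ) •
        ∑ i, (∏ j ∈ Finset.univ.erase i, A y (σ j) j) • A' (σ i) i) s y := by
    simp only [Matrix.det_apply']
    refine HasFDerivWithinAt.fun_sum fun σ _ => ?_
    refine HasFDerivWithinAt.const_mul ?_ _
    have := HasFDerivWithinAt.finsetProd (u := Finset.univ) (g := fun i z => A z (σ i) i)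
      (g' := fun i => A' (σ i) i) (fun i _ => hA (σ i) i)
    simpa using this
  refine h.congr_fderiv ?_
  ext u
  simp only [sum_apply, smul_apply, smul_eq_mul, Finset.mul_sum]
  rw [Finset.sum_comm]
  refine Finset.sum_congr rfl fun i _ => ?_
  -- By Cramer's rule this sum is the determinant with the column `i` differentiated.
  have h2 : ∑ j, (A y).adjugate i j * A' j i u = ((A y).updateCol i fun j => A' j i u).det := by
    rw [← Matrix.cramer_apply, Matrix.cramer_eq_adjugate_mulVec]
    rfl
  rw [h2, Matrix.det_apply']
  refine Finset.sum_congr rfl fun σ _ => ?_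
  congr 1
  rw [← Finset.mul_prod_erase Finset.univ _ (Finset.mem_univ i), mul_comm]
  congr 1
  · simp
  · exact Finset.prod_congr rfl fun j hj => by
      rw [Matrix.updateCol_ne (Finset.ne_of_mem_erase hj)]

end MatrixCalculus

/-! ### Christoffel symbols, inverse matrix and volume density of a metric field. -/

section MetricCalculus

variable {m k : ℕ} {s : Set (Model m)} {y : Model m}
  {G : Model m → Model m →L[ℝ] Model m →L[ℝ] ℝ}

/-- The bilinear forms `G` are inner products near `y` in `s` that depend differentiably on the
point. -/
structure IsMetricNear (s : Set (Model m)) (G : Model m → Model m →L[ℝ] Model m →L[ℝ] ℝ)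
    (y : Model m) : Prop where
  mem : y ∈ s
  uniq : UniqueDiffWithinAt ℝ s y
  smooth : ContDiffWithinAt ℝ 1 G s y
  metric : ∀ᶠ z in nhdsWithin y s, IsMetric (G z)

namespace IsMetricNear

theorem metric_self (h : IsMetricNear s G y) : IsMetric (G y) := h.metric.self_of_nhdsWithin h.mem

theorem differentiableWithinAt (h : IsMetricNear s G y) : DifferentiableWithinAt ℝ G s y :=
  h.smooth.differentiableWithinAt one_ne_zero

theorem fderivWithin_apply (h : IsMetricNear s G y) (w u v : Model m) :
    fderivWithin ℝ (fun z => G z u v) s y w = fderivWithin ℝ G s y w u v := by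
  have h1 := h.differentiableWithinAt.hasFDerivWithinAt
  have h2 := (h1.clm_apply (hasFDerivWithinAt_const u y s)).clm_apply
    (hasFDerivWithinAt_const v y s)
  rw [h2.fderivWithin h.uniq]
  simp

theorem fderivWithin_symm (h : IsMetricNear s G y) (w u v : Model m) :
    fderivWithin ℝ G s y w u v = fderivWithin ℝ G s y w v u := by
  rw [← h.fderivWithin_apply, ← h.fderivWithin_apply]
  have : (fun z => G z u v) =ᶠ[nhdsWithin y s] fun z => G z v u :=
    h.metric.mono fun z hz => hz.symm u v
  rw [this.fderivWithin_eq_of_mem h.mem]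

end IsMetricNear

/-- The Christoffel symbols at `y` of a field of bilinear forms. -/
def christoffelL (s : Set (Model m)) (G : Model m → Model m →L[ℝ] Model m →L[ℝ] ℝ)
    (y : Model m) : Model m →L[ℝ] Model m →L[ℝ] Model m :=
  christ (gram (G y))⁻¹ (fderivWithin ℝ G s y)

namespace IsMetricNear

theorem isLeviCivita (h : IsMetricNear s G y) :
    IsLeviCivita (G y) (fderivWithin ℝ G s y) (christoffelL s G y) :=
  isLeviCivita_christ h.metric_self h.fderivWithin_symm

theorem contDiffWithinAt_gram (h : IsMetricNear s G y) (i j : Fin (m + 1)) :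
    ContDiffWithinAt ℝ 1 (fun z => gram (G z) i j) s y :=
  (h.smooth.clm_apply contDiffWithinAt_const).clm_apply contDiffWithinAt_const

theorem fderivWithin_gram (h : IsMetricNear s G y) (u : Model m) (i j : Fin (m + 1)) :
    fderivWithin ℝ (fun z => gram (G z) i j) s y u =
      ∑ a, christoffelL s G y u (coordVec i) a * gram (G y) a j +
        ∑ a, gram (G y) i a * christoffelL s G y u (coordVec j) a := by
  refine (h.fderivWithin_apply u (coordVec i) (coordVec j)).trans ?_
  rw [h.isLeviCivita.compat]
  congr 1
  · have := sum_coord_mul_map ((G y).flip (coordVec j)) (christoffelL s G y u (coordVec i))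
    exact this.symm
  · have := sum_coord_mul_map (G y (coordVec i)) (christoffelL s G y u (coordVec j))
    rw [← this]
    exact Finset.sum_congr rfl fun a _ => mul_comm _ _

/-- Differentiate `g⁻¹ g = 1` and insert `∂g = Cᵀ g + g C`, where `C` is the matrix of `Γ(u, ·)`;
the result is `∂(g⁻¹) = -C g⁻¹ - g⁻¹ Cᵀ`. -/
theorem isParallelInv (h : IsMetricNear s G y) :
    IsParallelInv s (christoffelL s G y) (fun z => (gram (G z))⁻¹) y where
  diff i j := (contDiffWithinAt_matrix_inv h.contDiffWithinAt_gram
    h.metric_self.det_pos.ne' i j).differentiableWithinAt one_ne_zero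
  deriv i j u := by
    have hd : ∀ i j, DifferentiableWithinAt ℝ (fun z => (gram (G z))⁻¹ i j) s y := fun i j =>
      (contDiffWithinAt_matrix_inv h.contDiffWithinAt_gram
        h.metric_self.det_pos.ne' i j).differentiableWithinAt one_ne_zero
    have hg : ∀ i j, DifferentiableWithinAt ℝ (fun z => gram (G z) i j) s y := fun i j =>
      (h.contDiffWithinAt_gram i j).differentiableWithinAt one_ne_zero
    set g := gram (G y)
    set C := endMatrix (christoffelL s G y u)
    let g' : Matrix (Fin (m + 1)) (Fin (m + 1)) ℝ :=
      Matrix.of fun i j => fderivWithin ℝ (fun z => gram (G z) i j) s y u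
    let q' : Matrix (Fin (m + 1)) (Fin (m + 1)) ℝ :=
      Matrix.of fun i j => fderivWithin ℝ (fun z => (gram (G z))⁻¹ i j) s y u
    have hg' : g' = C.transpose * g + g * C := by
      ext i j
      exact h.fderivWithin_gram u i j
    have hu : IsUnit g.det := h.metric_self.det_pos.ne'.isUnit
    have hprod : q' * g + g⁻¹ * g' = 0 := by
      ext i j
      have e : (fun z => ∑ a, (gram (G z))⁻¹ i a * gram (G z) a j) =ᶠ[nhdsWithin y s]
          fun _ => (1 : Matrix (Fin (m + 1)) (Fin (m + 1)) ℝ) i j := by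
        filter_upwards [h.metric] with z hz
        rw [← Matrix.mul_apply, Matrix.nonsing_inv_mul _ hz.det_pos.ne'.isUnit]
      have h0 := e.fderivWithin_eq_of_mem (𝕜 := ℝ) h.mem
      have h1 : HasFDerivWithinAt (fun z => ∑ a, (gram (G z))⁻¹ i a * gram (G z) a j)
          (∑ a, (g⁻¹ i a • fderivWithin ℝ (fun z => gram (G z) a j) s y +
            g a j • fderivWithin ℝ (fun z => (gram (G z))⁻¹ i a) s y)) s y :=
        HasFDerivWithinAt.fun_sum fun a _ =>
          (hd i a).hasFDerivWithinAt.mul (hg a j).hasFDerivWithinAt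
      rw [HasFDerivWithinAt.fderivWithin h1 h.uniq] at h0
      have h2 := congrArg (fun L : Model m →L[ℝ] ℝ => L u) h0
      simp only [sum_apply, add_apply, smul_apply, smul_eq_mul, fderivWithin_const_apply,
        zero_apply, Finset.sum_add_distrib] at h2
      simp only [Matrix.add_apply, Matrix.mul_apply, Matrix.zero_apply]
      rw [← h2, add_comm]
      congr 1
      exact Finset.sum_congr rfl fun a _ => mul_comm _ _
    have hq : q' = -(C * g⁻¹) - g⁻¹ * C.transpose := by
      have h3 : q' * g = -(g⁻¹ * g') := eq_neg_of_add_eq_zero_left hprod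
      have h4 : q' = -(g⁻¹ * g') * g⁻¹ := by
        rw [← h3, mul_assoc, Matrix.mul_nonsing_inv _ hu, mul_one]
      rw [h4, hg', mul_add, ← mul_assoc g⁻¹ g C, Matrix.nonsing_inv_mul _ hu, one_mul, neg_mul,
        add_mul, ← mul_assoc, mul_assoc _ g, Matrix.mul_nonsing_inv _ hu, mul_one]
      abel
    exact congrFun (congrFun hq i) j

/-- By Jacobi's formula and `∂g = Cᵀ g + g C` the derivative of `det g` is `2 det g tr C`; the
square root removes the factor `2`. -/
theorem hasFDerivWithinAt_sqrt_det (h : IsMetricNear s G y) :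
    ∃ L : Model m →L[ℝ] ℝ,
      HasFDerivWithinAt (fun z => Real.sqrt (gram (G z)).det) L s y ∧
      ∀ u, L u = Real.sqrt (gram (G y)).det *
        LinearMap.trace ℝ (Model m) (christoffelL s G y u) := by
  have hg : ∀ i j, DifferentiableWithinAt ℝ (fun z => gram (G z) i j) s y := fun i j =>
    (h.contDiffWithinAt_gram i j).differentiableWithinAt one_ne_zero
  have hpos := h.metric_self.det_pos
  have h1 := (hasFDerivWithinAt_det fun i j => (hg i j).hasFDerivWithinAt).sqrt hpos.ne'
  refine ⟨_, h1, fun u => ?_⟩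
  set g := gram (G y)
  set C := endMatrix (christoffelL s G y u)
  let g' : Matrix (Fin (m + 1)) (Fin (m + 1)) ℝ :=
    Matrix.of fun i j => fderivWithin ℝ (fun z => gram (G z) i j) s y u
  have hg' : g' = C.transpose * g + g * C := by
    ext i j
    exact h.fderivWithin_gram u i j
  have ht : ∑ i, ∑ j, g.adjugate i j * g' j i = 2 * g.det * C.trace := by
    have : ∑ i, ∑ j, g.adjugate i j * g' j i = (g.adjugate * g').trace := rfl
    rw [this, hg', mul_add, Matrix.trace_add, ← mul_assoc g.adjugate g C, Matrix.adjugate_mul,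
      Matrix.trace_mul_comm, mul_assoc, Matrix.mul_adjugate]
    simp
    ring
  have hs : Real.sqrt g.det * Real.sqrt g.det = g.det := Real.mul_self_sqrt hpos.le
  have hne : Real.sqrt g.det ≠ 0 := (Real.sqrt_pos.2 hpos).ne'
  simp only [smul_apply, sum_apply, smul_eq_mul]
  change 1 / (2 * Real.sqrt g.det) * ∑ i, ∑ j, g.adjugate i j * g' j i = _
  rw [ht, ← trace_endMatrix]
  field_simp
  rw [sq, hs]

/-- The divergence of a vector field in terms of the density `√det G`. -/
theorem sum_fderivWithin_density (h : IsMetricNear s G y) {f : Model m → Model m}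
    (hf : DifferentiableWithinAt ℝ f s y) :
    ∑ i, fderivWithin ℝ (fun z => Real.sqrt (gram (G z)).det * f z i) s y (coordVec i) =
      Real.sqrt (gram (G y)).det * LinearMap.trace ℝ (Model m) (covV s (christoffelL s G y) f y) := by
  obtain ⟨L, hL, hLu⟩ := h.hasFDerivWithinAt_sqrt_det
  have hfi : ∀ i, DifferentiableWithinAt ℝ (fun z => f z i) s y := fun i =>
    (coordCovec i).differentiableAt.comp_differentiableWithinAt y hf
  have e : ∀ i, fderivWithin ℝ (fun z => Real.sqrt (gram (G z)).det * f z i) s y (coordVec i) =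
      Real.sqrt (gram (G y)).det * fderivWithin ℝ (fun z => f z i) s y (coordVec i) +
        f y i * (Real.sqrt (gram (G y)).det *
          LinearMap.trace ℝ (Model m) (christoffelL s G y (coordVec i))) := by
    intro i
    have := (hL.mul (hfi i).hasFDerivWithinAt).fderivWithin h.uniq
    change fderivWithin ℝ ((fun z => Real.sqrt (gram (G z)).det) * fun z => f z i) s y _ = _
    rw [this, add_apply, smul_apply, smul_apply, hLu]
    rfl
  rw [Finset.sum_congr rfl fun i _ => e i, Finset.sum_add_distrib,
    trace_covV h.uniq h.isLeviCivita.symm hf, mul_add, Finset.mul_sum]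
  congr 1
  have : christoffelL s G y (f y) = ∑ i, f y i • christoffelL s G y (coordVec i) :=
    (sum_coord_smul_map
      (christoffelL s G y : Model m →ₗ[ℝ] Model m →L[ℝ] Model m) (f y)).symm
  rw [this]
  simp only [ContinuousLinearMap.toLinearMap_sum, ContinuousLinearMap.toLinearMap_smul, map_sum,
    map_smul, Finset.mul_sum, smul_eq_mul]
  exact Finset.sum_congr rfl fun i _ => by ring

end IsMetricNear

/-! #### The pointwise identity -/

theorem covV_sub (Γ : Model m →L[ℝ] Model m →L[ℝ] Model m) (hs : UniqueDiffWithinAt ℝ s y)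
    {f f' : Model m → Model m} (hf : DifferentiableWithinAt ℝ f s y)
    (hf' : DifferentiableWithinAt ℝ f' s y) :
    covV s Γ (fun z => f z - f' z) y = covV s Γ f y - covV s Γ f' y := by
  ext1 u
  rw [sub_apply, covV_apply, covV_apply, covV_apply, fderivWithin_fun_sub hs hf hf', sub_apply,
    map_sub]
  abel

theorem covV_add (Γ : Model m →L[ℝ] Model m →L[ℝ] Model m) (hs : UniqueDiffWithinAt ℝ s y)
    {f f' : Model m → Model m} (hf : DifferentiableWithinAt ℝ f s y)
    (hf' : DifferentiableWithinAt ℝ f' s y) :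
    covV s Γ (fun z => f z + f' z) y = covV s Γ f y + covV s Γ f' y := by
  ext1 u
  rw [add_apply, covV_apply, covV_apply, covV_apply, fderivWithin_fun_add hs hf hf', add_apply,
    map_add]
  abel

theorem trace_covV_smul {Γ : Model m →L[ℝ] Model m →L[ℝ] Model m}
    (hs : UniqueDiffWithinAt ℝ s y) {c : Model m → ℝ}
    {f : Model m → Model m} (hc : DifferentiableWithinAt ℝ c s y)
    (hf : DifferentiableWithinAt ℝ f s y) :
    LinearMap.trace ℝ (Model m) (covV s Γ (fun z => c z • f z) y) =
      c y * LinearMap.trace ℝ (Model m) (covV s Γ f y) + fderivWithin ℝ c s y (f y) := by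
  rw [trace_eq_sum, trace_eq_sum, ← sum_coord_mul_map (fderivWithin ℝ c s y) (f y),
    Finset.mul_sum, ← Finset.sum_add_distrib]
  refine Finset.sum_congr rfl fun i _ => ?_
  rw [covV_apply, covV_apply, fderivWithin_fun_smul hs hc hf]
  simp
  ring

variable {f : Model m → Model m}

/-- The divergence of the stress-energy part of the field for one form `γ`. The derivative of
`½|γ|²` along `f` is `⟨∇_f γ, γ⟩`, and `d(f ⌟ γ)` contains the same term. What survives of the
difference is `T_f γ` and `f ⌟ dγ`. -/
theorem IsMetricNear.trace_covV_energy (h : IsMetricNear s G y)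
    (hf : DifferentiableWithinAt ℝ f s y) {γ : Model m → Frm m k}
    (hγ : DifferentiableWithinAt ℝ γ s y) :
    LinearMap.trace ℝ (Model m) (covV s (christoffelL s G y)
      (fun z => (2⁻¹ * formInner (gram (G z))⁻¹ (γ z) (γ z)) • f z -
        pairField (gram (G z))⁻¹ (interiorProd (f z) (γ z)) (γ z)) y) =
    2⁻¹ * formInner (gram (G y))⁻¹ (γ y) (γ y) *
        LinearMap.trace ℝ (Model m) (covV s (christoffelL s G y) f y) -
      formInner (gram (G y))⁻¹ (derivationAction (covV s (christoffelL s G y) f y) (γ y)) (γ y) +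
      formInner (k := k) (gram (G y))⁻¹ (interiorProd (f y) (extDerivWithin γ s y)) (γ y) +
      formInner (gram (G y))⁻¹ (interiorProd (f y) (γ y))
        (codL s (christoffelL s G y) (gram (G y))⁻¹ γ y) := by
  have hsymm := h.metric_self.isSymm_inv
  have hgi := h.isParallelInv
  have hΓ := h.isLeviCivita.symm
  set Γ := christoffelL s G y
  have hq : DifferentiableWithinAt ℝ
      (fun z => 2⁻¹ * formInner (gram (G z))⁻¹ (γ z) (γ z)) s y :=
    (differentiableWithinAt_formInner h.uniq hgi hγ hγ).const_mul _
  have hι := differentiableWithinAt_interiorProd hf hγ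
  rw [covV_sub Γ h.uniq (hq.fun_smul hf) (differentiableWithinAt_pairField h.uniq hgi hι hγ),
    ContinuousLinearMap.toLinearMap_sub, map_sub, trace_covV_smul h.uniq hq hf,
    trace_covV_pairField h.uniq hΓ hgi hsymm hι hγ]
  have e1 : fderivWithin ℝ (fun z => 2⁻¹ * formInner (gram (G z))⁻¹ (γ z) (γ z)) s y (f y) =
      formInner (gram (G y))⁻¹ (covD s Γ γ y (f y)) (γ y) := by
    rw [fderivWithin_const_mul h.uniq (differentiableWithinAt_formInner h.uniq hgi hγ hγ), smul_apply,
      fderivWithin_formInner h.uniq hgi hγ hγ, formInner_comm _ hsymm (γ y), smul_eq_mul]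
    ring
  -- Together with `e3` this is Cartan's formula in covariant form, `d(f ⌟ γ) + f ⌟ dγ = ∇_f γ + T_f
  -- γ`: the sums of `dx^i ∧ (f ⌟ ∇_i γ)` cancel.
  have e2 : ∑ i, wedgeCovector (k := k) (coordCovec i)
      (covD s Γ (fun z => interiorProd (f z) (γ z)) y (coordVec i)) =
      derivationAction (covV s Γ f y) (γ y) +
        ∑ i, wedgeCovector (k := k) (coordCovec i)
          (interiorProd (f y) (covD s Γ γ y (coordVec i))) := by
    rw [← sum_wedge_interiorProd, ← Finset.sum_add_distrib]
    refine Finset.sum_congr rfl fun i _ => ?_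
    rw [covD_interiorProd h.uniq hf hγ, wedgeCovector_add_right]
  have e3 : (interiorProd (f y) (extDerivWithin γ s y) : Frm m k) =
      covD s Γ γ y (f y) - ∑ i, wedgeCovector (k := k) (coordCovec i)
          (interiorProd (f y) (covD s Γ γ y (coordVec i))) := by
    have h1 : (interiorProd (f y) (extDerivWithin γ s y) : Frm m k) =
        ∑ i, (f y i • covD s Γ γ y (coordVec i) - wedgeCovector (k := k) (coordCovec i)
          (interiorProd (f y) (covD s Γ γ y (coordVec i)))) := by
      rw [extDerivWithin_eq_sum hΓ]
      change interiorL m (k + 1) (f y) _ = _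
      rw [map_sum]
      exact Finset.sum_congr rfl fun i _ => interiorProd_wedgeCovector _ _ _
    rw [h1, Finset.sum_sub_distrib]
    congr 1
    exact sum_coord_smul_map (covD s Γ γ y : Model m →ₗ[ℝ] Frm m k) (f y)
  rw [e1, e2, e3]
  generalize (∑ i, wedgeCovector (k := k) (coordCovec i)
          (interiorProd (f y) (covD s Γ γ y (coordVec i)))) = X
  simp only [← formInnerL_apply, map_add, map_sub, add_apply, sub_apply]
  ring

/-- Here `trace_covV_pairField` is applied to `φ = f ∧ β`: the product rule splits `dφ` into the
exterior derivative of `f`, which becomes `df ⌟ α` by adjointness, and `-f ∧ dβ`. The codifferential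
of `α` supplies the last term. -/
theorem IsMetricNear.trace_covV_mixed (h : IsMetricNear s G y)
    (hf : DifferentiableWithinAt ℝ f s y) {α : Model m → Frm m (k + 2)} {β : Model m → Frm m k}
    (hα : DifferentiableWithinAt ℝ α s y) (hβ : DifferentiableWithinAt ℝ β s y) :
    LinearMap.trace ℝ (Model m) (covV s (christoffelL s G y)
      (fun z => pairField (k := k + 2) (gram (G z))⁻¹
        (wedgeCovector (k := k + 1) (G z (f z)) (β z)) (α z)) y) =
    formInner (gram (G y))⁻¹ (β y) (∑ i, ∑ j, (gram (G y))⁻¹ i j •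
        interiorProd (covV s (christoffelL s G y) f y (coordVec j))
          (interiorProd (coordVec i) (α y)) : Frm m k) -
      formInner (k := k + 1) (gram (G y))⁻¹ (extDerivWithin β s y) (interiorProd (f y) (α y)) -
      formInner (gram (G y))⁻¹ (β y)
        (interiorProd (f y) (codL s (christoffelL s G y) (gram (G y))⁻¹ α y) : Frm m k) := by
  have hsymm := h.metric_self.isSymm_inv
  have hgi := h.isParallelInv
  have hΓ := h.isLeviCivita
  have hG := h.metric_self
  set Γ := christoffelL s G y
  have hθ : DifferentiableWithinAt ℝ (fun z => G z (f z)) s y :=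
    h.differentiableWithinAt.clm_apply hf
  have hφ : DifferentiableWithinAt ℝ
      (fun z => wedgeCovector (k := k + 1) (G z (f z)) (β z)) s y :=
    differentiableWithinAt_wedgeCovector (k := k + 1) hθ hβ
  -- Lowering an index commutes with the covariant derivative, because the metric is parallel.
  have hflat : ∀ u, fderivWithin ℝ (fun z => G z (f z)) s y u - (G y (f y)).comp (Γ u) =
      G y (covV s Γ f y u) := by
    intro u
    ext v
    have h1 := (h.differentiableWithinAt.hasFDerivWithinAt.clm_apply
      hf.hasFDerivWithinAt).fderivWithin h.uniq
    rw [h1, covV_apply, map_add]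
    simp only [sub_apply, add_apply, ContinuousLinearMap.comp_apply,
      ContinuousLinearMap.flip_apply, hΓ.compat]
    ring
  rw [trace_covV_pairField (k := k + 2) h.uniq hΓ.symm hgi hsymm hφ hα]
  have e1 : formInner (k := k + 2) (gram (G y))⁻¹
      (∑ i, wedgeCovector (k := k + 2) (coordCovec i) (covD s Γ
        (fun z => wedgeCovector (k := k + 1) (G z (f z)) (β z)) y (coordVec i))) (α y) =
      ∑ i, (formInner (gram (G y))⁻¹ (β y) (interiorProd (covV s Γ f y (coordVec i))
          (interiorProd (sharp (gram (G y))⁻¹ (coordCovec i)) (α y)) : Frm m k) -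
        formInner (k := k + 1) (gram (G y))⁻¹ (wedgeCovector (k := k + 1) (coordCovec i)
          (covD s Γ β y (coordVec i))) (interiorProd (f y) (α y))) := by
    rw [← formInnerL_apply, map_sum, sum_apply]
    refine Finset.sum_congr rfl fun i _ => ?_
    have h1 := covD_wedgeCovector (k := k + 1) (Γ := Γ) h.uniq hθ hβ (coordVec i)
    rw [hflat] at h1
    rw [h1, wedgeCovector_add_right, map_add, add_apply, formInnerL_apply, formInnerL_apply,
      formInner_wedgeCovector, formInner_wedgeCovector (k := k + 2), sub_eq_add_neg]
    congr 1
    · refine (formInner_wedgeCovector (k := k + 1) _ _ _ _).trans ?_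
      rw [hG.sharp_flat]
    · refine (formInner_wedgeCovector (k := k + 1) _ _ _ _).trans ?_
      rw [hG.sharp_flat, formInner_wedgeCovector (k := k + 1)]
      have h2 := interiorProd_interiorProd (f y) (sharp (gram (G y))⁻¹ (coordCovec i)) (α y)
      erw [h2]
      rw [← formInnerL_apply, map_neg]
      rfl
  have e2 : ∑ i, formInner (gram (G y))⁻¹ (β y) (interiorProd (covV s Γ f y (coordVec i))
          (interiorProd (sharp (gram (G y))⁻¹ (coordCovec i)) (α y)) : Frm m k) =
      formInner (gram (G y))⁻¹ (β y) (∑ i, ∑ j, (gram (G y))⁻¹ i j •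
        interiorProd (covV s Γ f y (coordVec j)) (interiorProd (coordVec i) (α y)) : Frm m k) := by
    rw [← formInnerL_apply, Finset.sum_comm, map_sum]
    refine Finset.sum_congr rfl fun i _ => ?_
    rw [← formInnerL_apply]
    congr 1
    rw [sharp_coordCovec]
    simp only [← interiorL_apply, map_sum, map_smul, sum_apply, smul_apply]
    exact Finset.sum_congr rfl fun j _ => by rw [hsymm.apply]
  have e3 : ∑ i, formInner (k := k + 1) (gram (G y))⁻¹ (wedgeCovector (k := k + 1) (coordCovec i)
          (covD s Γ β y (coordVec i))) (interiorProd (f y) (α y)) =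
      formInner (k := k + 1) (gram (G y))⁻¹ (extDerivWithin β s y) (interiorProd (f y) (α y)) := by
    rw [extDerivWithin_eq_sum hΓ.symm, ← formInnerL_apply, map_sum, sum_apply]
    rfl
  have e4 : formInner (k := k + 1) (gram (G y))⁻¹
      (wedgeCovector (k := k + 1) (G y (f y)) (β y)) (codL s Γ (gram (G y))⁻¹ α y) =
      formInner (gram (G y))⁻¹ (β y)
        (interiorProd (f y) (codL s Γ (gram (G y))⁻¹ α y) : Frm m k) := by
    refine (formInner_wedgeCovector (k := k + 1) _ _ _ _).trans ?_
    rw [hG.sharp_flat]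
  rw [e1, Finset.sum_sub_distrib, e2, e3]
  erw [e4]

end MetricCalculus

end

end Rellich

namespace Rellich

noncomputable section

/-! ### The vector field of the Rellich identity -/

section RellichField

variable {m k : ℕ} {s : Set (Model m)} {y : Model m}
  {G : Model m → Model m →L[ℝ] Model m →L[ℝ] ℝ} {f : Model m → Model m}

/-- The vector field dual to
`(|α|² + |β|²) f / 2 - ⟨f ⌟ α, · ⌟ α⟩ - ⟨f ⌟ β, · ⌟ β⟩ - ⟨f ∧ β, · ⌟ α⟩`. -/
def rellichField {p : ℕ} (gi : Matrix (Fin (m + 1)) (Fin (m + 1)) ℝ)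
    (B : Model m →L[ℝ] Model m →L[ℝ] ℝ) (α : Frm m (p + 1)) (β : Frm m (p - 1)) (v : Model m) :
    Model m :=
  ((2⁻¹ * formInner gi α α) • v - pairField gi (interiorProd v α) α) +
    ((2⁻¹ * formInner gi β β) • v - pairField gi (interiorProd v β) β) -
    pairField (k := p + 1) gi (wedgeCovector (k := p) (B v) β) α

theorem IsMetricNear.differentiableWithinAt_energy (h : IsMetricNear s G y)
    (hf : DifferentiableWithinAt ℝ f s y) {γ : Model m → Frm m k}
    (hγ : DifferentiableWithinAt ℝ γ s y) :
    DifferentiableWithinAt ℝ (fun z => (2⁻¹ * formInner (gram (G z))⁻¹ (γ z) (γ z)) • f z -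
        pairField (gram (G z))⁻¹ (interiorProd (f z) (γ z)) (γ z)) s y :=
  (((differentiableWithinAt_formInner h.uniq h.isParallelInv hγ hγ).const_mul _).fun_smul hf).fun_sub
    (differentiableWithinAt_pairField h.uniq h.isParallelInv
      (differentiableWithinAt_interiorProd hf hγ) hγ)

theorem IsMetricNear.differentiableWithinAt_mixed {p : ℕ} (h : IsMetricNear s G y)
    (hf : DifferentiableWithinAt ℝ f s y) {α : Model m → Frm m (p + 1)}
    {β : Model m → Frm m (p - 1)}
    (hα : DifferentiableWithinAt ℝ α s y) (hβ : DifferentiableWithinAt ℝ β s y) :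
    DifferentiableWithinAt ℝ (fun z => pairField (k := p + 1) (gram (G z))⁻¹
        (wedgeCovector (k := p) (G z (f z)) (β z)) (α z)) s y := by
  have hθ : DifferentiableWithinAt ℝ (fun z => G z (f z)) s y :=
    h.differentiableWithinAt.clm_apply hf
  exact differentiableWithinAt_pairField (k := p + 1) h.uniq h.isParallelInv
    (differentiableWithinAt_wedgeCovector (k := p) hθ hβ) hα

theorem IsMetricNear.differentiableWithinAt_rellichField {p : ℕ} (h : IsMetricNear s G y)
    (hf : DifferentiableWithinAt ℝ f s y) {α : Model m → Frm m (p + 1)}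
    {β : Model m → Frm m (p - 1)}
    (hα : DifferentiableWithinAt ℝ α s y) (hβ : DifferentiableWithinAt ℝ β s y) :
    DifferentiableWithinAt ℝ
      (fun z => rellichField (gram (G z))⁻¹ (G z) (α z) (β z) (f z)) s y :=
  ((h.differentiableWithinAt_energy hf hα).fun_add (h.differentiableWithinAt_energy hf hβ)).fun_sub
    (h.differentiableWithinAt_mixed hf hα hβ)

/-- The energy identities supply `⟨δα, f ⌟ α⟩` and `⟨β, f ⌟ dβ⟩`; the mixed term supplies `⟨dβ, f ⌟
α⟩` and `⟨β, f ⌟ δα⟩`. In pairs these are the two terms with `ε = dβ + δα`, which will be the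
Laplacian. -/
theorem IsMetricNear.trace_covV_rellichField (h : IsMetricNear s G y)
    (hf : DifferentiableWithinAt ℝ f s y) {α : Model m → Frm m (k + 2)} {β : Model m → Frm m k}
    (hα : DifferentiableWithinAt ℝ α s y) (hβ : DifferentiableWithinAt ℝ β s y)
    (hdα : extDerivWithin α s y = 0)
    (hδβ : codL s (christoffelL s G y) (gram (G y))⁻¹ β y = 0)
    {δα ε : Frm m (k + 1)} (hδα : codL s (christoffelL s G y) (gram (G y))⁻¹ α y = δα)
    (hε : ε = extDerivWithin β s y + δα) :
    LinearMap.trace ℝ (Model m) (covV s (christoffelL s G y)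
      (fun z => rellichField (p := k + 1) (gram (G z))⁻¹ (G z) (α z) (β z) (f z)) y) =
    formInner (k := k + 1) (gram (G y))⁻¹ ε (interiorProd (f y) (α y)) +
      formInner (k := k) (gram (G y))⁻¹ (β y) (interiorProd (f y) ε) +
      2⁻¹ * ((formInner (gram (G y))⁻¹ (α y) (α y) + formInner (gram (G y))⁻¹ (β y) (β y)) *
        LinearMap.trace ℝ (Model m) (covV s (christoffelL s G y) f y)) -
      formInner (k := k) (gram (G y))⁻¹ (β y) (∑ i, ∑ j, (gram (G y))⁻¹ i j •
        interiorProd (covV s (christoffelL s G y) f y (coordVec j))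
          (interiorProd (coordVec i) (α y))) -
      formInner (gram (G y))⁻¹ (derivationAction (covV s (christoffelL s G y) f y) (α y)) (α y) -
      formInner (gram (G y))⁻¹ (derivationAction (covV s (christoffelL s G y) f y) (β y)) (β y) := by
  have h1 := h.trace_covV_energy hf hα
  have h2 := h.trace_covV_energy hf hβ
  have h3 := h.trace_covV_mixed hf hα hβ
  rw [hδα] at h1 h3
  have d1 := h.differentiableWithinAt_energy hf hα
  have d2 := h.differentiableWithinAt_energy hf hβ
  have d3 := h.differentiableWithinAt_mixed (p := k + 1) hf hα hβ
  have hsymm := h.metric_self.isSymm_inv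
  set Γ := christoffelL s G y
  have e : covV s Γ (fun z => rellichField (p := k + 1) (gram (G z))⁻¹ (G z) (α z) (β z) (f z)) y =
      _ := covV_sub Γ h.uniq (d1.fun_add d2) d3
  rw [e, covV_add Γ h.uniq d1 d2, ContinuousLinearMap.toLinearMap_sub,
    ContinuousLinearMap.toLinearMap_add, map_sub, map_add, h1, h2]
  erw [h3]
  have hz1 : (interiorProd (f y) (extDerivWithin α s y) : Frm m (k + 2)) = 0 := by
    rw [hdα, ← interiorL_apply]
    exact map_zero _
  rw [hδβ, formInner_zero_right, hε]
  have c1 : formInner (k := k) (gram (G y))⁻¹ (interiorProd (f y) (extDerivWithin β s y)) (β y) =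
      formInner (k := k) (gram (G y))⁻¹ (β y) (interiorProd (f y) (extDerivWithin β s y)) :=
    formInner_comm _ hsymm _ _
  have c2 : formInner (k := k + 1) (gram (G y))⁻¹ (interiorProd (f y) (α y))
      δα = formInner (k := k + 1) (gram (G y))⁻¹ δα (interiorProd (f y) (α y)) :=
    formInner_comm _ hsymm _ _
  have c3 : formInner (k := k + 2) (gram (G y))⁻¹ (interiorProd (f y) (extDerivWithin α s y))
      (α y) = 0 := by
    erw [hz1]
    exact formInner_zero_left _ _
  have c4 : ∀ X Y : Frm m (k + 1), formInner (k := k + 1) (gram (G y))⁻¹ (X + Y)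
      (interiorProd (f y) (α y)) = formInner (k := k + 1) (gram (G y))⁻¹ X
      (interiorProd (f y) (α y)) + formInner (k := k + 1) (gram (G y))⁻¹ Y
      (interiorProd (f y) (α y)) := fun X Y => by
    rw [← formInnerL_apply, map_add]
    rfl
  have c5 : ∀ X Y : Frm m (k + 1), formInner (k := k) (gram (G y))⁻¹ (β y)
      (interiorProd (f y) (X + Y)) = formInner (k := k) (gram (G y))⁻¹ (β y)
      (interiorProd (f y) X) + formInner (k := k) (gram (G y))⁻¹ (β y)
      (interiorProd (f y) Y) := fun X Y => by
    rw [interiorProd_add_right]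
    exact map_add (formInnerL (gram (G y))⁻¹ k (β y)) _ _
  rw [c1, c3, c4, c5]
  erw [c2]
  ring

/-- The case of functions is separate: the degree of the codifferential is truncated to `0`, so `β`
is a zero form of degree `0`, and the Laplacian is `δα` alone. Only one energy identity remains. -/
theorem IsMetricNear.trace_covV_rellichField_zero (h : IsMetricNear s G y)
    (hf : DifferentiableWithinAt ℝ f s y) {α : Model m → Frm m 1} {β : Model m → Frm m 0}
    (hα : DifferentiableWithinAt ℝ α s y) (hβ : ∀ z, β z = 0)
    (hdα : extDerivWithin α s y = 0) :
    LinearMap.trace ℝ (Model m) (covV s (christoffelL s G y)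
      (fun z => rellichField (p := 0) (gram (G z))⁻¹ (G z) (α z) (β z) (f z)) y) =
    formInner (k := 0) (gram (G y))⁻¹ (codL s (christoffelL s G y) (gram (G y))⁻¹ α y)
        (interiorProd (f y) (α y)) +
      2⁻¹ * (formInner (gram (G y))⁻¹ (α y) (α y) *
        LinearMap.trace ℝ (Model m) (covV s (christoffelL s G y) f y)) -
      formInner (gram (G y))⁻¹ (derivationAction (covV s (christoffelL s G y) f y) (α y))
        (α y) := by
  have h1 := h.trace_covV_energy hf hα
  have e : (fun z => rellichField (p := 0) (gram (G z))⁻¹ (G z) (α z) (β z) (f z)) =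
      fun z => (2⁻¹ * formInner (gram (G z))⁻¹ (α z) (α z)) • f z -
        pairField (gram (G z))⁻¹ (interiorProd (f z) (α z)) (α z) := by
    funext z
    unfold rellichField
    have e1 : (wedgeCovector (k := 0) (G z (f z)) (β z)) = 0 := rfl
    have e2 : ∀ (j : ℕ) (γ γ' : Frm m j) (gi : Matrix (Fin (m + 1)) (Fin (m + 1)) ℝ)
        (δ : Frm m (j - 1)), (γ = 0 ∨ δ = 0) → pairField gi δ γ = 0 := by
      intro j γ γ' gi δ hh
      refine Finset.sum_eq_zero fun i _ => ?_
      rcases hh with rfl | rfl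
      · rw [formInner_zero_right, zero_smul]
      · have : wedgeCovector (k := j) (coordCovec i) (0 : Frm m (j - 1)) = 0 := by
          rw [← wedgeL_apply, map_zero]
        rw [this, formInner_zero_left, zero_smul]
    rw [e1, e2 _ (α z) (α z) _ _ (Or.inr rfl), e2 _ (β z) (β z) _ _ (Or.inl (hβ z)), sub_zero]
    have e3 : formInner (gram (G z))⁻¹ (β z) (β z) = 0 := by
      rw [hβ z]; exact formInner_zero_left _ _
    erw [e3]
    simp
  rw [e, h1, hdα]
  have c3 : formInner (k := 1) (gram (G y))⁻¹ (interiorProd (f y) (0 : Frm m 2)) (α y) = 0 := by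
    rw [← interiorL_apply, map_zero]
    exact formInner_zero_left _ _
  have c2 : formInner (k := 0) (gram (G y))⁻¹ (interiorProd (f y) (α y))
      (codL s (christoffelL s G y) (gram (G y))⁻¹ α y) = formInner (k := 0) (gram (G y))⁻¹
        (codL s (christoffelL s G y) (gram (G y))⁻¹ α y) (interiorProd (f y) (α y)) :=
    formInner_comm _ h.metric_self.isSymm_inv _ _
  erw [c2, c3]
  ring

end RellichField

/-! ### Smooth fields on the model space -/

section SmoothFields

variable {m k : ℕ} {s U : Set (Model m)} {G : Model m → Model m →L[ℝ] Model m →L[ℝ] ℝ}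

/-- `U` is a relatively open subset of a set `s` on which higher derivatives make sense. -/
structure IsRelOpen (s U : Set (Model m)) : Prop where
  sub : U ⊆ s
  nhds : ∀ y ∈ U, U ∈ nhdsWithin y s
  uniq : UniqueDiffOn ℝ s
  closure : s ⊆ closure (interior s)

/-- Evaluation of forms. -/
def evalL (v : Fin k → Model m) : Frm m k →L[ℝ] ℝ :=
  LinearMap.toContinuousLinearMap
    { toFun := fun α => α v
      map_add' := fun _ _ => rfl
      map_smul' := fun _ _ => rfl }

theorem IsRelOpen.fderivWithin {F : Type*} [NormedAddCommGroup F] [NormedSpace ℝ F]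
    (h : IsRelOpen s U) {f : Model m → F} (hf : ContDiffOn ℝ ∞ f U) :
    ContDiffOn ℝ ∞ (fderivWithin ℝ f s) U := by
  intro y hy
  have h1 : ContDiffWithinAt ℝ ∞ f s y := (hf y hy).mono_of_mem_nhdsWithin (h.nhds y hy)
  exact (h1.fderivWithin_right h.uniq (by simp) (h.sub hy)).mono h.sub

theorem IsRelOpen.contDiffWithinAt {F : Type*} [NormedAddCommGroup F] [NormedSpace ℝ F]
    (h : IsRelOpen s U) {f : Model m → F} (hf : ContDiffOn ℝ ∞ f U) {y : Model m} (hy : y ∈ U) :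
    ContDiffWithinAt ℝ ∞ f s y :=
  (hf y hy).mono_of_mem_nhdsWithin (h.nhds y hy)

theorem IsRelOpen.differentiableWithinAt {F : Type*} [NormedAddCommGroup F] [NormedSpace ℝ F]
    (h : IsRelOpen s U) {f : Model m → F} (hf : ContDiffOn ℝ ∞ f U) {y : Model m} (hy : y ∈ U) :
    DifferentiableWithinAt ℝ f s y :=
  (h.contDiffWithinAt hf hy).differentiableWithinAt (by simp)

theorem contDiffOn_bilin {E F F' F'' : Type*} [NormedAddCommGroup E] [NormedSpace ℝ E]
    [NormedAddCommGroup F] [NormedSpace ℝ F] [NormedAddCommGroup F'] [NormedSpace ℝ F']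
    [NormedAddCommGroup F''] [NormedSpace ℝ F''] {n : WithTop ℕ∞} {t : Set E}
    (B : F →L[ℝ] F' →L[ℝ] F'') {f : E → F}
    {f' : E → F'} (hf : ContDiffOn ℝ n f t) (hf' : ContDiffOn ℝ n f' t) :
    ContDiffOn ℝ n (fun z => B (f z) (f' z)) t :=
  (contDiffOn_const.clm_apply hf).clm_apply hf'

theorem contDiffOn_formInner {E : Type*} [NormedAddCommGroup E] [NormedSpace ℝ E]
    {n : WithTop ℕ∞} {t : Set E} {gi : E → Matrix (Fin (m + 1)) (Fin (m + 1)) ℝ}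
    (hgi : ∀ i j, ContDiffOn ℝ n (fun z => gi z i j) t) {α β : E → Frm m k}
    (hα : ContDiffOn ℝ n α t) (hβ : ContDiffOn ℝ n β t) :
    ContDiffOn ℝ n (fun z => formInner (gi z) (α z) (β z)) t := by
  unfold formInner
  refine contDiffOn_const.mul (ContDiffOn.sum fun I _ => ContDiffOn.sum fun J _ => ?_)
  exact (contDiffOn_prod fun l _ => hgi _ _).mul
    (((evalL _).contDiff.comp_contDiffOn hα).mul ((evalL _).contDiff.comp_contDiffOn hβ))

/-- A smooth metric on a relatively open set. -/
structure IsMetricOn (s U : Set (Model m)) (G : Model m → Model m →L[ℝ] Model m →L[ℝ] ℝ) :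
    Prop extends IsRelOpen s U where
  smooth : ContDiffOn ℝ ∞ G U
  metric : ∀ y ∈ U, IsMetric (G y)

namespace IsMetricOn

variable (h : IsMetricOn s U G)
include h

theorem isMetricNear {y : Model m} (hy : y ∈ U) : IsMetricNear s G y where
  mem := h.sub hy
  uniq := h.uniq y (h.sub hy)
  smooth := (h.toIsRelOpen.contDiffWithinAt h.smooth hy).of_le (by simp)
  metric := Filter.mem_of_superset (h.nhds y hy) h.metric

theorem contDiffOn_gram (i j : Fin (m + 1)) : ContDiffOn ℝ ∞ (fun z => gram (G z) i j) U :=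
  (h.smooth.clm_apply contDiffOn_const).clm_apply contDiffOn_const

theorem contDiffOn_gramInv (i j : Fin (m + 1)) :
    ContDiffOn ℝ ∞ (fun z => (gram (G z))⁻¹ i j) U := fun y hy =>
  contDiffWithinAt_matrix_inv (fun i j => h.contDiffOn_gram i j y hy)
    (h.metric y hy).det_pos.ne' i j

theorem contDiffOn_sqrt_det : ContDiffOn ℝ ∞ (fun z => Real.sqrt (gram (G z)).det) U :=
  fun y hy => (contDiffWithinAt_det fun i j => h.contDiffOn_gram i j y hy).sqrt
    (h.metric y hy).det_pos.ne'

theorem contDiffOn_christoffelL : ContDiffOn ℝ ∞ (fun z => christoffelL s G z) U := by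
  have hD := h.toIsRelOpen.fderivWithin h.smooth
  have hDa : ∀ u v w, ContDiffOn ℝ ∞ (fun z => fderivWithin ℝ G s z u v w) U := fun u v w =>
    ((hD.clm_apply contDiffOn_const).clm_apply contDiffOn_const).clm_apply contDiffOn_const
  refine contDiffOn_clm_apply.2 fun u => contDiffOn_clm_apply.2 fun v => ?_
  simp only [christoffelL, christ_apply]
  exact ContDiffOn.sum fun i _ => ContDiffOn.sum fun j _ =>
    ((contDiffOn_const.mul (h.contDiffOn_gramInv i j)).mul
      (((hDa _ _ _).add (hDa _ _ _)).sub (hDa _ _ _))).smul contDiffOn_const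

theorem contDiffOn_codL {w : Model m → Frm m k} (hw : ContDiffOn ℝ ∞ w U) :
    ContDiffOn ℝ ∞ (fun z => codL s (christoffelL s G z) (gram (G z))⁻¹ w z) U := by
  have h1 : ContDiffOn ℝ ∞ (fun z => covD s (christoffelL s G z) w z) U :=
    (h.toIsRelOpen.fderivWithin hw).sub
      ((contDiffOn_const.clm_apply hw).clm_comp h.contDiffOn_christoffelL)
  unfold codL
  exact (ContDiffOn.sum fun i _ => ContDiffOn.sum fun j _ =>
    (h.contDiffOn_gramInv i j).smul ((interiorL m k (coordVec i)).contDiff.comp_contDiffOn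
      (h1.clm_apply contDiffOn_const))).neg

end IsMetricOn

theorem IsRelOpen.contDiffOn_extDerivWithin (h : IsRelOpen s U) {w : Model m → Frm m k}
    (hw : ContDiffOn ℝ ∞ w U) : ContDiffOn ℝ ∞ (extDerivWithin w s) U := by
  change ContDiffOn ℝ ∞ (fun z => ContinuousAlternatingMap.alternatizeUncurryFinCLM ℝ (Model m) ℝ
    (_root_.fderivWithin ℝ w s z)) U
  exact (ContinuousLinearMap.contDiff _).comp_contDiffOn (h.fderivWithin hw)

theorem IsRelOpen.fderivWithin_comm (h : IsRelOpen s U) {F : Model m → ℝ}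
    (hF : ContDiffOn ℝ ∞ F U) {y : Model m} (hy : y ∈ U) (u v : Model m) :
    _root_.fderivWithin ℝ (fun z => _root_.fderivWithin ℝ F s z u) s y v =
      _root_.fderivWithin ℝ (fun z => _root_.fderivWithin ℝ F s z v) s y u := by
  have hs := h.uniq y (h.sub hy)
  have hd := h.differentiableWithinAt (h.fderivWithin hF) hy
  have e : ∀ a b, _root_.fderivWithin ℝ (fun z => _root_.fderivWithin ℝ F s z a) s y b =
      _root_.fderivWithin ℝ (_root_.fderivWithin ℝ F s) s y b a := by
    intro a b
    rw [(hd.hasFDerivWithinAt.clm_apply (hasFDerivWithinAt_const a y s)).fderivWithin hs]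
    simp
  rw [e, e]
  exact (h.contDiffWithinAt hF hy).isSymmSndFDerivWithinAt (by simp; exact WithTop.coe_le_coe.2 le_top) h.uniq
    (h.closure (h.sub hy)) (h.sub hy) v u

/-- Testing against `v ∧ φ` shows, by adjointness, that `v ⌟ ψ` satisfies the same hypothesis in
lower degree; positivity is needed only in degree `0`. -/
theorem formInner_nondegenerate {B : Model m →L[ℝ] Model m →L[ℝ] ℝ} (hB : IsMetric B)
    {ψ : Frm m k} (h : ∀ φ : Frm m k, formInner (gram B)⁻¹ φ ψ = 0) : ψ = 0 := by
  induction k with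
  | zero =>
    have h1 := h ψ
    rw [formInner_zero_degree] at h1
    exact form_ext_zero (mul_self_eq_zero.1 h1)
  | succ k ih =>
    refine form_ext_interiorProd fun v => ?_
    have h1 : ∀ φ : Frm m k, formInner (k := k) (gram B)⁻¹ φ (interiorProd v ψ) = 0 := by
      intro φ
      have h2 := formInner_wedgeCovector (k := k + 1) (gram B)⁻¹ (B v) φ ψ
      rw [h, hB.sharp_flat] at h2
      exact h2.symm
    refine (ih h1).trans ?_
    rw [← interiorL_apply, map_zero]

/-- In terms of components with respect to constant forms, the codifferential is a divergence. -/
theorem IsMetricOn.sqrt_mul_formInner_codL (h : IsMetricOn s U G) {w : Model m → Frm m (k + 1)}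
    (hw : ContDiffOn ℝ ∞ w U) (φ : Frm m k) {y : Model m} (hy : y ∈ U) :
    Real.sqrt (gram (G y)).det * formInner (k := k) (gram (G y))⁻¹ φ
        (codL s (christoffelL s G y) (gram (G y))⁻¹ w y) =
      -∑ i, _root_.fderivWithin ℝ (fun z => Real.sqrt (gram (G z)).det *
        formInner (gram (G z))⁻¹ (wedgeCovector (k := k + 1) (coordCovec i) φ) (w z)) s y
          (coordVec i) := by
  have hn := h.isMetricNear hy
  have hwd := h.toIsRelOpen.differentiableWithinAt hw hy
  have hc : DifferentiableWithinAt ℝ (fun _ : Model m => φ) s y := differentiableWithinAt_const _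
  have h1 := trace_covV_pairField (k := k + 1) hn.uniq hn.isLeviCivita.symm hn.isParallelInv
    hn.metric_self.isSymm_inv hc hwd
  have h2 := hn.sum_fderivWithin_density
    (differentiableWithinAt_pairField (k := k + 1) hn.uniq hn.isParallelInv hc hwd)
  simp only [pairField_apply] at h2
  erw [h2, h1, ← extDerivWithin_eq_sum hn.isLeviCivita.symm]
  -- A form with constant coefficients is closed, so only the codifferential contributes to the
  -- divergence.
  have h3 : extDerivWithin (fun _ : Model m => φ) s y = 0 := by
    rw [extDerivWithin, fderivWithin_fun_const,
      ← ContinuousAlternatingMap.alternatizeUncurryFinCLM_apply]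
    exact map_zero _
  rw [h3, formInner_zero_left]
  simp

/-- The square of the codifferential is zero. -/
theorem IsMetricOn.codL_codL (h : IsMetricOn s U G) {w : Model m → Frm m (k + 2)}
    (hw : ContDiffOn ℝ ∞ w U) {δw : Model m → Frm m (k + 1)}
    (hδw : ∀ z ∈ U, δw z = codL s (christoffelL s G z) (gram (G z))⁻¹ w z) {y : Model m}
    (hy : y ∈ U) :
    (codL s (christoffelL s G y) (gram (G y))⁻¹ δw y : Frm m k) = 0 := by
  refine formInner_nondegenerate (h.metric y hy) fun φ => ?_
  have hne : Real.sqrt (gram (G y)).det ≠ 0 := (Real.sqrt_pos.2 (h.metric y hy).det_pos).ne'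
  have hδs : ContDiffOn ℝ ∞ δw U := (h.contDiffOn_codL hw).congr hδw
  refine (mul_eq_zero.1 ?_).resolve_left hne
  rw [h.sqrt_mul_formInner_codL hδs φ hy]
  -- With these densitized components of `w`, antisymmetric in the two indices, applying the
  -- divergence form of the codifferential twice gives a double sum of second partial derivatives.
  let F : Fin (m + 1) → Fin (m + 1) → Model m → ℝ := fun i j z =>
    Real.sqrt (gram (G z)).det * formInner (gram (G z))⁻¹ (wedgeCovector (k := k + 2)
      (coordCovec j) (wedgeCovector (k := k + 1) (coordCovec i) φ)) (w z)
  have hF : ∀ i j, ContDiffOn ℝ ∞ (F i j) U := fun i j =>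
    h.contDiffOn_sqrt_det.mul (contDiffOn_formInner h.contDiffOn_gramInv contDiffOn_const hw)
  have hanti : ∀ i j, F j i = fun z => -F i j z := by
    intro i j
    funext z
    simp only [F]
    have e : ∀ θ θ' : Model m →L[ℝ] ℝ, formInner (k := k + 2) (gram (G z))⁻¹
        (wedgeCovector (k := k + 2) θ (wedgeCovector (k := k + 1) θ' φ)) (w z) =
        formInner (k := k) (gram (G z))⁻¹ φ (interiorProd (k := k + 1) (sharp (gram (G z))⁻¹ θ')
          (interiorProd (k := k + 2) (sharp (gram (G z))⁻¹ θ) (w z))) := fun θ θ' =>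
      (formInner_wedgeCovector (k := k + 2) _ _ _ _).trans
        (formInner_wedgeCovector (k := k + 1) _ _ _ _)
    rw [e, e]
    have h2 := interiorProd_interiorProd (sharp (gram (G z))⁻¹ (coordCovec j))
      (sharp (gram (G z))⁻¹ (coordCovec i)) (w z)
    erw [h2]
    have h3 : ∀ X : Frm m k, formInner (k := k) (gram (G z))⁻¹ φ (-X) =
        -formInner (k := k) (gram (G z))⁻¹ φ X := fun X =>
      map_neg (formInnerL (gram (G z))⁻¹ k φ) X
    erw [h3]
    rw [mul_neg]
  have e1 : ∀ i, _root_.fderivWithin ℝ (fun z => Real.sqrt (gram (G z)).det *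
        formInner (gram (G z))⁻¹ (wedgeCovector (k := k + 1) (coordCovec i) φ) (δw z)) s y
          (coordVec i) =
      -∑ j, _root_.fderivWithin ℝ (fun z => _root_.fderivWithin ℝ (F i j) s z (coordVec j)) s y
        (coordVec i) := by
    intro i
    have he : (fun z => Real.sqrt (gram (G z)).det *
        formInner (gram (G z))⁻¹ (wedgeCovector (k := k + 1) (coordCovec i) φ) (δw z)) =ᶠ[
          nhdsWithin y s] fun z => -∑ j, _root_.fderivWithin ℝ (F i j) s z (coordVec j) := by
      filter_upwards [h.nhds y hy] with z hz
      rw [hδw z hz]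
      exact h.sqrt_mul_formInner_codL hw (wedgeCovector (k := k + 1) (coordCovec i) φ) hz
    have hd : ∀ j, DifferentiableWithinAt ℝ
        (fun z => _root_.fderivWithin ℝ (F i j) s z (coordVec j)) s y := fun j =>
      h.toIsRelOpen.differentiableWithinAt
        ((h.toIsRelOpen.fderivWithin (hF i j)).clm_apply contDiffOn_const) hy
    have hu := h.uniq y (h.sub hy)
    rw [he.fderivWithin_eq_of_mem (h.sub hy), fderivWithin_fun_neg hu, neg_apply,
      fderivWithin_fun_sum hu fun j _ => hd j, sum_apply]
  rw [Finset.sum_congr rfl fun i _ => e1 i, Finset.sum_neg_distrib, neg_neg]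
  set S := ∑ i, ∑ j, _root_.fderivWithin ℝ
    (fun z => _root_.fderivWithin ℝ (F i j) s z (coordVec j)) s y (coordVec i) with hS
  -- The second derivatives are symmetric in `i` and `j` while `F` is antisymmetric.
  have hSneg : S = -S := by
    conv_lhs => rw [hS, Finset.sum_comm]
    rw [hS, ← Finset.sum_neg_distrib]
    refine Finset.sum_congr rfl fun i _ => ?_
    rw [← Finset.sum_neg_distrib]
    refine Finset.sum_congr rfl fun j _ => ?_
    have hu := h.uniq y (h.sub hy)
    have e3 : ∀ z ∈ U, _root_.fderivWithin ℝ (F j i) s z (coordVec i) =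
        -_root_.fderivWithin ℝ (F i j) s z (coordVec i) := by
      intro z hz
      rw [hanti i j, fderivWithin_fun_neg (h.uniq z (h.sub hz)), neg_apply]
    have e4 : (fun z => _root_.fderivWithin ℝ (F j i) s z (coordVec i)) =ᶠ[nhdsWithin y s]
        fun z => -_root_.fderivWithin ℝ (F i j) s z (coordVec i) :=
      Filter.mem_of_superset (h.nhds y hy) e3
    rw [e4.fderivWithin_eq_of_mem (h.sub hy), fderivWithin_fun_neg hu, neg_apply,
      h.toIsRelOpen.fderivWithin_comm (hF i j) hy]
  linarith

end SmoothFields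

end

end Rellich

namespace Rellich

noncomputable section

/-! ### Changes of coordinates -/

section CoordinateChange

variable {m k : ℕ} {s : Set (Model m)} {y : Model m} {ψ : Model m → Model m}
  {G₀ G₁ : Model m → Model m →L[ℝ] Model m →L[ℝ] ℝ}

theorem fderivWithin_apply_apply {K : Model m → Model m →L[ℝ] Model m →L[ℝ] ℝ}
    {K' : Model m →L[ℝ] Model m →L[ℝ] Model m →L[ℝ] ℝ} {P : Model m → Model m →L[ℝ] Model m}
    {P' : Model m →L[ℝ] Model m →L[ℝ] Model m} (hs : UniqueDiffWithinAt ℝ s y)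
    (hK : HasFDerivWithinAt K K' s y) (hP : HasFDerivWithinAt P P' s y) (u v w : Model m) :
    fderivWithin ℝ (fun z => K z (P z u) (P z v)) s y w =
      K' w (P y u) (P y v) + K y (P' w u) (P y v) + K y (P y u) (P' w v) := by
  have hu : HasFDerivWithinAt (fun z => P z u) (P'.flip u) s y := by
    have := hP.clm_apply (hasFDerivWithinAt_const u y s)
    rwa [ContinuousLinearMap.comp_zero, zero_add] at this
  have hv : HasFDerivWithinAt (fun z => P z v) (P'.flip v) s y := by
    have := hP.clm_apply (hasFDerivWithinAt_const v y s)
    rwa [ContinuousLinearMap.comp_zero, zero_add] at this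
  have h1 := hK.clm_apply hu
  have h2 := h1.clm_apply hv
  rw [h2.fderivWithin hs]
  simp only [add_apply, ContinuousLinearMap.comp_apply, ContinuousLinearMap.flip_apply]
  ring

/-- `ψ` is a change of coordinates near `y`. -/
structure IsChange (s : Set (Model m)) (ψ : Model m → Model m) (y : Model m) : Prop where
  mem : y ∈ s
  uniq : UniqueDiffOn ℝ s
  closure : s ⊆ closure (interior s)
  smooth : ContDiffWithinAt ℝ ∞ ψ s y
  tendsto : Filter.Tendsto ψ (nhdsWithin y s) (nhdsWithin (ψ y) s)
  inv : ∃ B : Model m →L[ℝ] Model m, (fderivWithin ℝ ψ s y).comp B = ContinuousLinearMap.id ℝ _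

namespace IsChange

variable (h : IsChange s ψ y)
include h

theorem hasFDerivWithinAt : HasFDerivWithinAt ψ (fderivWithin ℝ ψ s y) s y :=
  (h.smooth.differentiableWithinAt (by simp)).hasFDerivWithinAt

theorem hasFDerivWithinAt_fderivWithin :
    HasFDerivWithinAt (fderivWithin ℝ ψ s) (fderivWithin ℝ (fderivWithin ℝ ψ s) s y) s y :=
  ((h.smooth.fderivWithin_right (m := 1) h.uniq
    (by norm_num; exact WithTop.coe_le_coe.2 le_top) h.mem).differentiableWithinAt
      one_ne_zero).hasFDerivWithinAt

theorem symm_second (u v : Model m) :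
    fderivWithin ℝ (fderivWithin ℝ ψ s) s y u v = fderivWithin ℝ (fderivWithin ℝ ψ s) s y v u :=
  h.smooth.isSymmSndFDerivWithinAt (by simp; exact WithTop.coe_le_coe.2 le_top) h.uniq
    (h.closure h.mem) h.mem u v

theorem surjective : Function.Surjective (fderivWithin ℝ ψ s y) := by
  obtain ⟨B, hB⟩ := h.inv
  exact fun v => ⟨B v, congrArg (fun C : Model m →L[ℝ] Model m => C v) hB⟩

theorem hasFDerivWithinAt_comp {F : Type*} [NormedAddCommGroup F] [NormedSpace ℝ F]
    {w : Model m → F} (hw : DifferentiableWithinAt ℝ w s (ψ y)) :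
    HasFDerivWithinAt (fun z => w (ψ z))
      ((fderivWithin ℝ w s (ψ y)).comp (fderivWithin ℝ ψ s y)) s y :=
  hw.hasFDerivWithinAt.comp_of_tendsto y h.hasFDerivWithinAt h.tendsto

/-- The symbols that would satisfy the transformation law, pulled back by a right inverse of the
differential, are symmetric because second derivatives are, and compatible with `G₀` by the product
rule. Uniqueness of the Levi-Civita symbols then identifies them. -/
theorem christoffelL_eq (h₀ : IsMetricNear s G₀ y) (h₁ : IsMetricNear s G₁ (ψ y))
    (hG : ∀ᶠ z in nhdsWithin y s, G₀ z = (G₁ (ψ z)).bilinearComp (fderivWithin ℝ ψ s z)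
      (fderivWithin ℝ ψ s z)) (u v : Model m) :
    fderivWithin ℝ ψ s y (christoffelL s G₀ y u v) =
      fderivWithin ℝ (fderivWithin ℝ ψ s) s y u v +
        christoffelL s G₁ (ψ y) (fderivWithin ℝ ψ s y u) (fderivWithin ℝ ψ s y v) := by
  obtain ⟨B, hB⟩ := h.inv
  have hd := h.hasFDerivWithinAt_fderivWithin
  have hK := h.hasFDerivWithinAt_comp (w := G₁) h₁.differentiableWithinAt
  set A := fderivWithin ℝ ψ s y with hA
  set D2 := fderivWithin ℝ (fderivWithin ℝ ψ s) s y with hD2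
  set Γ₁ := christoffelL s G₁ (ψ y) with hΓ₁
  have hAB : ∀ x, A (B x) = x := fun x => congrArg (fun C : Model m →L[ℝ] Model m => C x) hB
  have hG0 : ∀ u v, G₀ y u v = G₁ (ψ y) (A u) (A v) := fun u v => by
    rw [hG.self_of_nhdsWithin h.mem]; rfl
  let Γ : Model m →L[ℝ] Model m →L[ℝ] Model m :=
    (ContinuousLinearMap.compL ℝ (Model m) (Model m) (Model m) B).comp (D2 + Γ₁.bilinearComp A A)
  have hΓ : ∀ u v, Γ u v = B (D2 u v + Γ₁ (A u) (A v)) := fun _ _ => rfl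
  have hAΓ : ∀ u v, A (Γ u v) = D2 u v + Γ₁ (A u) (A v) := fun u v => by rw [hΓ, hAB]
  have hlc : IsLeviCivita (G₀ y) (fderivWithin ℝ G₀ s y) Γ := by
    refine ⟨fun u v => ?_, fun w u v => ?_⟩
    · rw [hΓ, hΓ, h.symm_second u v, h₁.isLeviCivita.symm (A u)]
    · rw [← h₀.fderivWithin_apply]
      have e : (fun z => G₀ z u v) =ᶠ[nhdsWithin y s]
          fun z => G₁ (ψ z) (fderivWithin ℝ ψ s z u) (fderivWithin ℝ ψ s z v) :=
        hG.mono fun z hz => by simp only [hz]; rfl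
      rw [e.fderivWithin_eq_of_mem h.mem, fderivWithin_apply_apply h₀.uniq hK hd, hG0, hG0, hAΓ, hAΓ,
        ContinuousLinearMap.comp_apply, ← hA, h₁.isLeviCivita.compat, ← hΓ₁, map_add, map_add,
        add_apply]
      ring
  rw [h₀.isLeviCivita.unique h₀.metric_self hlc, hΓ, hAB]

/-- Differentiating a pullback also differentiates the differential of `ψ` in each slot; these
second derivatives are cancelled by the inhomogeneous part of the transformation law of the
Christoffel symbols. -/
theorem covD_eq (h₀ : IsMetricNear s G₀ y) (h₁ : IsMetricNear s G₁ (ψ y))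
    (hG : ∀ᶠ z in nhdsWithin y s, G₀ z = (G₁ (ψ z)).bilinearComp (fderivWithin ℝ ψ s z)
      (fderivWithin ℝ ψ s z)) {w₀ w₁ : Model m → Frm m k}
    (hw : ∀ᶠ z in nhdsWithin y s, w₀ z = pull (fderivWithin ℝ ψ s z) (w₁ (ψ z)))
    (hw₁ : DifferentiableWithinAt ℝ w₁ s (ψ y)) (u : Model m) :
    covD s (christoffelL s G₀ y) w₀ y u =
      pull (fderivWithin ℝ ψ s y)
        (covD s (christoffelL s G₁ (ψ y)) w₁ (ψ y) (fderivWithin ℝ ψ s y u)) := by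
  have hd := h.hasFDerivWithinAt_fderivWithin
  have hc := h.hasFDerivWithinAt_comp hw₁
  have h1 := fderivWithin_continuousAlternatingMapCompContinuousLinearMap
    hc.differentiableWithinAt hd.differentiableWithinAt h₀.uniq
  have e : w₀ =ᶠ[nhdsWithin y s] fun z => pull (fderivWithin ℝ ψ s z) (w₁ (ψ z)) := hw
  rw [covD_apply, covD_apply, e.fderivWithin_eq_of_mem h.mem, h1, hw.self_of_nhdsWithin h.mem,
    hc.fderivWithin h₀.uniq]
  ext v
  have hΓ := h.christoffelL_eq h₀ h₁ hG
  simp only [pull_apply, ContinuousAlternatingMap.sub_apply, add_apply,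
    ContinuousAlternatingMap.add_apply, ContinuousLinearMap.comp_apply, derivationAction_apply,
    ContinuousAlternatingMap.fderivCompContinuousLinearMap_apply]
  set A := fderivWithin ℝ ψ s y
  have e1 : ∀ l, (w₁ (ψ y)) (fun i => A (Function.update v l (christoffelL s G₀ y u (v l)) i)) =
      (w₁ (ψ y)) (fun j => Function.update (fun _ => A) l
        (fderivWithin ℝ (fderivWithin ℝ ψ s) s y u) j (v j)) +
      (w₁ (ψ y)) (Function.update (fun i => A (v i)) l
        (christoffelL s G₁ (ψ y) (A u) (A (v l)))) := by
    intro l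
    have e2 : (fun i => A (Function.update v l (christoffelL s G₀ y u (v l)) i)) =
        Function.update (fun i => A (v i)) l (A (christoffelL s G₀ y u (v l))) := by
      funext i
      rcases eq_or_ne i l with rfl | hi
      · simp
      · simp [Function.update_of_ne hi]
    have e3 : (fun j => Function.update (fun _ => A) l
        (fderivWithin ℝ (fderivWithin ℝ ψ s) s y u) j (v j)) =
        Function.update (fun i => A (v i)) l
          (fderivWithin ℝ (fderivWithin ℝ ψ s) s y u (v l)) := by
      funext i
      rcases eq_or_ne i l with rfl | hi
      · simp
      · simp [Function.update_of_ne hi]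
    rw [e2, e3, hΓ, ContinuousAlternatingMap.map_update_add]
  rw [Finset.sum_congr rfl fun l _ => e1 l, Finset.sum_add_distrib]
  change (fderivWithin ℝ w₁ s (ψ y) (A u)) (fun i => A (v i)) + _ - _ = _
  ring

theorem giRel (hG : ∀ᶠ z in nhdsWithin y s, G₀ z = (G₁ (ψ z)).bilinearComp (fderivWithin ℝ ψ s z)
      (fderivWithin ℝ ψ s z)) :
    GiRel (fderivWithin ℝ ψ s y) (gram (G₀ y))⁻¹ (gram (G₁ (ψ y)))⁻¹ := by
  obtain ⟨B, hB⟩ := h.inv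
  rw [hG.self_of_nhdsWithin h.mem]
  exact giRel_gram hB _

/-- Naturality of the covariant derivative combined with that of the trace. -/
theorem codL_eq (h₀ : IsMetricNear s G₀ y) (h₁ : IsMetricNear s G₁ (ψ y))
    (hG : ∀ᶠ z in nhdsWithin y s, G₀ z = (G₁ (ψ z)).bilinearComp (fderivWithin ℝ ψ s z)
      (fderivWithin ℝ ψ s z)) {w₀ w₁ : Model m → Frm m k}
    (hw : ∀ᶠ z in nhdsWithin y s, w₀ z = pull (fderivWithin ℝ ψ s z) (w₁ (ψ z)))
    (hw₁ : DifferentiableWithinAt ℝ w₁ s (ψ y)) :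
    codL s (christoffelL s G₀ y) (gram (G₀ y))⁻¹ w₀ y =
      pull (fderivWithin ℝ ψ s y)
        (codL s (christoffelL s G₁ (ψ y)) (gram (G₁ (ψ y)))⁻¹ w₁ (ψ y)) := by
  have hc := h.covD_eq h₀ h₁ hG hw hw₁
  have ht := trace2_natural (h.giRel hG) (LinearMap.mk₂ ℝ
    (fun u v => interiorL m k u (covD s (christoffelL s G₁ (ψ y)) w₁ (ψ y) v))
    (by intros; simp only [map_add, add_apply]) (by intros; simp only [map_smul, smul_apply])
    (by intros; simp only [map_add]) (by intros; simp only [map_smul]))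
  simp only [trace2, LinearMap.mk₂_apply, interiorL_apply] at ht
  rw [codL, codL, ← ht, ← pullL_apply, map_neg, map_sum]
  congr 1
  refine Finset.sum_congr rfl fun i _ => ?_
  rw [map_sum]
  refine Finset.sum_congr rfl fun j _ => ?_
  rw [map_smul, hc, interiorProd_pull, pullL_apply]

/-- The metrics serve only as a means: once `d` is an alternated covariant derivative, naturality of
the latter is enough. -/
theorem extDerivWithin_eq (h₀ : IsMetricNear s G₀ y) (h₁ : IsMetricNear s G₁ (ψ y))
    (hG : ∀ᶠ z in nhdsWithin y s, G₀ z = (G₁ (ψ z)).bilinearComp (fderivWithin ℝ ψ s z)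
      (fderivWithin ℝ ψ s z)) {w₀ w₁ : Model m → Frm m k}
    (hw : ∀ᶠ z in nhdsWithin y s, w₀ z = pull (fderivWithin ℝ ψ s z) (w₁ (ψ z)))
    (hw₁ : DifferentiableWithinAt ℝ w₁ s (ψ y)) :
    extDerivWithin w₀ s y = pull (fderivWithin ℝ ψ s y) (extDerivWithin w₁ s (ψ y)) := by
  have hc := h.covD_eq h₀ h₁ hG hw hw₁
  rw [extDerivWithin_eq_sum h₀.isLeviCivita.symm, extDerivWithin_eq_sum h₁.isLeviCivita.symm,
    ← alternatizeUncurryFin_eq_sum, ← alternatizeUncurryFin_eq_sum]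
  ext v
  rw [pull_apply, ContinuousAlternatingMap.alternatizeUncurryFin_apply,
    ContinuousAlternatingMap.alternatizeUncurryFin_apply]
  refine Finset.sum_congr rfl fun i _ => ?_
  rw [hc]
  rfl

/-- Differentiate `f₁ ∘ ψ = dψ(f₀)`: the second derivative of `ψ` is absorbed by the transformation
law of the Christoffel symbols. -/
theorem covV_eq (h₀ : IsMetricNear s G₀ y) (h₁ : IsMetricNear s G₁ (ψ y))
    (hG : ∀ᶠ z in nhdsWithin y s, G₀ z = (G₁ (ψ z)).bilinearComp (fderivWithin ℝ ψ s z)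
      (fderivWithin ℝ ψ s z)) {f₀ f₁ : Model m → Model m}
    (hf : ∀ᶠ z in nhdsWithin y s, f₁ (ψ z) = fderivWithin ℝ ψ s z (f₀ z))
    (hf₀ : DifferentiableWithinAt ℝ f₀ s y) (hf₁ : DifferentiableWithinAt ℝ f₁ s (ψ y)) :
    (fderivWithin ℝ ψ s y).comp (covV s (christoffelL s G₀ y) f₀ y) =
      (covV s (christoffelL s G₁ (ψ y)) f₁ (ψ y)).comp (fderivWithin ℝ ψ s y) := by
  ext1 u
  have hd := h.hasFDerivWithinAt_fderivWithin
  have e : (fun z => f₁ (ψ z)) =ᶠ[nhdsWithin y s] fun z => fderivWithin ℝ ψ s z (f₀ z) := hf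
  have h1 := (h.hasFDerivWithinAt_comp hf₁).fderivWithin h₀.uniq
  rw [e.fderivWithin_eq_of_mem h.mem,
    (hd.clm_apply hf₀.hasFDerivWithinAt).fderivWithin h₀.uniq] at h1
  have h2 := congrArg (fun C : Model m →L[ℝ] Model m => C u) h1
  simp only [add_apply, ContinuousLinearMap.comp_apply, ContinuousLinearMap.flip_apply] at h2
  rw [ContinuousLinearMap.comp_apply, ContinuousLinearMap.comp_apply, covV_apply, covV_apply,
    ← h2, hf.self_of_nhdsWithin h.mem, map_add, h.christoffelL_eq h₀ h₁ hG]
  abel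

end IsChange

end CoordinateChange

end

end Rellich

namespace Rellich

noncomputable section

/-! ### Charts of a manifold with boundary -/

section Charts

/-- The model half-space `{y | 0 ≤ y 0}`. -/
abbrev halfSpace (m : ℕ) : Set (Model m) := range (𝓡∂ (m + 1))

theorem mem_halfSpace {m : ℕ} {y : Model m} : y ∈ halfSpace m ↔ 0 ≤ y 0 := by
  rw [halfSpace, range_modelWithCornersEuclideanHalfSpace]
  rfl

variable {m : ℕ} {M : Type*} [TopologicalSpace M] [ChartedSpace (EuclideanHalfSpace (m + 1)) M]

/-- The preferred chart at a point. -/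
abbrev chart (m : ℕ) {M : Type*} [TopologicalSpace M]
    [ChartedSpace (EuclideanHalfSpace (m + 1)) M] (x₀ : M) : PartialEquiv M (Model m) :=
  extChartAt (𝓡∂ (m + 1)) x₀

/-- The change of coordinates between two preferred charts. -/
abbrev transition (m : ℕ) {M : Type*} [TopologicalSpace M]
    [ChartedSpace (EuclideanHalfSpace (m + 1)) M] (x₀ x₁ : M) : Model m → Model m :=
  chart m x₁ ∘ (chart m x₀).symm

/-- The domain of the change of coordinates between two preferred charts. -/
abbrev overlap (m : ℕ) {M : Type*} [TopologicalSpace M]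
    [ChartedSpace (EuclideanHalfSpace (m + 1)) M] (x₀ x₁ : M) : Set (Model m) :=
  (chart m x₀).target ∩ (chart m x₀).symm ⁻¹' (chart m x₁).source

theorem isRelOpen_target (x₀ : M) : IsRelOpen (halfSpace m) (chart m x₀).target where
  sub := extChartAt_target_subset_range x₀
  nhds _ hy := extChartAt_target_mem_nhdsWithin_of_mem hy
  uniq := (𝓡∂ (m + 1)).uniqueDiffOn
  closure := (𝓡∂ (m + 1)).range_subset_closure_interior

theorem overlap_mem_nhdsWithin {x₀ x₁ : M} {y : Model m} (hy : y ∈ overlap m x₀ x₁) :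
    overlap m x₀ x₁ ∈ nhdsWithin y (halfSpace m) := by
  refine Filter.inter_mem ((isRelOpen_target x₀).nhds y hy.1) ?_
  have hc : ContinuousWithinAt (chart m x₀).symm (chart m x₀).target y :=
    continuousOn_extChartAt_symm x₀ y hy.1
  have := hc.preimage_mem_nhdsWithin ((isOpen_extChartAt_source (I := 𝓡∂ (m + 1)) x₁).mem_nhds hy.2)
  rwa [nhdsWithin_extChartAt_target_eq_of_mem hy.1] at this

theorem isRelOpen_overlap (x₀ x₁ : M) : IsRelOpen (halfSpace m) (overlap m x₀ x₁) where
  sub := inter_subset_left.trans (isRelOpen_target x₀).sub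
  nhds _ hy := overlap_mem_nhdsWithin hy
  uniq := (isRelOpen_target x₀).uniq
  closure := (isRelOpen_target x₀).closure

theorem transition_mem {x₀ x₁ : M} {y : Model m} (hy : y ∈ overlap m x₀ x₁) :
    transition m x₀ x₁ y ∈ overlap m x₁ x₀ := by
  refine ⟨(chart m x₁).map_source hy.2, ?_⟩
  change (chart m x₁).symm (chart m x₁ _) ∈ (chart m x₀).source
  rw [(chart m x₁).left_inv hy.2]
  exact (chart m x₀).map_target hy.1

theorem symm_transition {x₀ x₁ : M} {y : Model m} (hy : y ∈ overlap m x₀ x₁) :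
    (chart m x₁).symm (transition m x₀ x₁ y) = (chart m x₀).symm y :=
  (chart m x₁).left_inv hy.2

theorem transition_transition {x₀ x₁ : M} {y : Model m} (hy : y ∈ overlap m x₀ x₁) :
    transition m x₁ x₀ (transition m x₀ x₁ y) = y := by
  change chart m x₀ ((chart m x₁).symm (transition m x₀ x₁ y)) = y
  rw [symm_transition hy]
  exact (chart m x₀).right_inv hy.1

theorem mem_overlap_self {x₀ : M} {y : Model m} (hy : y ∈ (chart m x₀).target) :
    y ∈ overlap m x₀ ((chart m x₀).symm y) := ⟨hy, mem_extChartAt_source _⟩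

variable [IsManifold (𝓡∂ (m + 1)) ∞ M]

instance : IsManifold (𝓡∂ (m + 1)) 1 M := IsManifold.of_le (n := ∞) (by simp)

theorem contDiffWithinAt_transition {x₀ x₁ : M} {y : Model m} (hy : y ∈ overlap m x₀ x₁) :
    ContDiffWithinAt ℝ ∞ (transition m x₀ x₁) (halfSpace m) y :=
  contDiffWithinAt_ext_coord_change x₁ x₀ (by
    simpa only [PartialEquiv.trans_source, PartialEquiv.symm_source] using hy)

theorem tendsto_transition {x₀ x₁ : M} {y : Model m} (hy : y ∈ overlap m x₀ x₁) :
    Filter.Tendsto (transition m x₀ x₁) (nhdsWithin y (halfSpace m))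
      (nhdsWithin (transition m x₀ x₁ y) (halfSpace m)) := by
  refine tendsto_nhdsWithin_of_tendsto_nhds_of_eventually_within _
    (contDiffWithinAt_transition hy).continuousWithinAt ?_
  filter_upwards [overlap_mem_nhdsWithin hy] with z hz
  exact (isRelOpen_overlap x₁ x₀).sub (transition_mem hz)

theorem fderivWithin_transition_comp {x₀ x₁ x₂ : M} {y : Model m} (hy : y ∈ overlap m x₀ x₁)
    (hy' : y ∈ overlap m x₀ x₂) :
    fderivWithin ℝ (transition m x₀ x₂) (halfSpace m) y =
      (fderivWithin ℝ (transition m x₁ x₂) (halfSpace m) (transition m x₀ x₁ y)).comp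
        (fderivWithin ℝ (transition m x₀ x₁) (halfSpace m) y) := by
  have hz : transition m x₀ x₁ y ∈ overlap m x₁ x₂ := by
    refine ⟨(transition_mem hy).1, ?_⟩
    rw [mem_preimage, symm_transition hy]
    exact hy'.2
  have h1 := ((contDiffWithinAt_transition hz).differentiableWithinAt
    (by simp)).hasFDerivWithinAt.comp_of_tendsto y
      ((contDiffWithinAt_transition hy).differentiableWithinAt (by simp)).hasFDerivWithinAt
      (tendsto_transition hy)
  have e : transition m x₀ x₂ =ᶠ[nhdsWithin y (halfSpace m)]
      transition m x₁ x₂ ∘ transition m x₀ x₁ := by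
    filter_upwards [overlap_mem_nhdsWithin hy] with z hz
    change chart m x₂ _ = chart m x₂ ((chart m x₁).symm (transition m x₀ x₁ z))
    rw [symm_transition hz]
  rw [e.fderivWithin_eq_of_mem ((isRelOpen_overlap x₀ x₁).sub hy)]
  exact h1.fderivWithin ((isRelOpen_overlap x₀ x₁).uniq _ ((isRelOpen_overlap x₀ x₁).sub hy))

omit [IsManifold (𝓡∂ (m + 1)) ∞ M] in
theorem fderivWithin_transition_self {x₀ : M} {y : Model m} (hy : y ∈ (chart m x₀).target) :
    fderivWithin ℝ (transition m x₀ x₀) (halfSpace m) y = ContinuousLinearMap.id ℝ (Model m) := by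
  have h := isRelOpen_target (m := m) x₀
  have e : transition m x₀ x₀ =ᶠ[nhdsWithin y (halfSpace m)] id := by
    filter_upwards [h.nhds y hy] with z hz
    exact (chart m x₀).right_inv hz
  rw [e.fderivWithin_eq_of_mem (h.sub hy)]
  exact fderivWithin_id (h.uniq y (h.sub hy))

theorem isChange_transition {x₀ x₁ : M} {y : Model m} (hy : y ∈ overlap m x₀ x₁) :
    IsChange (halfSpace m) (transition m x₀ x₁) y where
  mem := (isRelOpen_overlap x₀ x₁).sub hy
  uniq := (isRelOpen_overlap x₀ x₁).uniq
  closure := (isRelOpen_overlap x₀ x₁).closure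
  smooth := contDiffWithinAt_transition hy
  tendsto := tendsto_transition hy
  inv := by
    refine ⟨fderivWithin ℝ (transition m x₁ x₀) (halfSpace m) (transition m x₀ x₁ y), ?_⟩
    have := fderivWithin_transition_comp (transition_mem hy)
      (x₂ := x₁) ⟨(transition_mem hy).1, (chart m x₁).map_target (transition_mem hy).1⟩
    rw [transition_transition hy] at this
    rw [← this, fderivWithin_transition_self (transition_mem hy).1]

/-- The differential of the inverse of a chart, as an endomorphism of the model space. -/
def frame (x₀ : M) (y : Model m) : Model m →L[ℝ] Model m := chartFrame x₀ y

/-- The tangent space at `x` is identified with the model space through the preferred chart at `x`.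
The differential of an inverse chart is therefore that of the transition to this chart, and all
statements about frames become statements about transitions. -/
theorem frame_eq {x₀ x : M} {y : Model m} (hy : y ∈ (chart m x₀).target)
    (hx : x = (chart m x₀).symm y) :
    frame x₀ y = fderivWithin ℝ (transition m x₀ x) (halfSpace m) y := by
  subst hx
  refine (mdifferentiableWithinAt_extChartAt_symm hy).mfderivWithin.trans ?_
  rw [writtenInExtChartAt, extChartAt_model_space_eq_id, modelWithCornersSelf_coe, range_id,
    inter_univ]
  rfl

theorem frame_comp {x₀ x₁ : M} {y : Model m} (hy : y ∈ overlap m x₀ x₁) :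
    frame x₀ y = (frame x₁ (transition m x₀ x₁ y)).comp
      (fderivWithin ℝ (transition m x₀ x₁) (halfSpace m) y) := by
  rw [frame_eq hy.1 rfl, frame_eq (transition_mem hy).1 (symm_transition hy).symm]
  exact fderivWithin_transition_comp hy (mem_overlap_self hy.1)

theorem frame_self (x : M) : frame x (chart m x x) = ContinuousLinearMap.id ℝ (Model m) := by
  have hy : chart m x x ∈ (chart m x).target := mem_extChartAt_target x
  rw [frame_eq hy (extChartAt_to_inv x).symm, fderivWithin_transition_self hy]

theorem frame_isInvertible {x₀ : M} {y : Model m} (hy : y ∈ (chart m x₀).target) :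
    (frame x₀ y).IsInvertible :=
  isInvertible_mfderivWithin_extChartAt_symm hy

theorem exists_frame_right_inverse {x₀ : M} {y : Model m} (hy : y ∈ (chart m x₀).target) :
    ∃ B : Model m →L[ℝ] Model m, (frame x₀ y).comp B = ContinuousLinearMap.id ℝ _ := by
  obtain ⟨e, he⟩ := frame_isInvertible hy
  refine ⟨e.symm, ?_⟩
  rw [← he]
  ext v
  simp

/-! ### Local expressions of tensors -/

/-- A field of forms, as a function with values in the forms on the model space. -/
def formAt {k : ℕ} (η : DForm m M k) (x : M) : Frm m k := η x

omit [IsManifold (𝓡∂ (m + 1)) ∞ M] in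
theorem localForm_eq {k : ℕ} (η : DForm m M k) (x₀ : M) (y : Model m) :
    localForm η x₀ y = pull (frame x₀ y) (formAt η ((chart m x₀).symm y)) := rfl

theorem localForm_self {k : ℕ} (η : DForm m M k) (x : M) :
    localForm η x (chart m x x) = formAt η x := by
  rw [localForm_eq, frame_self, extChartAt_to_inv]
  rfl

theorem localForm_transition {k : ℕ} (η : DForm m M k) {x₀ x₁ : M} {y : Model m}
    (hy : y ∈ overlap m x₀ x₁) :
    localForm η x₀ y = pull (fderivWithin ℝ (transition m x₀ x₁) (halfSpace m) y)
      (localForm η x₁ (transition m x₀ x₁ y)) := by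
  rw [localForm_eq, localForm_eq, frame_comp hy, symm_transition hy]
  rfl

/-- A vector field, as a function with values in the model space. -/
def vecAt (F : VField m M) (x : M) : Model m := F x

theorem frame_localVField (F : VField m M) {x₀ : M} {y : Model m} (hy : y ∈ (chart m x₀).target) :
    frame x₀ y (localVField F x₀ y) = vecAt F ((chart m x₀).symm y) := by
  obtain ⟨e, he⟩ := frame_isInvertible hy
  have h : localVField F x₀ y = (frame x₀ y).inverse (vecAt F ((chart m x₀).symm y)) := rfl
  rw [h, ← he, ContinuousLinearMap.inverse_equiv]
  simp

theorem localVField_self (F : VField m M) (x : M) :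
    localVField F x (chart m x x) = vecAt F x := by
  have := frame_localVField F (mem_extChartAt_target (I := 𝓡∂ (m + 1)) x)
  rwa [frame_self, extChartAt_to_inv] at this

theorem frame_injective {x₀ : M} {y : Model m} (hy : y ∈ (chart m x₀).target) :
    Function.Injective (frame x₀ y) := by
  obtain ⟨e, he⟩ := frame_isInvertible hy
  rw [← he]
  exact e.injective

theorem localVField_transition (F : VField m M) {x₀ x₁ : M} {y : Model m}
    (hy : y ∈ overlap m x₀ x₁) :
    localVField F x₁ (transition m x₀ x₁ y) =
      fderivWithin ℝ (transition m x₀ x₁) (halfSpace m) y (localVField F x₀ y) := by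
  apply frame_injective (transition_mem hy).1
  rw [frame_localVField F (transition_mem hy).1, symm_transition hy, ← frame_localVField F hy.1,
    frame_comp hy]
  rfl

variable (g : RiemMetric m M)

theorem localMetric_eq (x₀ : M) (y : Model m) :
    localMetric g x₀ y =
      (metricAt g ((chart m x₀).symm y)).bilinearComp (frame x₀ y) (frame x₀ y) := rfl

theorem localMetric_self (x : M) : localMetric g x (chart m x x) = metricAt g x := by
  rw [localMetric_eq, frame_self, extChartAt_to_inv]
  rfl

theorem localMetric_transition {x₀ x₁ : M} {y : Model m} (hy : y ∈ overlap m x₀ x₁) :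
    localMetric g x₀ y = (localMetric g x₁ (transition m x₀ x₁ y)).bilinearComp
      (fderivWithin ℝ (transition m x₀ x₁) (halfSpace m) y)
      (fderivWithin ℝ (transition m x₀ x₁) (halfSpace m) y) := by
  rw [localMetric_eq, localMetric_eq, frame_comp hy, symm_transition hy]
  rfl

theorem isMetric_metricAt (x : M) : IsMetric (metricAt g x) where
  symm := g.symm x
  pos := g.pos x

theorem isMetric_localMetric {x₀ : M} {y : Model m} (hy : y ∈ (chart m x₀).target) :
    IsMetric (localMetric g x₀ y) :=
  (isMetric_metricAt g _).pull (frame_injective hy)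

/-- In the trivialization of the tangent bundle at `x₀` the coordinate field is the constant `u`,
since the chart and its inverse have inverse differentials. -/
theorem contMDiffWithinAt_frame (x₀ : M) {y : Model m} (hy : y ∈ (chart m x₀).target)
    (u : Model m) :
    ContMDiffWithinAt 𝓘(ℝ, Model m) (𝓡∂ (m + 1)).tangent ∞
      (fun z => (⟨(chart m x₀).symm z, chartFrame x₀ z u⟩ : TangentBundle (𝓡∂ (m + 1)) M))
      (chart m x₀).target y := by
  have hs : ∀ z ∈ (chart m x₀).target, (chart m x₀).symm z ∈ (chartAt (EuclideanHalfSpace (m + 1)) x₀).source :=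
    fun z hz => by
      rw [← extChartAt_source (𝓡∂ (m + 1))]
      exact (chart m x₀).map_target hz
  refine ((trivializationAt (Model m) (TangentSpace (𝓡∂ (m + 1))) x₀).contMDiffWithinAt_iff
    ?_).2 ⟨contMDiffOn_extChartAt_symm x₀ y hy, ?_⟩
  · rw [Bundle.Trivialization.mem_source]
    exact hs y hy
  · refine ContMDiffWithinAt.congr_of_mem (f := fun _ => u) contMDiffWithinAt_const
      (fun z hz => ?_) hy
    have h1 := TangentBundle.continuousLinearMapAt_trivializationAt (𝕜 := ℝ) (I := 𝓡∂ (m + 1))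
      (hs z hz)
    have h2 := mfderiv_extChartAt_comp_mfderivWithin_extChartAt_symm (I := 𝓡∂ (m + 1)) hz
    rw [← h1] at h2
    have h3 := congrArg (fun A : Model m →L[ℝ] Model m => A u) h2
    refine Eq.trans ?_ h3
    exact (congrFun (Bundle.Trivialization.coe_linearMapAt_of_mem (R := ℝ)
      (trivializationAt (Model m) (TangentSpace (𝓡∂ (m + 1))) x₀) (hs z hz)) _).symm

theorem contDiffOn_localMetric (x₀ : M) :
    ContDiffOn ℝ ∞ (localMetric g x₀) (chart m x₀).target := by
  rw [contDiffOn_clm_apply]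
  intro u
  rw [contDiffOn_clm_apply]
  intro v y hy
  have : ContMDiffWithinAt 𝓘(ℝ, Model m) ((𝓡∂ (m + 1)).prod 𝓘(ℝ)) ∞
      (fun z => Bundle.TotalSpace.mk' ℝ (E := Bundle.Trivial M ℝ) ((chart m x₀).symm z)
        (g.inner ((chart m x₀).symm z) (chartFrame x₀ z u) (chartFrame x₀ z v)))
      (chart m x₀).target y := by
    apply ContMDiffWithinAt.clm_bundle_apply₂ (F₁ := Model m) (F₂ := Model m)
    · exact ContMDiffAt.comp_contMDiffWithinAt y g.contMDiff.contMDiffAt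
        (contMDiffOn_extChartAt_symm x₀ y hy)
    · exact contMDiffWithinAt_frame x₀ hy u
    · exact contMDiffWithinAt_frame x₀ hy v
  simp only [Bundle.contMDiffWithinAt_totalSpace] at this
  exact this.2.contDiffWithinAt

theorem isMetricOn_localMetric (x₀ : M) :
    IsMetricOn (halfSpace m) (chart m x₀).target (localMetric g x₀) where
  toIsRelOpen := isRelOpen_target x₀
  smooth := contDiffOn_localMetric g x₀
  metric _ hy := isMetric_localMetric g hy

end Charts

end

end Rellich

namespace Rellich

noncomputable section

/-! ### The operators in local coordinates -/

section LocalOperators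

variable {m k : ℕ} {M : Type*} [TopologicalSpace M] [ChartedSpace (EuclideanHalfSpace (m + 1)) M]
  [IsManifold (𝓡∂ (m + 1)) ∞ M] (g : RiemMetric m M) {x₀ : M} {y : Model m}

/-- The inverse metric matrix in a chart. -/
abbrev localInv (x₀ : M) (y : Model m) : Matrix (Fin (m + 1)) (Fin (m + 1)) ℝ :=
  (gram (localMetric g x₀ y))⁻¹

/-- The Christoffel symbols in a chart. -/
abbrev localChristoffel (x₀ : M) (y : Model m) : Model m →L[ℝ] Model m →L[ℝ] Model m :=
  christoffelL (halfSpace m) (localMetric g x₀) y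

theorem gInv_eq (x : M) : gInv g x = localInv g x (chart m x x) := by
  rw [localInv, localMetric_self]
  rfl

theorem christoffel_eq (x : M) : christoffel g x = localChristoffel g x (chart m x x) := by
  have h : christoffel g x = christ (gInv g x) (metricDeriv g x) := rfl
  rw [h, gInv_eq]
  rfl

theorem giRel_frame (hy : y ∈ (chart m x₀).target) :
    GiRel (frame x₀ y) (localInv g x₀ y) (gInv g ((chart m x₀).symm y)) := by
  obtain ⟨B, hB⟩ := exists_frame_right_inverse hy
  exact giRel_gram hB (metricAt g ((chart m x₀).symm y))

theorem innerForm_symm (α β : DForm m M k) (hy : y ∈ (chart m x₀).target) :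
    innerForm g α β ((chart m x₀).symm y) =
      formInner (localInv g x₀ y) (localForm α x₀ y) (localForm β x₀ y) := by
  rw [localForm_eq, localForm_eq, formInner_pull (giRel_frame g hy)]
  rfl

theorem innerV_symm (F G : VField m M) (hy : y ∈ (chart m x₀).target) :
    innerV g F G ((chart m x₀).symm y) =
      localMetric g x₀ y (localVField F x₀ y) (localVField G x₀ y) := by
  change metricAt g _ (vecAt F _) (vecAt G _) = metricAt g _ (frame x₀ y _) (frame x₀ y _)
  rw [frame_localVField F hy, frame_localVField G hy]

omit [IsManifold (𝓡∂ (m + 1)) ∞ M] in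
theorem IsSmoothForm.differentiableWithinAt {η : DForm m M k} (hη : IsSmoothForm η)
    (hy : y ∈ (chart m x₀).target) :
    DifferentiableWithinAt ℝ (localForm η x₀) (halfSpace m) y :=
  (isRelOpen_target x₀).differentiableWithinAt (hη x₀) hy

theorem localMetric_eventually {x₁ : M} (hy : y ∈ overlap m x₀ x₁) :
    ∀ᶠ z in nhdsWithin y (halfSpace m), localMetric g x₀ z =
      (localMetric g x₁ (transition m x₀ x₁ z)).bilinearComp
        (fderivWithin ℝ (transition m x₀ x₁) (halfSpace m) z)
        (fderivWithin ℝ (transition m x₀ x₁) (halfSpace m) z) := by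
  filter_upwards [overlap_mem_nhdsWithin hy] with z hz using localMetric_transition g hz

theorem localForm_eventually (η : DForm m M k) {x₁ : M} (hy : y ∈ overlap m x₀ x₁) :
    ∀ᶠ z in nhdsWithin y (halfSpace m), localForm η x₀ z =
      pull (fderivWithin ℝ (transition m x₀ x₁) (halfSpace m) z)
        (localForm η x₁ (transition m x₀ x₁ z)) := by
  filter_upwards [overlap_mem_nhdsWithin hy] with z hz using localForm_transition η hz

/-- The value of `extD` at each point is computed in the chart of that point, so the chart varies
with the point. Naturality under the transition to this chart shows that one fixed chart computes it
throughout its domain. -/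
theorem localForm_extD (g : RiemMetric m M) {η : DForm m M k} (hη : IsSmoothForm η) (hy : y ∈ (chart m x₀).target) :
    localForm (extD η) x₀ y = extDerivWithin (localForm η x₀) (halfSpace m) y := by
  have ho := mem_overlap_self hy
  have h := (isChange_transition ho).extDerivWithin_eq
    ((isMetricOn_localMetric g x₀).isMetricNear hy)
    ((isMetricOn_localMetric g _).isMetricNear (transition_mem ho).1)
    (localMetric_eventually g ho) (localForm_eventually η ho)
    (hη.differentiableWithinAt (transition_mem ho).1)
  rw [h, localForm_eq, frame_eq hy rfl]
  rfl

theorem isSmoothForm_extD (g : RiemMetric m M) {η : DForm m M k} (hη : IsSmoothForm η) :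
    IsSmoothForm (extD η) := fun x₀ =>
  ((isRelOpen_target x₀).contDiffOn_extDerivWithin (hη x₀)).congr fun _ hy =>
    localForm_extD g hη hy

theorem codiff_eq (η : DForm m M k) (x : M) :
    formAt (codiff g η) x = codL (halfSpace m) (localChristoffel g x (chart m x x))
      (localInv g x (chart m x x)) (localForm η x) (chart m x x) := by
  have h : formAt (codiff g η) x = -∑ i, ∑ j, gInv g x i j • interiorProd (coordVec i)
    (fderivWithin ℝ (localForm η x) (halfSpace m) (chart m x x) (coordVec j) -
      derivationAction (christoffel g x (coordVec j)) (formAt η x)) := rfl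
  rw [h, christoffel_eq, gInv_eq, ← localForm_self]
  rfl

theorem localForm_codiff {η : DForm m M k} (hη : IsSmoothForm η) (hy : y ∈ (chart m x₀).target) :
    localForm (codiff g η) x₀ y = codL (halfSpace m) (localChristoffel g x₀ y)
      (localInv g x₀ y) (localForm η x₀) y := by
  have ho := mem_overlap_self hy
  have h := (isChange_transition ho).codL_eq
    ((isMetricOn_localMetric g x₀).isMetricNear hy)
    ((isMetricOn_localMetric g _).isMetricNear (transition_mem ho).1)
    (localMetric_eventually g ho) (localForm_eventually η ho)
    (hη.differentiableWithinAt (transition_mem ho).1)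
  rw [h, localForm_eq, frame_eq hy rfl, codiff_eq]
  rfl

theorem isSmoothForm_codiff {η : DForm m M k} (hη : IsSmoothForm η) :
    IsSmoothForm (codiff g η) := fun x₀ =>
  ((isMetricOn_localMetric g x₀).contDiffOn_codL (hη x₀)).congr fun _ hy =>
    localForm_codiff g hη hy

omit [IsManifold (𝓡∂ (m + 1)) ∞ M] in
theorem isSmoothForm_add {η θ ζ : DForm m M k} (hη : IsSmoothForm η) (hθ : IsSmoothForm θ)
    (h : ∀ x, formAt ζ x = formAt η x + formAt θ x) : IsSmoothForm ζ := fun x₀ =>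
  ((hη x₀).add (hθ x₀)).congr fun y _ => by
    rw [localForm_eq, h, pull_add]
    rfl

theorem isSmoothForm_hodgeLaplacian {η : DForm m M k} (hη : IsSmoothForm η) :
    IsSmoothForm (hodgeLaplacian g η) := by
  cases k with
  | zero => exact isSmoothForm_codiff g (isSmoothForm_extD g hη)
  | succ k =>
    exact isSmoothForm_add (isSmoothForm_extD g (isSmoothForm_codiff g hη))
      (isSmoothForm_codiff g (isSmoothForm_extD g hη)) fun _ => rfl

theorem localForm_hodgeLaplacian_succ {η : DForm m M (k + 1)} (hη : IsSmoothForm η)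
    (hy : y ∈ (chart m x₀).target) :
    localForm (hodgeLaplacian g η) x₀ y =
      extDerivWithin (localForm (k := k) (codiff g η) x₀) (halfSpace m) y +
        (show Frm m (k + 1) from codL (k := k + 2) (halfSpace m) (localChristoffel g x₀ y)
          (localInv g x₀ y) (localForm (extD η) x₀) y) := by
  have h : localForm (hodgeLaplacian g η) x₀ y = localForm (extD (k := k) (codiff g η)) x₀ y +
    localForm (k := k + 1) (codiff g (extD η)) x₀ y := rfl
  rw [h, localForm_extD (k := k) g (isSmoothForm_codiff g hη) hy,
    localForm_codiff (k := k + 2) g (isSmoothForm_extD g hη) hy]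

theorem localForm_contract (F : VField m M) (α : DForm m M k) (hy : y ∈ (chart m x₀).target) :
    localForm (contract F α) x₀ y = interiorProd (localVField F x₀ y) (localForm α x₀ y) := by
  rw [localForm_eq, localForm_eq, interiorProd_pull, frame_localVField F hy]
  rfl

theorem extDerivWithin_localForm_extD {η : DForm m M k} (g : RiemMetric m M)
    (hη : IsSmoothForm η) (hy : y ∈ (chart m x₀).target) :
    extDerivWithin (localForm (extD η) x₀) (halfSpace m) y = 0 := by
  have h := isRelOpen_target (m := m) x₀
  have e : localForm (extD η) x₀ =ᶠ[nhdsWithin y (halfSpace m)]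
      extDerivWithin (localForm η x₀) (halfSpace m) :=
    Filter.mem_of_superset (h.nhds y hy) fun z hz => localForm_extD g hη hz
  rw [e.extDerivWithin_eq (localForm_extD g hη hy)]
  exact extDerivWithin_extDerivWithin_apply (h.contDiffWithinAt (hη x₀) hy)
    (by simp; exact WithTop.coe_le_coe.2 le_top)
    h.uniq (h.closure (h.sub hy)) (h.sub hy)

/-- For one-forms the codifferential has degree `0` and nothing is left to contract; in higher
degree it is `δδ = 0`. -/
theorem codL_localForm_codiff {η : DForm m M (k + 1)} (hη : IsSmoothForm η)
    (hy : y ∈ (chart m x₀).target) :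
    codL (halfSpace m) (localChristoffel g x₀ y) (localInv g x₀ y)
      (localForm (k := k) (codiff g η) x₀) y = 0 := by
  cases k with
  | zero =>
    simp [codL, interiorProd_zero_degree]
  | succ k =>
    exact (isMetricOn_localMetric g x₀).codL_codL (hη x₀)
      (fun z hz => localForm_codiff g hη hz) hy

/-! ### The covariant derivative of a vector field in local coordinates -/

theorem nablaV_eq (F : VField m M) (x : M) :
    nablaV g F x = covV (halfSpace m) (localChristoffel g x (chart m x x)) (localVField F x)
      (chart m x x) := by
  have h : nablaV g F x = fderivWithin ℝ (localVField F x) (halfSpace m) (chart m x x) +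
    (christoffel g x).flip (vecAt F x) := rfl
  rw [h, christoffel_eq, ← localVField_self]
  rfl

/-- Near the image point the new components are the differential of the transition applied to the
old components, both composed with the inverse transition, and both factors are differentiable. -/
theorem differentiableWithinAt_localVField (F : VField m M) {x₁ : M} (hy : y ∈ overlap m x₀ x₁)
    (hF : DifferentiableWithinAt ℝ (localVField F x₀) (halfSpace m) y) :
    DifferentiableWithinAt ℝ (localVField F x₁) (halfSpace m) (transition m x₀ x₁ y) := by
  have hz := transition_mem hy
  have hc := isChange_transition hz
  have e : localVField F x₁ =ᶠ[nhdsWithin (transition m x₀ x₁ y) (halfSpace m)] fun z =>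
      fderivWithin ℝ (transition m x₀ x₁) (halfSpace m) (transition m x₁ x₀ z)
        (localVField F x₀ (transition m x₁ x₀ z)) := by
    filter_upwards [overlap_mem_nhdsWithin hz] with z hz
    rw [← localVField_transition F (transition_mem hz), transition_transition hz]
  have hF' := hF
  have hd := (isChange_transition hy).hasFDerivWithinAt_fderivWithin.differentiableWithinAt
  rw [← transition_transition hy] at hF' hd
  exact ((hc.hasFDerivWithinAt_comp hd).clm_apply
    (hc.hasFDerivWithinAt_comp hF')).differentiableWithinAt.congr_of_eventuallyEq_of_mem e
      hc.mem

theorem isDifferentiableVFieldAt_symm (F : VField m M) (hy : y ∈ (chart m x₀).target)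
    (hF : DifferentiableWithinAt ℝ (localVField F x₀) (halfSpace m) y) :
    IsDifferentiableVFieldAt F ((chart m x₀).symm y) :=
  differentiableWithinAt_localVField F (mem_overlap_self hy) hF

/-- The covariant derivative of a vector field in a chart. -/
abbrev localNabla (F : VField m M) (x₀ : M) (y : Model m) : Model m →L[ℝ] Model m :=
  covV (halfSpace m) (localChristoffel g x₀ y) (localVField F x₀) y

theorem frame_comp_localNabla (F : VField m M) (hy : y ∈ (chart m x₀).target)
    (hF : DifferentiableWithinAt ℝ (localVField F x₀) (halfSpace m) y) :
    (frame x₀ y).comp (localNabla g F x₀ y) =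
      (nablaV g F ((chart m x₀).symm y)).comp (frame x₀ y) := by
  have ho := mem_overlap_self hy
  have h := (isChange_transition ho).covV_eq
    ((isMetricOn_localMetric g x₀).isMetricNear hy)
    ((isMetricOn_localMetric g _).isMetricNear (transition_mem ho).1)
    (localMetric_eventually g ho) (f₀ := localVField F x₀) (f₁ := localVField F _)
    (by filter_upwards [overlap_mem_nhdsWithin ho] with z hz using localVField_transition F hz)
    hF (differentiableWithinAt_localVField F ho hF)
  rw [nablaV_eq, frame_eq hy rfl]
  exact h

theorem localForm_opT (F : VField m M) (α : DForm m M k) (hy : y ∈ (chart m x₀).target)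
    (hF : DifferentiableWithinAt ℝ (localVField F x₀) (halfSpace m) y) :
    localForm (opT g F α) x₀ y =
      derivationAction (localNabla g F x₀ y) (localForm α x₀ y) := by
  rw [localForm_eq α, derivationAction_pull _ _ _ (frame_comp_localNabla g F hy hF)]
  rfl

/-- The two endomorphisms are conjugate by the frame, and the trace is invariant under conjugation.
-/
theorem divergence_symm (F : VField m M) (hy : y ∈ (chart m x₀).target)
    (hF : DifferentiableWithinAt ℝ (localVField F x₀) (halfSpace m) y) :
    divergence g F ((chart m x₀).symm y) = LinearMap.trace ℝ (Model m) (localNabla g F x₀ y) := by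
  obtain ⟨e, he⟩ := frame_isInvertible hy
  have h := frame_comp_localNabla g F hy hF
  rw [← he] at h
  have h2 : (nablaV g F ((chart m x₀).symm y) : Model m →ₗ[ℝ] Model m) =
      (e.toLinearEquiv.conj (localNabla g F x₀ y : Model m →ₗ[ℝ] Model m)) := by
    ext1 v
    have h3 := congrArg (fun C : Model m →L[ℝ] Model m => C (e.symm v)) h
    simp only [ContinuousLinearMap.comp_apply, ContinuousLinearEquiv.coe_coe,
      ContinuousLinearEquiv.apply_symm_apply] at h3
    rw [LinearEquiv.conj_apply]
    exact h3.symm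
  rw [divergence, h2, LinearMap.trace_conj']

/-- The form is the trace, with respect to the inverse metric, of a bilinear map in the two
contraction slots, so `trace2_natural` carries it to the chart once `∇F` has been intertwined with
the frame. -/
theorem localForm_contractDF (F : VField m M) (α : DForm m M k) (hy : y ∈ (chart m x₀).target)
    (hF : DifferentiableWithinAt ℝ (localVField F x₀) (halfSpace m) y) :
    localForm (contractDF g F α) x₀ y = ∑ i, ∑ j, localInv g x₀ y i j •
      interiorProd (localNabla g F x₀ y (coordVec j))
        (interiorProd (coordVec i) (localForm α x₀ y)) := by
  set N := nablaV g F ((chart m x₀).symm y) with hN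
  have ht := trace2_natural (giRel_frame g hy) (LinearMap.mk₂ ℝ
    (fun u v => interiorL m (k - 1) (N v) (interiorL m k u (formAt α ((chart m x₀).symm y))))
    (by intros; simp only [map_add, add_apply]) (by intros; simp only [map_smul, smul_apply])
    (by intros; simp only [map_add, add_apply]) (by intros; simp only [map_smul, smul_apply]))
  simp only [trace2, LinearMap.mk₂_apply, interiorL_apply] at ht
  have h1 : localForm (contractDF g F α) x₀ y = pull (frame x₀ y) (∑ i, ∑ j,
    gInv g ((chart m x₀).symm y) i j • interiorProd (N (coordVec j))
      (interiorProd (coordVec i) (formAt α ((chart m x₀).symm y)))) := rfl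
  rw [h1, ← ht, ← pullL_apply, map_sum]
  refine Finset.sum_congr rfl fun i _ => ?_
  rw [map_sum]
  refine Finset.sum_congr rfl fun j _ => ?_
  have h2 := congrArg (fun C : Model m →L[ℝ] Model m => C (coordVec j))
    (frame_comp_localNabla g F hy hF)
  simp only [ContinuousLinearMap.comp_apply] at h2
  rw [map_smul, pullL_apply, localForm_eq, interiorProd_pull, interiorProd_pull, h2, ← hN]

end LocalOperators

end

end Rellich

namespace Rellich

noncomputable section

/-! ### Algebra of the Rellich field -/

section RellichAlgebra

variable {m k p : ℕ} {gi gi' : Matrix (Fin (m + 1)) (Fin (m + 1)) ℝ}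
  {A : Model m →L[ℝ] Model m} {B : Model m →L[ℝ] Model m →L[ℝ] ℝ}

theorem apply_pairField (θ : Model m →L[ℝ] ℝ) (φ : Frm m (k - 1)) (α : Frm m k) :
    θ (pairField gi φ α) = formInner gi (wedgeCovector (k := k) θ φ) α := by
  rw [pairField, wedgeCovector_eq_sum θ φ, map_sum, ← formInnerL_apply, map_sum, sum_apply]
  refine Finset.sum_congr rfl fun i _ => ?_
  rw [map_smul, map_smul, smul_apply, formInnerL_apply, smul_eq_mul, smul_eq_mul, mul_comm]

theorem covector_ext {u v : Model m} (h : ∀ θ : Model m →L[ℝ] ℝ, θ u = θ v) : u = v := by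
  ext i
  exact h (coordCovec i)

/-- Tested against a covector `θ`, the field gives `⟨θ ∧ φ, α⟩`, whose naturality is that of the
inner product and of the exterior product. -/
theorem pairField_natural (h : GiRel A gi gi') (φ : Frm m (k - 1)) (α : Frm m k) :
    A (pairField gi (pull A φ) (pull A α)) = pairField gi' φ α := by
  refine covector_ext fun θ => ?_
  rw [apply_pairField, ← ContinuousLinearMap.comp_apply, apply_pairField, wedgeCovector_pull,
    formInner_pull h]

theorem rellichField_natural (h : GiRel A gi gi') (α : Frm m (p + 1)) (β : Frm m (p - 1))
    (v : Model m) :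
    A (rellichField gi (B.bilinearComp A A) (pull A α) (pull A β) v) =
      rellichField gi' B α β (A v) := by
  have e : wedgeCovector (k := p) (B.bilinearComp A A v) (pull A β) =
      pull A (wedgeCovector (k := p) (B (A v)) β) := wedgeCovector_pull A (B (A v)) β
  have h2 := pairField_natural (k := p + 1) h (wedgeCovector (k := p) (B (A v)) β) α
  rw [rellichField, rellichField, map_sub, map_add, map_sub, map_sub, map_smul, map_smul,
    formInner_pull h, formInner_pull h, interiorProd_pull, interiorProd_pull,
    pairField_natural h, pairField_natural h, e, h2]

theorem interiorProd_self (v : Model m) (α : Frm m k) : interiorProd v (interiorProd v α) = 0 := by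
  have h := interiorProd_interiorProd v v α
  rw [eq_neg_iff_add_eq_zero, ← two_smul ℝ] at h
  exact (smul_eq_zero.1 h).resolve_left two_ne_zero

theorem interiorProd_neg_right (v : Model m) (α : Frm m k) :
    interiorProd v (-α) = -interiorProd v α := map_neg (interiorL m k v) α

theorem interiorProd_sub_right (v : Model m) (α β : Frm m k) :
    interiorProd v (α - β) = interiorProd v α - interiorProd v β := map_sub (interiorL m k v) α β

theorem wedgeCovector_neg_right (θ : Model m →L[ℝ] ℝ) (α : Frm m (k - 1)) :
    wedgeCovector (k := k) θ (-α) = -wedgeCovector (k := k) θ α := map_neg (wedgeL m k θ) α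

theorem wedgeCovector_sub_right (θ : Model m →L[ℝ] ℝ) (α β : Frm m (k - 1)) :
    wedgeCovector (k := k) θ (α - β) =
      wedgeCovector (k := k) θ α - wedgeCovector (k := k) θ β := map_sub (wedgeL m k θ) α β

/-- The pullback by a projection along a vector. -/
theorem pull_projection {θ : Model m →L[ℝ] ℝ} {ν : Model m} (γ : Frm m k) :
    pull (ContinuousLinearMap.id ℝ (Model m) - θ.smulRight ν) γ =
      γ - wedgeCovector (k := k) θ (interiorProd ν γ) := by
  induction k with
  | zero =>
    refine form_ext_zero ?_
    have h0 : wedgeCovector (k := 0) θ (interiorProd ν γ) = 0 := rfl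
    rw [h0, sub_zero, pull_apply]
    exact congrArg γ (Subsingleton.elim _ _)
  | succ k ih =>
    refine form_ext_interiorProd fun v => ?_
    let X : Frm m k := interiorProd v γ
    let N : Frm m k := interiorProd ν γ
    have hX : interiorProd ν X = -interiorProd v N := interiorProd_interiorProd ν v γ
    -- Only `ν ⌟ (ν ⌟ γ) = 0` is used, so that `θ ν` need not be `1`: an alternating form sees a
    -- rank-one correction at most once.
    have hN : interiorProd ν N = 0 := interiorProd_self ν γ
    have h2 : (ContinuousLinearMap.id ℝ (Model m) - θ.smulRight ν) v = v - θ v • ν := rfl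
    have h3 : interiorProd (v - θ v • ν) γ = X - θ v • N := by
      rw [← interiorL_apply, map_sub, map_smul]
      rfl
    have h4 : interiorProd ν (X - θ v • N) = -interiorProd v N := by
      rw [interiorProd_sub_right, interiorProd_smul_right, hN, smul_zero, sub_zero, hX]
    have h5 := ih (X - θ v • N)
    have h6 : interiorProd v (γ - wedgeCovector (k := k + 1) θ N) =
        X - (θ v • N - wedgeCovector (k := k) θ (interiorProd v N)) := by
      rw [interiorProd_sub_right, interiorProd_wedgeCovector]
    rw [h4, wedgeCovector_neg_right] at h5
    refine Eq.trans ?_ (h5.trans ?_)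
    · rw [interiorProd_pull, h2, h3]
    · refine Eq.trans ?_ h6.symm
      abel

/-- The projection changes `γ` by an exterior product with `ν`, which is orthogonal to every form
that `ν` annihilates. This is why `ι^*` may be dropped in the boundary terms. -/
theorem formInner_pull_projection {G : Model m →L[ℝ] Model m →L[ℝ] ℝ} (hG : IsMetric G)
    (ν : Model m) (γ δ : Frm m k) (hδ : interiorProd ν δ = 0) :
    formInner (gram G)⁻¹ (pull (ContinuousLinearMap.id ℝ (Model m) - (G ν).smulRight ν) γ) δ =
      formInner (gram G)⁻¹ γ δ := by
  rw [pull_projection, ← formInnerL_apply, map_sub, sub_apply, formInnerL_apply, formInnerL_apply,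
    formInner_wedgeCovector, hG.sharp_flat, hδ, formInner_zero_right, sub_zero]

theorem wedgeCovector_anticomm (θ θ' : Model m →L[ℝ] ℝ) (μ : Frm m (k - 1)) :
    wedgeCovector (k := k + 1) θ (wedgeCovector (k := k) θ' μ) =
      -wedgeCovector (k := k + 1) θ' (wedgeCovector (k := k) θ μ) := by
  induction k with
  | zero =>
    have h : ∀ θ'' : Model m →L[ℝ] ℝ, wedgeCovector (k := 0) θ'' μ = 0 := fun _ => rfl
    rw [h, h, ← wedgeL_apply, ← wedgeL_apply, map_zero, map_zero, neg_zero]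
  | succ k ih =>
    refine form_ext_interiorProd fun v => ?_
    have h := ih (interiorProd v μ)
    have e : ∀ θ₁ θ₂ : Model m →L[ℝ] ℝ, interiorProd v (wedgeCovector (k := k + 2) θ₁
        (wedgeCovector (k := k + 1) θ₂ μ)) = θ₁ v • wedgeCovector (k := k + 1) θ₂ μ -
          (θ₂ v • wedgeCovector (k := k + 1) θ₁ μ - wedgeCovector (k := k + 1) θ₁
            (wedgeCovector (k := k) θ₂ (interiorProd v μ))) := by
      intro θ₁ θ₂
      have h1 := interiorProd_wedgeCovector v θ₁ (wedgeCovector (k := k + 1) θ₂ μ)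
      have h2 : interiorProd v (wedgeCovector (k := k + 1) θ₂ μ) =
        θ₂ v • (show Frm m k from μ) - wedgeCovector (k := k) θ₂ (interiorProd v μ) :=
        interiorProd_wedgeCovector v θ₂ μ
      have h3 : wedgeCovector (k := k + 1) θ₁ (interiorProd v (wedgeCovector (k := k + 1) θ₂ μ)) =
          θ₂ v • wedgeCovector (k := k + 1) θ₁ μ - wedgeCovector (k := k + 1) θ₁
            (wedgeCovector (k := k) θ₂ (interiorProd v μ)) := by
        refine (congrArg (wedgeL m (k + 1) θ₁) h2).trans ?_
        rw [map_sub, map_smul]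
        rfl
      rw [← h3]
      exact h1
    refine (e θ θ').trans ?_
    rw [interiorProd_neg_right]
    refine Eq.trans ?_ (congrArg Neg.neg (e θ' θ)).symm
    rw [h]
    abel

/-- The discarded part of `β` is an exterior product with `ν`; after anticommuting this factor past
`θ`, it is orthogonal to `α` as before. -/
theorem formInner_wedge_projection {G : Model m →L[ℝ] Model m →L[ℝ] ℝ} (hG : IsMetric G)
    (ν : Model m) (θ : Model m →L[ℝ] ℝ) (β : Frm m (k - 1)) (α : Frm m k)
    (hα : interiorProd ν α = 0) :
    formInner (gram G)⁻¹ (wedgeCovector (k := k) θ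
      (pull (ContinuousLinearMap.id ℝ (Model m) - (G ν).smulRight ν) β)) α =
      formInner (gram G)⁻¹ (wedgeCovector (k := k) θ β) α := by
  rw [pull_projection]
  cases k with
  | zero => rfl
  | succ k =>
    have h := wedgeCovector_anticomm (k := k) θ (G ν) (interiorProd ν β)
    let β' : Frm m k := β
    let μ : Frm m k := wedgeCovector (k := k) (G ν) (interiorProd ν β')
    have h2 : wedgeCovector (k := k + 1) θ (β' - μ) = wedgeCovector (k := k + 1) θ β' +
          wedgeCovector (k := k + 1) (G ν) (wedgeCovector (k := k) θ (interiorProd ν β')) := by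
      rw [wedgeCovector_sub_right]
      refine (congrArg (fun ζ => wedgeCovector (k := k + 1) θ β' - ζ) h).trans ?_
      rw [sub_neg_eq_add]
    refine (congrArg (fun ζ => formInner (gram G)⁻¹ ζ α) h2).trans ?_
    change formInner _ (_ + _) _ = _
    rw [← formInnerL_apply, map_add, add_apply, formInnerL_apply, formInnerL_apply,
      formInner_wedgeCovector (gram G)⁻¹ (G ν), hG.sharp_flat, hα, formInner_zero_right, add_zero]

/-- The normal component of the Rellich field. -/
theorem apply_rellichField {G : Model m →L[ℝ] Model m →L[ℝ] ℝ} (hG : IsMetric G)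
    (ν v : Model m) (α : Frm m (p + 1)) (β : Frm m (p - 1)) :
    G ν (rellichField (gram G)⁻¹ G α β v) =
      2⁻¹ * ((formInner (gram G)⁻¹ α α + formInner (gram G)⁻¹ β β) * G v ν) -
      formInner (gram G)⁻¹ (wedgeCovector (k := p) (G v)
        (pull (ContinuousLinearMap.id ℝ (Model m) - (G ν).smulRight ν) β)) (interiorProd ν α) -
      formInner (gram G)⁻¹ (pull (ContinuousLinearMap.id ℝ (Model m) - (G ν).smulRight ν)
        (interiorProd v α)) (interiorProd ν α) -
      formInner (gram G)⁻¹ (pull (ContinuousLinearMap.id ℝ (Model m) - (G ν).smulRight ν)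
        (interiorProd v β)) (interiorProd ν β) := by
  have h1 := formInner_wedge_projection (k := p) hG ν (G v) β (interiorProd ν α)
    (interiorProd_self ν α)
  rw [formInner_pull_projection hG ν _ _ (interiorProd_self ν α),
    formInner_pull_projection hG ν _ _ (interiorProd_self ν β), h1]
  simp only [rellichField, map_sub, map_add, map_smul, smul_eq_mul]
  have h2 := apply_pairField (k := p + 1) (gi := (gram G)⁻¹) (G ν)
    (wedgeCovector (k := p) (G v) β) α
  rw [apply_pairField, apply_pairField, h2, formInner_wedgeCovector, formInner_wedgeCovector]
  have h3 := formInner_wedgeCovector (k := p + 1) (gram G)⁻¹ (G ν)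
    (wedgeCovector (k := p) (G v) β) α
  rw [h3, hG.sharp_flat, hG.symm v ν]
  change _ = _ - formInner (k := p) (gram G)⁻¹ _ _ - formInner (k := p) (gram G)⁻¹ _ _ - _
  ring

end RellichAlgebra

/-! ### The Rellich field on a manifold -/

section RellichManifold

variable {m p : ℕ} {M : Type*} [TopologicalSpace M] [ChartedSpace (EuclideanHalfSpace (m + 1)) M]
  [IsManifold (𝓡∂ (m + 1)) ∞ M] (g : RiemMetric m M) (F : VField m M) {η : DForm m M p}
  {x₀ : M} {y : Model m}

theorem gInv_eq_gram (x : M) : gInv g x = (gram (metricAt g x))⁻¹ := rfl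

/-- The normal is dual to the normalized covector `dx^0`, so that its product with a field sees only
the coordinate `0`. -/
theorem apply_unitNormal (x : M) (w : Model m) :
    metricAt g x (vecAt (unitNormal g) x) w = (Real.sqrt (gInv g x 0 0))⁻¹ * w 0 := by
  have hm := isMetric_metricAt g x
  have h : vecAt (unitNormal g) x = (Real.sqrt (gInv g x 0 0))⁻¹ •
      sharp (gInv g x) (coordCovec 0) := by
    rw [sharp_coordCovec, vecAt, unitNormal]
    congr 1
    refine Finset.sum_congr rfl fun i _ => ?_
    have : gInv g x i 0 = gInv g x 0 i := hm.isSymm_inv.apply 0 i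
    rw [this]
  rw [h, map_smul, smul_apply, gInv_eq_gram, hm.apply_sharp]
  rfl

/-- The vector field whose divergence is the integrand of the Rellich identity. -/
def rellichV (η : DForm m M p) : VField m M := fun x =>
  (rellichField (gInv g x) (metricAt g x) (formAt (extD η) x) (formAt (codiff g η) x)
    (vecAt F x) : Model m)

/-- Every ingredient of the Rellich field is natural, so its components in a chart are obtained by
the same algebra from the local expressions. The model-space computations thereby apply to the field
on `M`. -/
theorem localVField_rellichV (η : DForm m M p) (hy : y ∈ (chart m x₀).target) :
    localVField (rellichV g F η) x₀ y = rellichField (localInv g x₀ y) (localMetric g x₀ y)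
      (localForm (extD η) x₀ y) (localForm (codiff g η) x₀ y) (localVField F x₀ y) := by
  apply frame_injective hy
  rw [frame_localVField _ hy, localMetric_eq, localForm_eq, localForm_eq,
    rellichField_natural (giRel_frame g hy), frame_localVField F hy]
  rfl

/-- The interior integrand of the Rellich identity. -/
def rellichDensity (η : DForm m M p) (x : M) : ℝ :=
  innerForm g (hodgeLaplacian g η) (contract F (extD η)) x +
    innerForm g (codiff g η) (contract F (hodgeLaplacian g η)) x +
    2⁻¹ * ((normSq g (extD η) x + normSq g (codiff g η) x) * divergence g F x) -
    innerForm g (codiff g η) (contractDF g F (extD η)) x -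
    innerForm g (opT g F (extD η)) (extD η) x -
    innerForm g (opT g F (codiff g η)) (codiff g η) x

/-- The boundary integrand of the Rellich identity. -/
def rellichFlux (η : DForm m M p) (x : M) : ℝ :=
  2⁻¹ * ((normSq g (extD η) x + normSq g (codiff g η) x) * innerV g F (unitNormal g) x) -
    innerForm g (wedge g F (tangentialPart g (codiff g η)))
      (contract (unitNormal g) (extD η)) x -
    innerForm g (tangentialPart g (contract F (extD η))) (contract (unitNormal g) (extD η)) x -
    innerForm g (tangentialPart g (contract F (codiff g η)))
      (contract (unitNormal g) (codiff g η)) x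

theorem rellichFlux_eq (η : DForm m M p) (x : M) :
    rellichFlux g F η x = (Real.sqrt (gInv g x 0 0))⁻¹ * vecAt (rellichV g F η) x 0 := by
  rw [← apply_unitNormal]
  exact (apply_rellichField (isMetric_metricAt g x) (vecAt (unitNormal g) x) (vecAt F x)
    (formAt (extD η) x) (formAt (codiff g η) x)).symm

theorem differentiableWithinAt_rellichV (hη : IsSmoothForm η) (hy : y ∈ (chart m x₀).target)
    (hF : DifferentiableWithinAt ℝ (localVField F x₀) (halfSpace m) y) :
    DifferentiableWithinAt ℝ (localVField (rellichV g F η) x₀) (halfSpace m) y := by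
  have h := ((isMetricOn_localMetric g x₀).isMetricNear hy).differentiableWithinAt_rellichField hF
    ((isSmoothForm_extD g hη).differentiableWithinAt hy)
    ((isSmoothForm_codiff g hη).differentiableWithinAt hy)
  refine h.congr_of_eventuallyEq_of_mem ?_ ((isRelOpen_target x₀).sub hy)
  exact Filter.mem_of_superset ((isRelOpen_target x₀).nhds y hy)
    fun z hz => localVField_rellichV g F η hz

/-- The interior integrand is rewritten in the chart term by term and then matched with the
pointwise divergence identity, where `dα = 0`, `δβ = 0` and `dβ + δα = Δη` are now available. -/
theorem trace_localNabla_rellichV (hη : IsSmoothForm η) (hy : y ∈ (chart m x₀).target)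
    (hF : DifferentiableWithinAt ℝ (localVField F x₀) (halfSpace m) y) :
    LinearMap.trace ℝ (Model m) (localNabla g (rellichV g F η) x₀ y) =
      rellichDensity g F η ((chart m x₀).symm y) := by
  have hn := (isMetricOn_localMetric g x₀).isMetricNear hy
  have hα := (isSmoothForm_extD g hη).differentiableWithinAt (x₀ := x₀) hy
  have hβ := (isSmoothForm_codiff g hη).differentiableWithinAt (x₀ := x₀) hy
  have hdα := extDerivWithin_localForm_extD g hη hy
  have e : localVField (rellichV g F η) x₀ =ᶠ[nhdsWithin y (halfSpace m)] fun z =>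
      rellichField (localInv g x₀ z) (localMetric g x₀ z) (localForm (extD η) x₀ z)
        (localForm (codiff g η) x₀ z) (localVField F x₀ z) :=
    Filter.mem_of_superset ((isRelOpen_target x₀).nhds y hy)
      fun z hz => localVField_rellichV g F η hz
  have e2 : localNabla g (rellichV g F η) x₀ y = covV (halfSpace m) (localChristoffel g x₀ y)
      (fun z => rellichField (localInv g x₀ z) (localMetric g x₀ z) (localForm (extD η) x₀ z)
        (localForm (codiff g η) x₀ z) (localVField F x₀ z)) y := by
    rw [localNabla, covV, covV, e.fderivWithin_eq_of_mem hn.mem, localVField_rellichV g F η hy]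
  rw [e2, rellichDensity]
  simp only [normSq]
  rw [innerForm_symm g _ _ hy, innerForm_symm g _ _ hy, innerForm_symm g _ _ hy,
    innerForm_symm g _ _ hy, innerForm_symm g _ _ hy, innerForm_symm g _ _ hy,
    innerForm_symm g _ _ hy, localForm_contract F _ hy, localForm_contract F _ hy,
    localForm_opT g F _ hy hF, localForm_opT g F _ hy hF, localForm_contractDF g F _ hy hF,
    divergence_symm g F hy hF]
  cases p with
  | zero =>
    -- In degree `0` the truncated degree `0 - 1` is again `0`, and the codifferential is a zero
    -- form of that degree.
    have hz : ∀ z, localForm (codiff g η) x₀ z = 0 := fun z => by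
      have : formAt (codiff g η) ((chart m x₀).symm z) = 0 := by
        have h : formAt (codiff g η) ((chart m x₀).symm z) = -∑ i, ∑ j,
          gInv g ((chart m x₀).symm z) i j • (0 : Frm m 0) := rfl
        simpa using h
      rw [localForm_eq, this]
      rfl
    have h := hn.trace_covV_rellichField_zero hF hα hz hdα
    have hh : localForm (hodgeLaplacian g η) x₀ y = codL (halfSpace m) (localChristoffel g x₀ y)
      (localInv g x₀ y) (localForm (extD η) x₀) y := localForm_codiff g (isSmoothForm_extD g hη) hy
    rw [hz, formInner_zero_left, formInner_zero_left, formInner_zero_left, formInner_zero_right,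
      hh, add_zero, add_zero, sub_zero, sub_zero]
    exact h
  | succ k =>
    have hh := localForm_hodgeLaplacian_succ g hη hy
    have h := hn.trace_covV_rellichField (k := k) hF hα hβ hdα (codL_localForm_codiff g hη hy) rfl hh
    exact h

/-- The local form of the divergence theorem for the Rellich field. -/
theorem sum_fderivWithin_rellichV (hη : IsSmoothForm η) (hy : y ∈ (chart m x₀).target)
    (hF : DifferentiableWithinAt ℝ (localVField F x₀) (halfSpace m) y) :
    ∑ i, fderivWithin ℝ (fun z => Real.sqrt (localGram g x₀ z).det *
      localVField (rellichV g F η) x₀ z i) (halfSpace m) y (coordVec i) =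
      Real.sqrt (localGram g x₀ y).det * rellichDensity g F η ((chart m x₀).symm y) := by
  rw [← trace_localNabla_rellichV g F hη hy hF]
  exact ((isMetricOn_localMetric g x₀).isMetricNear hy).sum_fderivWithin_density
    (differentiableWithinAt_rellichV g F hη hy hF)

end RellichManifold

end

end Rellich

namespace Rellich

noncomputable section

/-! ### The divergence theorem on the half-space -/

section HalfSpace

open Filter Topology

variable {m : ℕ}

/-- The points of the model space as pairs of the coordinate `0` and the other coordinates. -/
def consPair (q : ℝ × EuclideanSpace ℝ (Fin m)) : Model m := WithLp.toLp 2 (Fin.cons q.1 q.2.ofLp)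

@[simp] theorem consPair_zero (q : ℝ × EuclideanSpace ℝ (Fin m)) : consPair q 0 = q.1 := rfl

@[simp] theorem consPair_succ (q : ℝ × EuclideanSpace ℝ (Fin m)) (i : Fin m) :
    consPair q i.succ = q.2 i := rfl

theorem boundaryInclusion_eq (z : EuclideanSpace ℝ (Fin m)) :
    boundaryInclusion z = consPair (0, z) := rfl

@[simp] theorem boundaryInclusion_zero (z : EuclideanSpace ℝ (Fin m)) :
    boundaryInclusion z 0 = 0 := rfl

@[simp] theorem boundaryInclusion_succ (z : EuclideanSpace ℝ (Fin m)) (i : Fin m) :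
    boundaryInclusion z i.succ = z i := rfl

theorem boundaryInclusion_mem (z : EuclideanSpace ℝ (Fin m)) :
    boundaryInclusion z ∈ halfSpace m := mem_halfSpace.2 le_rfl

theorem volume_preserving_consPair :
    MeasurePreserving (consPair : ℝ × EuclideanSpace ℝ (Fin m) → Model m) := by
  have h1 := (volume_preserving_piFinSuccAbove (fun _ : Fin (m + 1) => ℝ) 0).symm
  have h2 : MeasurePreserving (Prod.map id WithLp.ofLp :
      ℝ × EuclideanSpace ℝ (Fin m) → ℝ × (Fin m → ℝ)) :=
    (MeasurePreserving.id _).prod (PiLp.volume_preserving_ofLp (Fin m))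
  have h3 := ((PiLp.volume_preserving_toLp (Fin (m + 1))).comp h1).comp h2
  convert h3 using 1
  funext q
  simp only [consPair, Function.comp, MeasurableEquiv.piFinSuccAbove_symm_apply, Prod.map]
  congr 1
  rw [Fin.insertNthEquiv_zero]
  rfl

theorem continuous_consPair :
    Continuous (consPair : ℝ × EuclideanSpace ℝ (Fin m) → Model m) := by
  refine (PiLp.continuous_toLp 2 _).comp (continuous_pi fun i => ?_)
  refine Fin.cases ?_ (fun j => ?_) i
  · exact continuous_fst
  · exact (PiLp.continuous_apply 2 _ j).comp continuous_snd

theorem continuous_boundaryInclusion :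
    Continuous (boundaryInclusion : EuclideanSpace ℝ (Fin m) → Model m) :=
  continuous_consPair.comp (continuous_const.prodMk continuous_id)

theorem measurableEmbedding_consPair :
    MeasurableEmbedding (consPair : ℝ × EuclideanSpace ℝ (Fin m) → Model m) := by
  refine continuous_consPair.measurableEmbedding fun p q h => ?_
  refine Prod.ext (congrArg (fun v : Model m => v 0) h) ?_
  ext i
  exact congrArg (fun v : Model m => v i.succ) h

theorem norm_le_norm_consPair (q : ℝ × EuclideanSpace ℝ (Fin m)) : ‖q.2‖ ≤ ‖consPair q‖ := by
  rw [EuclideanSpace.norm_eq, EuclideanSpace.norm_eq]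
  apply Real.sqrt_le_sqrt
  rw [Fin.sum_univ_succ]
  simp only [consPair_succ]
  exact le_add_of_nonneg_left (sq_nonneg _)

theorem consPair_sub (s : ℝ) (z : EuclideanSpace ℝ (Fin m)) :
    consPair (s, z) - boundaryInclusion z = s • coordVec 0 := by
  ext i
  refine Fin.cases ?_ (fun j => ?_) i
  · simp [coordVec_apply]
  · simp [coordVec_apply]

theorem norm_coordVec (i : Fin (m + 1)) : ‖(coordVec i : Model m)‖ = 1 := by
  simp [coordVec]

theorem measurableSet_halfSpace : MeasurableSet (halfSpace m) := by
  have : halfSpace m = {y : Model m | 0 ≤ y 0} := Set.ext fun _ => mem_halfSpace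
  rw [this]
  exact (isClosed_le continuous_const (PiLp.continuous_apply 2 _ 0)).measurableSet

variable {φ : Model m → ℝ} {C : NNReal} {R : ℝ}

theorem integrableOn_halfSpace (hφ : Continuous φ)
    (hR : ∀ y ∈ halfSpace m, R < ‖y‖ → φ y = 0) : IntegrableOn φ (halfSpace m) := by
  have h1 : IntegrableOn φ (Metric.closedBall 0 R) :=
    hφ.continuousOn.integrableOn_compact (isCompact_closedBall _ _)
  refine h1.of_forall_sdiff_eq_zero measurableSet_halfSpace fun y hy => hR y hy.1 ?_
  simpa using hy.2

/-- By Fubini the quantity is the mean over `0 ≤ s < 1/(n + 1)` of the integrals over the slices at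
height `s`. These depend on `s` in a Lipschitz way, since all slices vanish outside one ball, so the
means tend to the integral of the boundary slice. -/
theorem tendsto_strip (hφ : LipschitzWith C φ)
    (hR : ∀ y ∈ halfSpace m, R < ‖y‖ → φ y = 0) :
    Tendsto (fun n : ℕ => (n + 1 : ℝ) * ∫ y in {y : Model m | 0 ≤ y 0 ∧ y 0 < ((n : ℝ) + 1)⁻¹}, φ y)
      atTop (𝓝 (∫ z, φ (boundaryInclusion z))) := by
  set K := Metric.closedBall (0 : EuclideanSpace ℝ (Fin m)) R
  have hz : ∀ s : ℝ, 0 ≤ s → ∀ z ∉ K, φ (consPair (s, z)) = 0 := by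
    intro s hs z hzK
    refine hR _ (mem_halfSpace.2 hs) ?_
    have := norm_le_norm_consPair (s, z)
    simp only [K, Metric.mem_closedBall, dist_zero_right, not_le] at hzK
    exact hzK.trans_le this
  have hJ : ∀ s : ℝ, 0 ≤ s → Integrable fun z => φ (consPair (s, z)) := by
    intro s hs
    have hc : Continuous fun z : EuclideanSpace ℝ (Fin m) => φ (consPair (s, z)) :=
      hφ.continuous.comp (continuous_consPair.comp (continuous_const.prodMk continuous_id))
    rw [← integrableOn_univ]
    exact (hc.continuousOn.integrableOn_compact
      (isCompact_closedBall (0 : EuclideanSpace ℝ (Fin m)) R)).of_forall_sdiff_eq_zero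
        MeasurableSet.univ fun z hzK => hz s hs z hzK.2
  have hd : ∀ s : ℝ, 0 ≤ s → ‖(∫ z, φ (consPair (s, z))) - ∫ z, φ (boundaryInclusion z)‖ ≤
      C * s * volume.real K := by
    intro s hs
    change ‖_ - ∫ z, φ (consPair (0, z))‖ ≤ _
    rw [← integral_sub (hJ s hs) (hJ 0 le_rfl)]
    have e : ∀ z, (φ (consPair (s, z)) - φ (consPair (0, z))) =
        K.indicator (fun z => φ (consPair (s, z)) - φ (consPair (0, z))) z := by
      intro z
      by_cases h : z ∈ K
      · rw [indicator_of_mem h]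
      · rw [indicator_of_notMem h, hz s hs z h, hz 0 le_rfl z h, sub_self]
    rw [integral_congr_ae (ae_of_all _ e), integral_indicator measurableSet_closedBall]
    refine norm_setIntegral_le_of_norm_le_const measure_closedBall_lt_top fun z _ => ?_
    have h1 := hφ.dist_le_mul (consPair (s, z)) (consPair (0, z))
    rw [dist_eq_norm, dist_eq_norm, ← boundaryInclusion_eq, consPair_sub, norm_smul,
      norm_coordVec, mul_one, Real.norm_of_nonneg hs] at h1
    exact h1
  have hstrip : ∀ n : ℕ, ∫ y in {y : Model m | 0 ≤ y 0 ∧ y 0 < ((n : ℝ) + 1)⁻¹}, φ y =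
      ∫ s in Ico 0 ((n : ℝ) + 1)⁻¹, ∫ z, φ (consPair (s, z)) := by
    intro n
    have hp : consPair ⁻¹' {y : Model m | 0 ≤ y 0 ∧ y 0 < ((n : ℝ) + 1)⁻¹} =
        Ico 0 ((n : ℝ) + 1)⁻¹ ×ˢ (univ : Set (EuclideanSpace ℝ (Fin m))) := by
      ext q
      simp
    have hi : IntegrableOn (fun q => φ (consPair q))
        (Ico 0 ((n : ℝ) + 1)⁻¹ ×ˢ (univ : Set (EuclideanSpace ℝ (Fin m)))) := by
      refine ((hφ.continuous.comp continuous_consPair).continuousOn.integrableOn_compact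
        ((isCompact_Icc (a := (0 : ℝ)) (b := ((n : ℝ) + 1)⁻¹)).prod
          (isCompact_closedBall (0 : EuclideanSpace ℝ (Fin m)) R))).of_forall_sdiff_eq_zero
        (measurableSet_Ico.prod MeasurableSet.univ) fun q hq => hz q.1 hq.1.1.1 q.2 fun h => ?_
      exact hq.2 ⟨Ico_subset_Icc_self hq.1.1, h⟩
    have h2 := setIntegral_prod (μ := volume) (ν := volume) _ hi
    rw [← volume_preserving_consPair.setIntegral_preimage_emb measurableEmbedding_consPair, hp]
    simp only [Measure.restrict_univ] at h2
    exact h2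
  rw [tendsto_iff_norm_sub_tendsto_zero]
  have hb : ∀ n : ℕ, ‖(n + 1 : ℝ) * (∫ y in {y : Model m | 0 ≤ y 0 ∧ y 0 < ((n : ℝ) + 1)⁻¹}, φ y) -
      ∫ z, φ (boundaryInclusion z)‖ ≤ C * ((n : ℝ) + 1)⁻¹ * volume.real K := by
    intro n
    have ht : (0 : ℝ) < ((n : ℝ) + 1)⁻¹ := by positivity
    set t := ((n : ℝ) + 1)⁻¹ with ht_def
    have hti : (n : ℝ) + 1 = t⁻¹ := (inv_inv _).symm
    have hc : ∫ _ in Ico 0 t, (∫ z, φ (boundaryInclusion z)) = t * ∫ z, φ (boundaryInclusion z) := by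
      simp [ht.le]
    have hc2 : ∫ z, φ (boundaryInclusion z) =
        t⁻¹ * ∫ _ in Ico 0 t, (∫ z, φ (boundaryInclusion z)) := by
      rw [hc]; field_simp
    have hIi : IntegrableOn (fun s => ∫ z, φ (consPair (s, z))) (Ico 0 t) := by
      refine Measure.integrableOn_of_bounded (M := C * t * volume.real K +
        ‖∫ z, φ (boundaryInclusion z)‖) (by simp) ?_ ?_
      · have hsm : StronglyMeasurable (Function.uncurry fun (s : ℝ) z => φ (consPair (s, z))) :=
          (hφ.continuous.comp continuous_consPair).stronglyMeasurable
        exact hsm.integral_prod_right.aestronglyMeasurable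
      · filter_upwards [ae_restrict_mem measurableSet_Ico] with s hs
        have h1 := hd s hs.1
        have h2 : C * s * volume.real K ≤ C * t * volume.real K := by
          gcongr
          exact hs.2.le
        have h3 := norm_le_norm_add_norm_sub (∫ z, φ (boundaryInclusion z)) (∫ z, φ (consPair (s, z)))
        rw [norm_sub_rev] at h3
        linarith
    have hne : ‖∫ s in Ico 0 t, ((∫ z, φ (consPair (s, z))) - ∫ z, φ (boundaryInclusion z))‖ ≤
        C * t * volume.real K * volume.real (Ico 0 t) := by
      refine norm_setIntegral_le_of_norm_le_const (by simp) fun s hs => (hd s hs.1).trans ?_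
      gcongr
      exact hs.2.le
    rw [hstrip, ← ht_def, hti]
    conv_lhs => rw [hc2]
    rw [← mul_sub, ← integral_sub hIi (integrableOn_const (by simp)), norm_mul, norm_inv, Real.norm_of_nonneg ht.le]
    have hv : volume.real (Ico 0 t) = t := by simp [ht.le]
    rw [hv] at hne
    calc _ ≤ t⁻¹ * (C * t * volume.real K * t) := by gcongr
      _ = _ := by field_simp
  refine squeeze_zero (fun _ => norm_nonneg _) hb ?_
  have h0 : Tendsto (fun n : ℕ => ((n : ℝ) + 1)⁻¹) atTop (𝓝 0) :=
    (tendsto_atTop_add_const_right _ _ tendsto_natCast_atTop_atTop).inv_tendsto_atTop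
  simpa using (h0.const_mul (C : ℝ)).mul_const (volume.real K)

/-- Difference quotients with step `1/(n + 1)` converge to the derivative almost everywhere and are
dominated. Their integrals are computed by translation: a tangential shift preserves the half-space
and gives `0`, while a shift in direction `0` removes a thin strip and gives minus the boundary
integral. -/
theorem integral_fderivWithin_halfSpace_aux (hφ : LipschitzWith C φ)
    (hR : ∀ y ∈ halfSpace m, R < ‖y‖ → φ y = 0) (i : Fin (m + 1)) :
    IntegrableOn (fun y => fderivWithin ℝ φ (halfSpace m) y (coordVec i)) (halfSpace m) ∧
      ∫ y in halfSpace m, fderivWithin ℝ φ (halfSpace m) y (coordVec i) =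
        if i = 0 then -∫ z, φ (boundaryInclusion z) else 0 := by
  set H := halfSpace m
  -- Forward shifts stay in the half-space for every coordinate direction, so the quotients need the
  -- hypotheses on `φ` only there.
  have hmem : ∀ (y : Model m) (t : ℝ), y ∈ H → 0 ≤ t → y + t • coordVec i ∈ H := by
    intro y t hy ht
    rw [mem_halfSpace] at hy ⊢
    have : (y + t • (coordVec i : Model m)) 0 = y 0 + t * (coordVec i : Model m) 0 := rfl
    rw [this, coordVec_apply]
    split_ifs <;> linarith
  let t : ℕ → ℝ := fun n => ((n : ℝ) + 1)⁻¹
  have ht : ∀ n, 0 < t n := fun n => by positivity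
  have ht1 : ∀ n, t n ≤ 1 := fun n => inv_le_one_of_one_le₀ (by linarith [n.cast_nonneg (α := ℝ)])
  have hnorm : ∀ n (y : Model m), R + 1 < ‖y‖ → R < ‖y + t n • coordVec i‖ := by
    intro n y hy
    have h2 : ‖y‖ ≤ ‖y + t n • coordVec i‖ + ‖t n • (coordVec i : Model m)‖ := by
      simpa using norm_sub_le (y + t n • coordVec i) (t n • coordVec i)
    rw [norm_smul, norm_coordVec, mul_one, Real.norm_of_nonneg (ht n).le] at h2
    linarith [ht1 n]
  let D : ℕ → Model m → ℝ := fun n y => ((n : ℝ) + 1) * (φ (y + t n • coordVec i) - φ y)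
  have hDc : ∀ n, Continuous (D n) := fun n =>
    continuous_const.mul ((hφ.continuous.comp (continuous_id.add continuous_const)).sub
      hφ.continuous)
  -- The Lipschitz constant bounds the quotients, and as the steps are at most `1` they vanish
  -- outside the ball of radius `R + 1`.
  let bound : Model m → ℝ := (Metric.closedBall (0 : Model m) (R + 1)).indicator fun _ => (C : ℝ)
  have hbi : Integrable bound (volume.restrict H) :=
    (integrableOn_const (measure_closedBall_lt_top.ne)).integrable_indicator
      measurableSet_closedBall |>.restrict
  have hb : ∀ n, ∀ y ∈ H, ‖D n y‖ ≤ bound y := by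
    intro n y hy
    by_cases hyR : y ∈ Metric.closedBall (0 : Model m) (R + 1)
    · rw [show bound y = C from indicator_of_mem hyR _]
      have h1 := hφ.dist_le_mul (y + t n • coordVec i) y
      rw [dist_eq_norm, dist_eq_norm, add_sub_cancel_left, norm_smul, norm_coordVec, mul_one,
        Real.norm_of_nonneg (ht n).le] at h1
      rw [norm_mul, Real.norm_of_nonneg (by positivity : (0 : ℝ) ≤ (n : ℝ) + 1)]
      calc ((n : ℝ) + 1) * ‖φ (y + t n • coordVec i) - φ y‖ ≤ ((n : ℝ) + 1) * (C * t n) := by gcongr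
        _ = C := by simp only [t]; field_simp
    · rw [show bound y = 0 from indicator_of_notMem hyR _]
      rw [Metric.mem_closedBall, dist_zero_right, not_le] at hyR
      have h1 : R < ‖y + t n • coordVec i‖ := hnorm n y hyR
      simp only [D]
      rw [hR _ (hmem y _ hy (ht n).le) h1, hR y hy (by linarith)]
      simp
  have hlim : ∀ᵐ y ∂volume.restrict H, Tendsto (fun n => D n y) atTop
      (𝓝 (fderivWithin ℝ φ H y (coordVec i))) := by
    filter_upwards [(hφ.lipschitzOnWith (s := H)).ae_differentiableWithinAt
      (μ := volume) measurableSet_halfSpace, ae_restrict_mem measurableSet_halfSpace] with y hy hyH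
    refine hy.hasFDerivWithinAt.lim (c := fun n : ℕ => (n : ℝ) + 1)
      (d := fun n => t n • coordVec i) ?_ (Eventually.of_forall fun n => hmem y _ hyH (ht n).le)
      ?_
    · have h0 : Tendsto t atTop (𝓝 0) :=
        (tendsto_atTop_add_const_right _ _ tendsto_natCast_atTop_atTop).inv_tendsto_atTop
      simpa using h0.smul_const (coordVec i : Model m)
    · refine tendsto_const_nhds.congr fun n => ?_
      simp only [t, smul_smul]
      rw [mul_inv_cancel₀ (by positivity), one_smul]
  have hbae : ∀ n, ∀ᵐ y ∂volume.restrict H, ‖D n y‖ ≤ bound y := fun n =>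
    (ae_restrict_mem measurableSet_halfSpace).mono (hb n)
  have hint := tendsto_integral_of_dominated_convergence bound
    (fun n => (hDc n).aestronglyMeasurable) hbi hbae hlim
  refine ⟨?_, tendsto_nhds_unique hint ?_⟩
  · refine hbi.mono' (aestronglyMeasurable_of_tendsto_ae atTop
      (fun n => (hDc n).aestronglyMeasurable) hlim) ?_
    filter_upwards [hlim, ae_all_iff.2 hbae] with y h1 h2
    exact le_of_tendsto h1.norm (Eventually.of_forall h2)
  · have hφi := integrableOn_halfSpace hφ.continuous hR
    have hφt : ∀ n, IntegrableOn (fun y => φ (y + t n • coordVec i)) H := fun n =>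
      integrableOn_halfSpace (R := R + 1)
        (hφ.continuous.comp (continuous_id.add continuous_const)) fun y hy hyR =>
          hR _ (hmem y _ hy (ht n).le) (hnorm n y hyR)
    have hD : ∀ n, ∫ y in H, D n y = ((n : ℝ) + 1) *
        ((∫ y in H, φ (y + t n • coordVec i)) - ∫ y in H, φ y) := fun n => by
      rw [← integral_sub (hφt n) hφi, ← integral_const_mul]
    -- Translation invariance moves the shift from the function to the domain.
    have htr : ∀ n, ∫ y in H, φ (y + t n • coordVec i) =
        ∫ y in {y | y - t n • coordVec i ∈ H}, φ y := fun n => by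
      have hm : MeasurableSet {y : Model m | y - t n • coordVec i ∈ H} :=
        (measurable_id.sub_const _) measurableSet_halfSpace
      rw [← integral_indicator measurableSet_halfSpace, ← integral_indicator hm,
        ← integral_add_right_eq_self ({y : Model m | y - t n • coordVec i ∈ H}.indicator φ)
          (t n • (coordVec i : Model m))]
      congr 1
      funext y
      have e : y + t n • coordVec i ∈ {y : Model m | y - t n • coordVec i ∈ H} ↔ y ∈ H := by
        rw [mem_ofPred_eq, add_sub_cancel_right]
      by_cases hy : y ∈ H
      · rw [indicator_of_mem hy, indicator_of_mem (e.2 hy)]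
      · rw [indicator_of_notMem hy, indicator_of_notMem (mt e.1 hy)]
    split_ifs with hi
    · subst hi
      refine (tendsto_strip hφ hR).neg.congr fun n => ?_
      have hsub : {y : Model m | y - t n • coordVec 0 ∈ H} ⊆ H := fun y hy => by
        have := hmem _ _ hy (ht n).le
        rwa [sub_add_cancel] at this
      have hm : MeasurableSet {y : Model m | y - t n • coordVec 0 ∈ H} :=
        (measurable_id.sub_const _) measurableSet_halfSpace
      rw [hD, htr, ← mul_neg]
      congr 1
      -- The shifted half-space is the smaller one: what is lost is the strip treated in
      -- `tendsto_strip`, whence the sign.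
      have hdiff : H \ {y : Model m | y - t n • coordVec 0 ∈ H} =
          {y : Model m | 0 ≤ y 0 ∧ y 0 < ((n : ℝ) + 1)⁻¹} := by
        ext y
        have : (y - t n • (coordVec 0 : Model m)) 0 = y 0 - t n := by
          have : (y - t n • (coordVec 0 : Model m)) 0 = y 0 - t n * (coordVec 0 : Model m) 0 := rfl
          rw [this, coordVec_apply, if_pos rfl, mul_one]
        rw [Set.mem_sdiff, mem_ofPred_eq, mem_halfSpace, mem_halfSpace, this, mem_ofPred_eq]
        simp only [t, sub_nonneg, not_le]
      have h3 := setIntegral_sdiff hm hφi hsub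
      rw [hdiff] at h3
      rw [h3, neg_sub]
    · refine tendsto_const_nhds.congr fun n => ?_
      rw [hD, htr]
      have : {y | y - t n • coordVec i ∈ H} = H := by
        ext y
        have : (y - t n • (coordVec i : Model m)) 0 = y 0 - t n * (coordVec i : Model m) 0 := rfl
        rw [mem_ofPred_eq, mem_halfSpace, mem_halfSpace, this, coordVec_apply, if_neg (Ne.symm hi)]
        simp
      rw [this, sub_self, mul_zero]

/-- Compactness gives a Lipschitz constant `C` and a bound `|B|` on a ball that exceeds `K` by
distance `1`. A pair with one point in `K` and one outside this larger ball has distance at least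
`1`, so `|B|` times the distance controls the difference of values. -/
theorem LocallyLipschitzOn.exists_lipschitzOnWith_halfSpace {U K : Set (Model m)}
    (hU : IsRelOpen (halfSpace m) U) (hφ : LocallyLipschitzOn U φ) (hK : IsCompact K) (hKU : K ⊆ U)
    (h0 : ∀ y ∈ halfSpace m, y ∉ K → φ y = 0) : ∃ C, LipschitzOnWith C φ (halfSpace m) := by
  set H := halfSpace m
  -- At points of `U` this is the hypothesis, as `U` is relatively open; elsewhere the complement of
  -- `K` is a neighbourhood on which the function vanishes.
  have hloc : LocallyLipschitzOn H φ := by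
    intro y hy
    by_cases hyU : y ∈ U
    · obtain ⟨C, t, ht, hC⟩ := hφ hyU
      refine ⟨C, t, ?_, hC⟩
      have := nhdsWithin_inter_of_mem (hU.nhds y hyU)
      rw [inter_eq_left.2 hU.sub] at this
      rwa [← this]
    · refine ⟨0, Kᶜ ∩ H, Filter.inter_mem (mem_nhdsWithin_of_mem_nhds
        (hK.isClosed.isOpen_compl.mem_nhds fun h => hyU (hKU h))) self_mem_nhdsWithin, ?_⟩
      intro x hx z hz
      rw [h0 x hx.2 hx.1, h0 z hz.2 hz.1]
      simp
  obtain ⟨R, hR⟩ := hK.isBounded.subset_closedBall (0 : Model m)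
  have hHc : IsClosed H := by
    have : H = {y : Model m | 0 ≤ y 0} := Set.ext fun _ => mem_halfSpace
    rw [this]
    exact isClosed_le continuous_const (PiLp.continuous_apply 2 _ 0)
  have hBc : IsCompact (Metric.closedBall (0 : Model m) (R + 1) ∩ H) :=
    (isCompact_closedBall _ _).inter_right hHc
  have hlB : LocallyLipschitzOn (Metric.closedBall (0 : Model m) (R + 1) ∩ H) φ :=
    hloc.mono inter_subset_right
  obtain ⟨C, hC⟩ := hlB.exists_lipschitzOnWith_of_compact hBc
  obtain ⟨B, hB⟩ := hBc.exists_bound_of_continuousOn hC.continuousOn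
  have hBB : ∀ x ∈ H, ‖φ x‖ ≤ |B| := by
    intro x hx
    by_cases hxK : x ∈ K
    · exact (hB x ⟨Metric.closedBall_subset_closedBall (by linarith) (hR hxK), hx⟩).trans
        (le_abs_self B)
    · rw [h0 x hx hxK, norm_zero]
      exact abs_nonneg B
  have key : ∀ x ∈ H, ∀ z ∈ H, ‖z‖ ≤ R + 1 → dist (φ x) (φ z) ≤ (C + |B|) * dist x z := by
    intro x hx z hz hzR
    by_cases hxR : ‖x‖ ≤ R + 1
    · have h1 := hC.dist_le_mul x ⟨by simpa using hxR, hx⟩ z ⟨by simpa using hzR, hz⟩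
      refine h1.trans ?_
      gcongr
      linarith [abs_nonneg B]
    · have hxK : x ∉ K := fun h => hxR (by
        have := hR h
        rw [Metric.mem_closedBall, dist_zero_right] at this
        linarith)
      by_cases hzK : z ∈ K
      · have h2 : 1 ≤ dist x z := by
          have h3 := hR hzK
          rw [Metric.mem_closedBall, dist_zero_right] at h3
          rw [dist_eq_norm]
          have := norm_sub_norm_le x z
          rw [not_le] at hxR
          linarith
        rw [h0 x hx hxK, dist_zero_left]
        have h4 : |B| * 1 ≤ |B| * dist x z := by gcongr
        have h5 : 0 ≤ (C : ℝ) * dist x z := by positivity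
        rw [add_mul]
        linarith [hBB z hz]
      · rw [h0 x hx hxK, h0 z hz hzK, dist_self]
        positivity
  refine ⟨C + ⟨|B|, abs_nonneg B⟩, LipschitzOnWith.of_dist_le_mul fun x hx z hz => ?_⟩
  change _ ≤ ((C : ℝ) + |B|) * dist x z
  by_cases hzR : ‖z‖ ≤ R + 1
  · exact (key x hx z hz hzR)
  · by_cases hxR : ‖x‖ ≤ R + 1
    · rw [dist_comm (φ x), dist_comm x]
      exact (key z hz x hx hxR)
    · have hnK : ∀ w : Model m, ¬ ‖w‖ ≤ R + 1 → w ∉ K := fun w hw h => hw (by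
        have := hR h
        rw [Metric.mem_closedBall, dist_zero_right] at this
        linarith)
      rw [h0 x hx (hnK x hxR), h0 z hz (hnK z hzR), dist_self]
      positivity

/-- The divergence theorem on the half-space, for the partial derivatives of a function with compact
support that is Lipschitz near its support. -/
theorem integral_fderivWithin_halfSpace {U K : Set (Model m)}
    (hU : IsRelOpen (halfSpace m) U) (hφ : LocallyLipschitzOn U φ) (hK : IsCompact K) (hKU : K ⊆ U)
    (h0 : ∀ y ∈ halfSpace m, y ∉ K → φ y = 0) (i : Fin (m + 1)) :
    IntegrableOn (fun y => fderivWithin ℝ φ (halfSpace m) y (coordVec i)) (halfSpace m) ∧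
      ∫ y in halfSpace m, fderivWithin ℝ φ (halfSpace m) y (coordVec i) =
        if i = 0 then -∫ z, φ (boundaryInclusion z) else 0 := by
  obtain ⟨C, hC⟩ := LocallyLipschitzOn.exists_lipschitzOnWith_halfSpace hU hφ hK hKU h0
  -- The global Lipschitz extension is auxiliary: derivatives within the half-space and boundary
  -- values depend only on `φ` there.
  obtain ⟨ψ, hψ, hψe⟩ := hC.extend_real
  obtain ⟨R, hR⟩ := hK.isBounded.subset_closedBall (0 : Model m)
  have h := integral_fderivWithin_halfSpace_aux (R := R) hψ (fun y hy hyR => by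
    rw [← hψe hy]
    refine h0 y hy fun h => ?_
    have := hR h
    rw [Metric.mem_closedBall, dist_zero_right] at this
    linarith) i
  have e1 : ∀ y ∈ halfSpace m, fderivWithin ℝ ψ (halfSpace m) y (coordVec i) =
      fderivWithin ℝ φ (halfSpace m) y (coordVec i) := fun y hy => by
    rw [fderivWithin_congr hψe (hψe hy)]
  have e2 : ∀ z : EuclideanSpace ℝ (Fin m), ψ (boundaryInclusion z) = φ (boundaryInclusion z) :=
    fun z => (hψe (boundaryInclusion_mem z)).symm
  rw [integrableOn_congr_fun e1 measurableSet_halfSpace,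
    setIntegral_congr_fun measurableSet_halfSpace e1, funext e2] at h
  exact h

end HalfSpace

end

end Rellich

namespace Rellich

noncomputable section

/-! ### Measures given in parametrizations -/

section ParamMeasure

variable {E X : Type*} [MeasurableSpace X]

/-- The image of a measure with density under a parametrization. -/
def paramMeasure [MeasureSpace E] (S : Set E) (d : E → ℝ) (e : E → X) : Measure X :=
  ((volume.restrict S).withDensity fun y => ENNReal.ofReal (d y)).map e

/-- Inverse charts are continuous only on their targets and carry arbitrary values elsewhere, so
measurability is obtained on the subtype. -/
theorem measurableSet_inter_preimage_of_continuousOn [TopologicalSpace E] [MeasurableSpace E]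
    [BorelSpace E] [TopologicalSpace X] [BorelSpace X] {S : Set E} (hS : MeasurableSet S) {e : E → X}
    (he : ContinuousOn e S) {V : Set X} (hV : MeasurableSet V) : MeasurableSet (S ∩ e ⁻¹' V) := by
  have h : S ∩ e ⁻¹' V = Subtype.val '' ((fun y : S => e y) ⁻¹' V) := by
    ext y
    constructor
    · exact fun hy => ⟨⟨y, hy.1⟩, hy.2, rfl⟩
    · rintro ⟨z, hz, rfl⟩
      exact ⟨z.2, hz⟩
  rw [h]
  exact hS.subtype_image ((continuousOn_iff_continuous_domRestrict.1 he).measurable hV)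

/-! ### Change of parametrization. -/

section Topological

variable [NormedAddCommGroup E] [NormedSpace ℝ E] [FiniteDimensional ℝ E] [MeasureSpace E]
  [BorelSpace E] [(volume : Measure E).IsAddHaarMeasure] [TopologicalSpace X] [BorelSpace X]
  {S S' : Set E} {d d' : E → ℝ} {e e' : E → X}

theorem paramMeasure_apply (hS : MeasurableSet S) (he : ContinuousOn e S) (d : E → ℝ) {V : Set X}
    (hV : MeasurableSet V) :
    paramMeasure S d e V = ∫⁻ y in S ∩ e ⁻¹' V, ENNReal.ofReal (d y) := by
  have hm := he.aemeasurable (μ := volume) hS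
  have hm' : AEMeasurable e ((volume.restrict S).withDensity fun y => ENNReal.ofReal (d y)) :=
    hm.mono_ac (withDensity_absolutelyContinuous _ _)
  rw [paramMeasure, Measure.map_apply_of_aemeasurable hm' hV, withDensity_apply',
    Measure.restrict_restrict₀ (hm.nullMeasurable hV), inter_comm]

/-- Measures given in two parametrizations agree if the densities are related by the Jacobian of
the change of parameters. -/
theorem paramMeasure_restrict_eq (hS : MeasurableSet S) (he : ContinuousOn e S)
    (hS' : MeasurableSet S') (he' : ContinuousOn e' S') {U : Set X} (hU : MeasurableSet U)
    {τ σ : E → E} {τ' : E → E →L[ℝ] E} (hτS : ∀ y ∈ S, e y ∈ U → τ y ∈ S' ∧ e' (τ y) = e y)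
    (hσS : ∀ y ∈ S', e' y ∈ U → σ y ∈ S ∧ e (σ y) = e' y ∧ τ (σ y) = y)
    (hστ : ∀ y ∈ S, e y ∈ U → σ (τ y) = y)
    (hd : ∀ y ∈ S, e y ∈ U → HasFDerivWithinAt τ (τ' y) S y)
    (hdet : ∀ y ∈ S, e y ∈ U → d y = |(τ' y).det| * d' (τ y)) :
    (paramMeasure S d e).restrict U = (paramMeasure S' d' e').restrict U := by
  ext A hA
  rw [Measure.restrict_apply hA, Measure.restrict_apply hA,
    paramMeasure_apply hS he d (hA.inter hU), paramMeasure_apply hS' he' d' (hA.inter hU)]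
  have hT := measurableSet_inter_preimage_of_continuousOn hS he (hA.inter hU)
  -- Over `U` the change of parameters is a bijection between the two parameter sets of any
  -- measurable set, so the change of variables formula compares the two measures.
  have himg : τ '' (S ∩ e ⁻¹' (A ∩ U)) = S' ∩ e' ⁻¹' (A ∩ U) := by
    apply Subset.antisymm
    · rintro _ ⟨y, ⟨hy, hyA, hyU⟩, rfl⟩
      obtain ⟨h1, h2⟩ := hτS y hy hyU
      exact ⟨h1, by rw [mem_preimage, h2]; exact ⟨hyA, hyU⟩⟩
    · rintro y ⟨hy, hyA, hyU⟩
      obtain ⟨h1, h2, h3⟩ := hσS y hy hyU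
      exact ⟨σ y, ⟨h1, by rw [mem_preimage, h2]; exact ⟨hyA, hyU⟩⟩, h3⟩
  have hinj : InjOn τ (S ∩ e ⁻¹' (A ∩ U)) := fun y hy z hz h => by
    rw [← hστ y hy.1 hy.2.2, ← hστ z hz.1 hz.2.2, h]
  rw [← himg, lintegral_image_eq_lintegral_abs_det_fderiv_mul volume hT
    (fun y hy => (hd y hy.1 hy.2.2).mono inter_subset_left) hinj]
  refine setLIntegral_congr_fun hT fun y hy => ?_
  rw [hdet y hy.1 hy.2.2, ENNReal.ofReal_mul (abs_nonneg _)]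

end Topological

/-! ### Parametrizations with a continuous inverse. -/

section Inverse

variable [TopologicalSpace E] [MeasureSpace E] [BorelSpace E] [SecondCountableTopology E]
  [TopologicalSpace.PseudoMetrizableSpace E] [TopologicalSpace X] [BorelSpace X]
  {S : Set E} {d : E → ℝ} {e : E → X} {φ : X → E} {W : Set X}

/-- The set `W` carries a continuous inverse `φ` of the parametrization `e` of `S`. -/
structure IsParam (S : Set E) (e : E → X) (φ : X → E) (W : Set X) : Prop where
  measurable : MeasurableSet S
  continuousOn : ContinuousOn e S
  measurable_range : MeasurableSet W
  continuousOn_inv : ContinuousOn φ W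
  mapsTo : MapsTo e S W
  left_inv : ∀ y ∈ S, φ (e y) = y
  right_inv : ∀ x ∈ W, e (φ x) = x

namespace IsParam

variable (h : IsParam S e φ W)
include h

theorem aemeasurable (d : E → ℝ) :
    AEMeasurable e ((volume.restrict S).withDensity fun y => ENNReal.ofReal (d y)) :=
  (h.continuousOn.aemeasurable h.measurable).mono_ac (withDensity_absolutelyContinuous _ _)

theorem ae_mem (d : E → ℝ) : ∀ᵐ x ∂paramMeasure S d e, x ∈ W := by
  refine (ae_map_iff (h.aemeasurable d) h.measurable_range).2 ?_
  filter_upwards [(withDensity_absolutelyContinuous _ _).ae_le (ae_restrict_mem h.measurable)]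
    with y hy using h.mapsTo hy

theorem aemeasurable_inv (d : E → ℝ) : AEMeasurable φ (paramMeasure S d e) := by
  have h1 := h.continuousOn_inv.aemeasurable (μ := paramMeasure S d e) h.measurable_range
  rwa [Measure.restrict_eq_self_of_ae_mem (h.ae_mem d)] at h1

theorem map_inv (d : E → ℝ) : (paramMeasure S d e).map φ =
    (volume.restrict S).withDensity fun y => ENNReal.ofReal (d y) := by
  have hid : φ ∘ e =ᵐ[(volume.restrict S).withDensity fun y => ENNReal.ofReal (d y)] id := by
    filter_upwards [(withDensity_absolutelyContinuous _ _).ae_le (ae_restrict_mem h.measurable)]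
      with y hy using h.left_inv y hy
  have h1 := h.aemeasurable_inv d
  rw [paramMeasure] at h1 ⊢
  rw [AEMeasurable.map_map_of_aemeasurable h1 (h.aemeasurable d), Measure.map_congr hid,
    Measure.map_id]

/-- Pushing back along the inverse avoids assuming that `p` defines a measurable set, which
`ae_map_iff` would require. -/
theorem ae_of_ae (d : E → ℝ) {p : X → Prop} (hp : ∀ᵐ y ∂volume.restrict S, p (e y)) :
    ∀ᵐ x ∂paramMeasure S d e, p x := by
  have h1 : ∀ᵐ y ∂(paramMeasure S d e).map φ, p (e y) := by
    rw [h.map_inv d]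
    exact (withDensity_absolutelyContinuous _ _).ae_le hp
  filter_upwards [ae_of_ae_map (h.aemeasurable_inv d) h1, h.ae_mem d] with x hx hxW
  rwa [h.right_inv x hxW] at hx

/-- Integrals for a measure given in a parametrization with continuous inverse. -/
theorem integrable_iff (hd : ContinuousOn d S) (hd0 : ∀ y ∈ S, 0 ≤ d y) (f : X → ℝ) :
    (Integrable f (paramMeasure S d e) ↔ IntegrableOn (fun y => d y * f (e y)) S) ∧
      ∫ x, f x ∂paramMeasure S d e = ∫ y in S, d y * f (e y) := by
  have hdm : AEMeasurable (fun y => ENNReal.ofReal (d y)) (volume.restrict S) :=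
    (hd.aemeasurable h.measurable).ennreal_ofReal
  have hm' := h.aemeasurable d
  have hsm : AEStronglyMeasurable (f ∘ e)
      ((volume.restrict S).withDensity fun y => ENNReal.ofReal (d y)) →
        AEStronglyMeasurable f (paramMeasure S d e) := fun h1 => by
    rw [← h.map_inv d] at h1
    refine (h1.comp_aemeasurable (h.aemeasurable_inv d)).congr ?_
    filter_upwards [h.ae_mem d] with x hx
    simp [h.right_inv x hx]
  have hint : Integrable f (paramMeasure S d e) ↔ Integrable (f ∘ e)
      ((volume.restrict S).withDensity fun y => ENNReal.ofReal (d y)) :=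
    ⟨fun h1 => h1.comp_aemeasurable hm', fun h1 => (integrable_map_measure (hsm h1.1) hm').2 h1⟩
  have h2 : Integrable (f ∘ e) ((volume.restrict S).withDensity fun y => ENNReal.ofReal (d y)) ↔
      IntegrableOn (fun y => d y * f (e y)) S := by
    rw [integrable_withDensity_iff_integrable_smul₀' hdm (by simp)]
    refine integrable_congr ?_
    filter_upwards [ae_restrict_mem h.measurable] with y hy
    rw [ENNReal.toReal_ofReal (hd0 y hy)]
    rfl
  refine ⟨hint.trans h2, ?_⟩
  by_cases h1 : Integrable f (paramMeasure S d e)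
  · have h3 := h1.1
    rw [paramMeasure] at h3 ⊢
    rw [integral_map hm' h3, integral_withDensity_eq_integral_toReal_smul₀ hdm (by simp)]
    refine integral_congr_ae ?_
    filter_upwards [ae_restrict_mem h.measurable] with y hy
    rw [ENNReal.toReal_ofReal (hd0 y hy)]
    rfl
  · rw [integral_undef h1, integral_undef (mt (hint.trans h2).2 h1)]

end IsParam

end Inverse


/-- The supremum of measures that agree where their domains overlap restricts to each of them. -/
theorem iSup_restrict_eq {ι : Type*} (P : ι → Measure X) (U : ι → Set X)
    (hU : ∀ i, MeasurableSet (U i)) (hP : ∀ i, (P i).restrict (U i) = P i)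
    (hPP : ∀ i j, (P i).restrict (U i ∩ U j) = (P j).restrict (U i ∩ U j)) {s : ℕ → ι}
    (hs : ⋃ n, U (s n) = univ) (i : ι) : (⨆ j, P j).restrict (U i) = P i := by
  set D := disjointed fun n => U (s n) with hD
  have hDm : ∀ n, MeasurableSet (D n) := fun n => MeasurableSet.disjointed (fun k => hU (s k)) n
  have hDu : ⋃ n, D n = univ := by rw [hD, iUnion_disjointed, hs]
  have hdec : ∀ ρ : Measure X, ρ = Measure.sum fun n => ρ.restrict (D n) := fun ρ => by
    rw [← Measure.restrict_iUnion (disjoint_disjointed _) hDm, hDu, Measure.restrict_univ]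
  -- The candidate for the supremum, glued from the given measures along a countable partition of
  -- the space subordinate to the cover.
  set ν := Measure.sum fun n => (P (s n)).restrict (D n) with hν
  have hsub : ∀ n, D n ⊆ U (s n) := fun n => disjointed_subset _ _
  -- On the piece `D n`, which lies in `U (s n)`, both measures are restrictions to the overlap with
  -- `U j`, where they agree.
  have hkey : ∀ j n, (P j).restrict (D n) = ((P (s n)).restrict (D n)).restrict (U j) := by
    intro j n
    conv_lhs => rw [← hP j]
    rw [Measure.restrict_restrict (hDm n), Measure.restrict_restrict (hU j)]
    have h1 : ∀ ρ : Measure X, (ρ.restrict (U j ∩ U (s n))).restrict (D n) =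
        ρ.restrict (U j ∩ D n) := fun ρ => by
      rw [Measure.restrict_restrict (hDm n)]
      congr 1
      ext x
      constructor
      · exact fun h => ⟨h.2.1, h.1⟩
      · exact fun h => ⟨h.2, h.1, hsub n h.2⟩
    rw [inter_comm (D n), ← h1, ← h1, hPP]
  have hνr : ∀ j, ν.restrict (U j) = P j := by
    intro j
    rw [hν, Measure.restrict_sum _ (hU j)]
    conv_rhs => rw [hdec (P j)]
    congr 1
    funext n
    exact (hkey j n).symm
  have hsup : ⨆ j, P j = ν := by
    apply le_antisymm
    · exact iSup_le fun j => by
        rw [← hνr j]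
        exact Measure.restrict_le_self
    -- On each piece the supremum dominates the measure used there, so it dominates the glued
    -- measure.
    · rw [hdec (⨆ j, P j)]
      refine Measure.le_iff.2 fun A hA => ?_
      rw [hν, Measure.sum_apply _ hA, Measure.sum_apply _ hA]
      exact ENNReal.tsum_le_tsum fun n => Measure.restrict_mono le_rfl (le_iSup P (s n)) A
  rw [hsup, hνr]

end ParamMeasure

end

end Rellich

namespace Rellich

noncomputable section

/-! ### Changes of coordinates at the boundary -/

section BoundaryChange

variable {m : ℕ} {M : Type*} [TopologicalSpace M] [ChartedSpace (EuclideanHalfSpace (m + 1)) M]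
  [IsManifold (𝓡∂ (m + 1)) ∞ M] {x₀ x₁ : M} {y : Model m}

theorem convex_halfSpace : Convex ℝ (halfSpace m) := by
  have : halfSpace m = {y : Model m | 0 ≤ coordCovec 0 y} := Set.ext fun _ => mem_halfSpace
  rw [this]
  exact convex_halfSpace_ge (coordCovec 0).isLinear 0

theorem mem_posTangentConeAt_halfSpace {v : Model m} (hy : y ∈ halfSpace m) (hv : 0 ≤ v 0) :
    v ∈ posTangentConeAt (halfSpace m) y := by
  refine mem_posTangentConeAt_of_segment_subset (convex_halfSpace.segment_subset hy ?_)
  exact mem_halfSpace.2 (add_nonneg (mem_halfSpace.1 hy) hv)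

theorem hasFDerivWithinAt_transition_zero (hy : y ∈ overlap m x₀ x₁) :
    HasFDerivWithinAt (fun z => transition m x₀ x₁ z 0)
      ((coordCovec 0).comp (fderivWithin ℝ (transition m x₀ x₁) (halfSpace m) y)) (halfSpace m) y :=
  (coordCovec 0).hasFDerivAt.comp_hasFDerivWithinAt y
    (isChange_transition hy).hasFDerivWithinAt

omit [IsManifold (𝓡∂ (m + 1)) ∞ M] in
theorem transition_nonneg (hy : y ∈ overlap m x₀ x₁) :
    ∀ᶠ z in nhdsWithin y (halfSpace m), 0 ≤ transition m x₀ x₁ z 0 := by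
  filter_upwards [overlap_mem_nhdsWithin hy] with z hz
  exact mem_halfSpace.1 ((isRelOpen_overlap x₁ x₀).sub (transition_mem hz))

theorem exists_transition_eq_one (hy : y ∈ overlap m x₀ x₁) :
    ∃ v, fderivWithin ℝ (transition m x₀ x₁) (halfSpace m) y v 0 = 1 := by
  obtain ⟨v, hv⟩ := (isChange_transition hy).surjective (coordVec 0)
  exact ⟨v, by rw [hv, coordVec_apply, if_pos rfl]⟩

/-- Boundary points are mapped to boundary points by changes of coordinates. -/
theorem transition_boundary (hy : y ∈ overlap m x₀ x₁) (hy0 : y 0 = 0) :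
    transition m x₀ x₁ y 0 = 0 := by
  by_contra hne
  have hz := transition_mem hy
  have hpos : 0 < transition m x₀ x₁ y 0 :=
    lt_of_le_of_ne (mem_halfSpace.1 ((isRelOpen_overlap x₁ x₀).sub hz)) (Ne.symm hne)
  set z := transition m x₀ x₁ y
  -- If the image point `z` were interior, the coordinate `0` of the inverse transition would have
  -- an interior minimum there. Its derivative would vanish, contradicting the surjectivity of the
  -- differential.
  have hmin : IsLocalMinOn (fun w => transition m x₁ x₀ w 0) (halfSpace m) z := by
    filter_upwards [transition_nonneg hz] with w hw
    change transition m x₁ x₀ z 0 ≤ _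
    rwa [transition_transition hy, hy0]
  have hnhds : halfSpace m ∈ nhds z := by
    rw [← mem_interior_iff_mem_nhds, interior_range_modelWithCornersEuclideanHalfSpace]
    exact hpos
  have hd := (hmin.isLocalMin hnhds).hasFDerivAt_eq_zero
    ((hasFDerivWithinAt_transition_zero hz).hasFDerivAt hnhds)
  obtain ⟨v, hv⟩ := exists_transition_eq_one hz
  have := congrArg (fun L : Model m →L[ℝ] ℝ => L v) hd
  exact one_ne_zero (hv.symm.trans this)

/-- The coordinate `0` of the transition is minimal on the half-space at a boundary point. Its
derivative is therefore nonnegative on inward vectors and, applied to both signs, zero on tangential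
ones; it is not zero altogether because the differential is surjective. -/
theorem exists_fderivWithin_transition_zero (hy : y ∈ overlap m x₀ x₁) (hy0 : y 0 = 0) :
    ∃ c : ℝ, 0 < c ∧ ∀ v : Model m,
      fderivWithin ℝ (transition m x₀ x₁) (halfSpace m) y v 0 = c * v 0 := by
  have hmin : IsLocalMinOn (fun w => transition m x₀ x₁ w 0) (halfSpace m) y := by
    filter_upwards [transition_nonneg hy] with w hw
    change transition m x₀ x₁ y 0 ≤ _
    rwa [transition_boundary hy hy0]
  have hyH := (isRelOpen_overlap x₀ x₁).sub hy
  set L := (coordCovec 0).comp (fderivWithin ℝ (transition m x₀ x₁) (halfSpace m) y) with hL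
  have hpos : ∀ v : Model m, 0 ≤ v 0 → 0 ≤ L v := fun v hv =>
    hmin.hasFDerivWithinAt_nonneg (hasFDerivWithinAt_transition_zero hy)
      (mem_posTangentConeAt_halfSpace hyH hv)
  have hzero : ∀ v : Model m, v 0 = 0 → L v = 0 := fun v hv => by
    refine le_antisymm ?_ (hpos v hv.ge)
    have := hpos (-v) (by change 0 ≤ -(v 0); rw [hv, neg_zero])
    rw [map_neg] at this
    linarith
  have hform : ∀ v : Model m, L v = L (coordVec 0) * v 0 := fun v => by
    have h1 := hzero (v - v 0 • coordVec 0) (by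
      change v 0 - v 0 * (coordVec 0 : Model m) 0 = 0
      rw [coordVec_apply, if_pos rfl, mul_one, sub_self])
    rw [map_sub, map_smul, sub_eq_zero] at h1
    rw [h1, smul_eq_mul, mul_comm]
  refine ⟨L (coordVec 0), lt_of_le_of_ne (hpos _ ?_) fun h0 => ?_, hform⟩
  · rw [coordVec_apply, if_pos rfl]
    exact zero_le_one
  · obtain ⟨v, hv⟩ := exists_transition_eq_one hy
    have h1 : L v = 1 := hv
    rw [hform, ← h0, zero_mul] at h1
    exact one_ne_zero h1.symm

end BoundaryChange

/-! ### The Riemannian measures in charts -/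

section RiemannianMeasures

variable {m : ℕ} {M : Type*} [TopologicalSpace M] [ChartedSpace (EuclideanHalfSpace (m + 1)) M]

theorem measurableSet_target (x₀ : M) : MeasurableSet (chart m x₀).target := by
  rw [chart, extChartAt_target]
  exact (((chartAt (EuclideanHalfSpace (m + 1)) x₀).open_target.preimage
    (𝓡∂ (m + 1)).continuous_symm).measurableSet).inter measurableSet_halfSpace

variable [MeasurableSpace M] [BorelSpace M]

theorem measurableSet_source (x₀ : M) : MeasurableSet (chart m x₀).source :=
  (isOpen_extChartAt_source x₀).measurableSet

theorem isParam_chart (x₀ : M) : IsParam (chart m x₀).target (chart m x₀).symm (chart m x₀)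
    (chart m x₀).source where
  measurable := measurableSet_target x₀
  continuousOn := continuousOn_extChartAt_symm x₀
  measurable_range := measurableSet_source x₀
  continuousOn_inv := continuousOn_extChartAt x₀
  mapsTo := (chart m x₀).mapsTo_symm
  left_inv _ hy := (chart m x₀).right_inv hy
  right_inv _ hx := (chart m x₀).left_inv hx

/-- The coordinates `1, …, m` of a vector. -/
def tailL (m : ℕ) : Model m →L[ℝ] EuclideanSpace ℝ (Fin m) :=
  LinearMap.toContinuousLinearMap
    { toFun := fun v => WithLp.toLp 2 fun i => v i.succ
      map_add' := fun _ _ => rfl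
      map_smul' := fun _ _ => rfl }

@[simp] theorem tailL_apply (v : Model m) (i : Fin m) : tailL m v i = v i.succ := rfl

/-- The boundary inclusion as a continuous linear map. -/
def inclL (m : ℕ) : EuclideanSpace ℝ (Fin m) →L[ℝ] Model m :=
  LinearMap.toContinuousLinearMap
    { toFun := boundaryInclusion
      map_add' := fun u v => by
        ext i
        refine Fin.cases ?_ (fun j => ?_) i
        · exact (add_zero (0 : ℝ)).symm
        · rfl
      map_smul' := fun c v => by
        ext i
        refine Fin.cases ?_ (fun j => ?_) i
        · exact (mul_zero c).symm
        · rfl }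

@[simp] theorem inclL_apply (z : EuclideanSpace ℝ (Fin m)) : inclL m z = boundaryInclusion z := rfl

theorem tailL_boundaryInclusion (z : EuclideanSpace ℝ (Fin m)) :
    tailL m (boundaryInclusion z) = z := rfl

theorem boundaryInclusion_tailL {v : Model m} (hv : v 0 = 0) :
    boundaryInclusion (tailL m v) = v := by
  ext i
  refine Fin.cases ?_ (fun j => ?_) i
  · exact hv.symm
  · rfl

/-- The boundary part of a chart domain. -/
def boundaryTarget (m : ℕ) {M : Type*} [TopologicalSpace M]
    [ChartedSpace (EuclideanHalfSpace (m + 1)) M] (x₀ : M) : Set (EuclideanSpace ℝ (Fin m)) :=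
  boundaryInclusion ⁻¹' (chart m x₀).target

/-- The parametrization of the boundary part of a chart domain. -/
def boundaryParam (m : ℕ) {M : Type*} [TopologicalSpace M]
    [ChartedSpace (EuclideanHalfSpace (m + 1)) M] (x₀ : M) (z : EuclideanSpace ℝ (Fin m)) : M :=
  (chart m x₀).symm (boundaryInclusion z)

omit [MeasurableSpace M] [BorelSpace M] in
theorem measurableSet_boundaryTarget (x₀ : M) : MeasurableSet (boundaryTarget m x₀) :=
  continuous_boundaryInclusion.measurable (measurableSet_target x₀)

theorem isParam_boundary (x₀ : M) : IsParam (boundaryTarget m x₀) (boundaryParam m x₀)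
    (fun x => tailL m (chart m x₀ x)) ((chart m x₀).source ∩ {x | chart m x₀ x 0 = 0}) where
  measurable := measurableSet_boundaryTarget x₀
  continuousOn := (continuousOn_extChartAt_symm x₀).comp continuous_boundaryInclusion.continuousOn
    fun _ h => h
  measurable_range := measurableSet_inter_preimage_of_continuousOn (measurableSet_source x₀)
    (continuousOn_extChartAt x₀)
      (isClosed_singleton.preimage (PiLp.continuous_apply 2 _ (0 : Fin (m + 1)))).measurableSet
  continuousOn_inv := (tailL m).continuous.comp_continuousOn
    ((continuousOn_extChartAt x₀).mono inter_subset_left)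
  mapsTo z hz := ⟨(chart m x₀).map_target hz, by
    change chart m x₀ ((chart m x₀).symm _) 0 = 0
    rw [(chart m x₀).right_inv hz]
    rfl⟩
  left_inv z hz := by
    change tailL m (chart m x₀ ((chart m x₀).symm _)) = z
    rw [(chart m x₀).right_inv hz]
    rfl
  right_inv x hx := by
    rw [boundaryParam, boundaryInclusion_tailL hx.2, (chart m x₀).left_inv hx.1]

variable [IsManifold (𝓡∂ (m + 1)) ∞ M] (g : RiemMetric m M)

/-- The Riemannian volume density in a chart. -/
def volDensity (x₀ : M) (y : Model m) : ℝ := Real.sqrt (localGram g x₀ y).det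

/-- The Riemannian volume density of the boundary in a chart. -/
def boundaryDensity (x₀ : M) (z : EuclideanSpace ℝ (Fin m)) : ℝ :=
  Real.sqrt ((localGram g x₀ (boundaryInclusion z)).submatrix Fin.succ Fin.succ).det

omit [BorelSpace M] in
theorem chartVolume_eq (x₀ : M) : chartVolume g x₀ =
    paramMeasure (chart m x₀).target (volDensity g x₀) (chart m x₀).symm := rfl

omit [BorelSpace M] in
theorem chartBoundaryVolume_eq (x₀ : M) : chartBoundaryVolume g x₀ =
    paramMeasure (boundaryTarget m x₀) (boundaryDensity g x₀) (boundaryParam m x₀) := rfl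

omit [MeasurableSpace M] [BorelSpace M] in
theorem volDensity_transition {x₀ x₁ : M} {y : Model m} (hy : y ∈ overlap m x₀ x₁) :
    volDensity g x₀ y = |(fderivWithin ℝ (transition m x₀ x₁) (halfSpace m) y).det| *
      volDensity g x₁ (transition m x₀ x₁ y) := by
  have h : localGram g x₀ y = gram (localMetric g x₀ y) := rfl
  rw [volDensity, h, localMetric_transition g hy, gram_bilinearComp, Matrix.det_mul,
    Matrix.det_mul, Matrix.det_transpose, det_endMatrix]
  set D := (fderivWithin ℝ (transition m x₀ x₁) (halfSpace m) y).det
  rw [mul_right_comm, Real.sqrt_mul (mul_self_nonneg D), Real.sqrt_mul_self_eq_abs]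
  rfl

/-- The matrix of an endomorphism of the model space, in the directions of the boundary. -/
def tailMatrix (A : Model m →L[ℝ] Model m) : Matrix (Fin m) (Fin m) ℝ :=
  (endMatrix A).submatrix Fin.succ Fin.succ

theorem det_tailMatrix (A : Model m →L[ℝ] Model m) :
    (tailMatrix A).det = ((tailL m).comp (A.comp (inclL m))).det := by
  have : tailMatrix A = LinearMap.toMatrix (EuclideanSpace.basisFun (Fin m) ℝ).toBasis
      (EuclideanSpace.basisFun (Fin m) ℝ).toBasis
      ((tailL m).comp (A.comp (inclL m)) : EuclideanSpace ℝ (Fin m) →ₗ[ℝ] _) := by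
    ext i j
    rw [LinearMap.toMatrix_apply]
    have e : boundaryInclusion (EuclideanSpace.single j (1 : ℝ)) = coordVec j.succ := by
      ext l
      refine Fin.cases ?_ (fun q => ?_) l
      · rw [coordVec_apply]
        simp [Fin.succ_ne_zero, eq_comm]
      · rw [coordVec_apply]
        simp
    simp [tailMatrix, endMatrix, e]
  rw [this, LinearMap.det_toMatrix]

/-- Preserving the boundary hyperplane makes the matrix of `A` block triangular, so the tangential
Gram block transforms by the tangential block of `A` alone. This makes the boundary densities
compatible. -/
theorem submatrix_gram_bilinearComp {A : Model m →L[ℝ] Model m}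
    (hA : ∀ v : Model m, v 0 = 0 → A v 0 = 0) (G : Model m →L[ℝ] Model m →L[ℝ] ℝ) :
    (gram (G.bilinearComp A A)).submatrix Fin.succ Fin.succ =
      (tailMatrix A).transpose * (gram G).submatrix Fin.succ Fin.succ * tailMatrix A := by
  have h0 : ∀ j : Fin m, endMatrix A 0 j.succ = 0 := fun j => by
    refine hA _ ?_
    rw [coordVec_apply]
    simp [Fin.succ_ne_zero, eq_comm]
  rw [gram_bilinearComp]
  ext i j
  simp only [Matrix.submatrix_apply, Matrix.mul_apply, Matrix.transpose_apply, tailMatrix,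
    Fin.sum_univ_succ (n := m), h0, zero_mul, mul_zero, zero_add]

omit [MeasurableSpace M] [BorelSpace M] in
theorem boundaryDensity_transition {x₀ x₁ : M} {z : EuclideanSpace ℝ (Fin m)}
    (hz : boundaryInclusion z ∈ overlap m x₀ x₁) :
    boundaryDensity g x₀ z = |((tailL m).comp ((fderivWithin ℝ (transition m x₀ x₁) (halfSpace m)
      (boundaryInclusion z)).comp (inclL m))).det| *
      boundaryDensity g x₁ (tailL m (transition m x₀ x₁ (boundaryInclusion z))) := by
  have h : localGram g x₀ (boundaryInclusion z) =
    gram (localMetric g x₀ (boundaryInclusion z)) := rfl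
  obtain ⟨c, -, hc⟩ := exists_fderivWithin_transition_zero hz rfl
  have hA : ∀ v : Model m, v 0 = 0 → fderivWithin ℝ (transition m x₀ x₁) (halfSpace m)
      (boundaryInclusion z) v 0 = 0 := fun v hv => by rw [hc, hv, mul_zero]
  rw [boundaryDensity, h, localMetric_transition g hz, submatrix_gram_bilinearComp hA,
    Matrix.det_mul, Matrix.det_mul, Matrix.det_transpose, det_tailMatrix]
  set D := ((tailL m).comp ((fderivWithin ℝ (transition m x₀ x₁) (halfSpace m)
      (boundaryInclusion z)).comp (inclL m))).det
  rw [mul_right_comm, Real.sqrt_mul (mul_self_nonneg D), Real.sqrt_mul_self_eq_abs,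
    boundaryDensity, boundaryInclusion_tailL (transition_boundary hz rfl)]
  rfl

theorem chartVolume_restrict (x₀ x₁ : M) :
    (chartVolume g x₀).restrict ((chart m x₀).source ∩ (chart m x₁).source) =
      (chartVolume g x₁).restrict ((chart m x₀).source ∩ (chart m x₁).source) := by
  rw [chartVolume_eq, chartVolume_eq]
  refine paramMeasure_restrict_eq (measurableSet_target x₀) (continuousOn_extChartAt_symm x₀)
    (measurableSet_target x₁) (continuousOn_extChartAt_symm x₁)
    ((measurableSet_source x₀).inter (measurableSet_source x₁))
    (τ := transition m x₀ x₁) (σ := transition m x₁ x₀)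
    (τ' := fun y => fderivWithin ℝ (transition m x₀ x₁) (halfSpace m) y) ?_ ?_ ?_ ?_ ?_
  · exact fun y hy hU => ⟨(transition_mem ⟨hy, hU.2⟩).1, symm_transition ⟨hy, hU.2⟩⟩
  · exact fun y hy hU => ⟨(transition_mem ⟨hy, hU.1⟩).1, symm_transition ⟨hy, hU.1⟩,
      transition_transition ⟨hy, hU.1⟩⟩
  · exact fun y hy hU => transition_transition ⟨hy, hU.2⟩
  · exact fun y hy hU => (isChange_transition ⟨hy, hU.2⟩).hasFDerivWithinAt.mono
      (isRelOpen_target x₀).sub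
  · exact fun y hy hU => volDensity_transition g ⟨hy, hU.2⟩

theorem chartBoundaryVolume_restrict (x₀ x₁ : M) :
    (chartBoundaryVolume g x₀).restrict ((chart m x₀).source ∩ (chart m x₁).source) =
      (chartBoundaryVolume g x₁).restrict ((chart m x₀).source ∩ (chart m x₁).source) := by
  rw [chartBoundaryVolume_eq, chartBoundaryVolume_eq]
  have hb : ∀ {x₀ x₁ : M} {z : EuclideanSpace ℝ (Fin m)}, boundaryInclusion z ∈ overlap m x₀ x₁ →
      boundaryInclusion (tailL m (transition m x₀ x₁ (boundaryInclusion z))) =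
        transition m x₀ x₁ (boundaryInclusion z) := fun hz =>
    boundaryInclusion_tailL (transition_boundary hz rfl)
  have h1 : ∀ {x₀ x₁ : M} {z : EuclideanSpace ℝ (Fin m)}, boundaryInclusion z ∈ overlap m x₀ x₁ →
      tailL m (transition m x₀ x₁ (boundaryInclusion z)) ∈ boundaryTarget m x₁ ∧
      boundaryParam m x₁ (tailL m (transition m x₀ x₁ (boundaryInclusion z))) =
        boundaryParam m x₀ z := fun hz => by
    rw [boundaryTarget, mem_preimage, boundaryParam, hb hz]
    exact ⟨(transition_mem hz).1, symm_transition hz⟩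
  have h2 : ∀ {x₀ x₁ : M} {z : EuclideanSpace ℝ (Fin m)}, boundaryInclusion z ∈ overlap m x₀ x₁ →
      tailL m (transition m x₁ x₀ (boundaryInclusion
        (tailL m (transition m x₀ x₁ (boundaryInclusion z))))) = z := fun hz => by
    rw [hb hz, transition_transition hz, tailL_boundaryInclusion]
  refine paramMeasure_restrict_eq (isParam_boundary x₀).measurable
    (isParam_boundary x₀).continuousOn (isParam_boundary x₁).measurable
    (isParam_boundary x₁).continuousOn
    ((measurableSet_source x₀).inter (measurableSet_source x₁))
    (τ := fun z => tailL m (transition m x₀ x₁ (boundaryInclusion z)))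
    (σ := fun z => tailL m (transition m x₁ x₀ (boundaryInclusion z)))
    (τ' := fun z => (tailL m).comp ((fderivWithin ℝ (transition m x₀ x₁) (halfSpace m)
      (boundaryInclusion z)).comp (inclL m))) ?_ ?_ ?_ ?_ ?_
  · exact fun z hz hU => h1 ⟨hz, hU.2⟩
  · exact fun z hz hU => ⟨(h1 ⟨hz, hU.1⟩).1, (h1 ⟨hz, hU.1⟩).2, h2 ⟨hz, hU.1⟩⟩
  · exact fun z hz hU => h2 ⟨hz, hU.2⟩
  · intro z hz hU
    have h3 := (isChange_transition (x₀ := x₀) (x₁ := x₁) ⟨hz, hU.2⟩).hasFDerivWithinAt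
    exact (tailL m).hasFDerivAt.comp_hasFDerivWithinAt z
      (h3.comp z (inclL m).hasFDerivWithinAt fun w _ => boundaryInclusion_mem w)
  · exact fun z hz hU => boundaryDensity_transition g ⟨hz, hU.2⟩

omit [MeasurableSpace M] [BorelSpace M] [IsManifold (𝓡∂ (m + 1)) ∞ M] in
theorem exists_source_cover [CompactSpace M] [Nonempty M] :
    ∃ s : ℕ → M, ⋃ n, (chart m (s n)).source = univ := by
  obtain ⟨t, ht, htu⟩ := countable_cover_nhds_of_sigmaCompact
    (f := fun x : M => (chart m x).source) fun x => extChartAt_source_mem_nhds x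
  have hne : t.Nonempty := by
    by_contra h
    rw [not_nonempty_iff_eq_empty.1 h] at htu
    simp at htu
    exact empty_ne_univ htu
  obtain ⟨s, rfl⟩ := ht.exists_eq_range hne
  exact ⟨s, by simpa using htu⟩

/-- Gluing of the chart measures; compactness is used only for a countable cover by chart domains.
-/
theorem riemVolume_restrict [CompactSpace M] (x₀ : M) :
    (riemVolume g).restrict (chart m x₀).source = chartVolume g x₀ := by
  have : Nonempty M := ⟨x₀⟩
  obtain ⟨s, hs⟩ := exists_source_cover (m := m) (M := M)
  exact iSup_restrict_eq (chartVolume g) (fun x => (chart m x).source) measurableSet_source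
    (fun x => Measure.restrict_eq_self_of_ae_mem ((isParam_chart x).ae_mem (volDensity g x)))
    (chartVolume_restrict g) hs x₀

theorem boundaryVolume_restrict [CompactSpace M] (x₀ : M) :
    (boundaryVolume g).restrict (chart m x₀).source = chartBoundaryVolume g x₀ := by
  have : Nonempty M := ⟨x₀⟩
  obtain ⟨s, hs⟩ := exists_source_cover (m := m) (M := M)
  refine iSup_restrict_eq (chartBoundaryVolume g) (fun x => (chart m x).source)
    measurableSet_source (fun x => Measure.restrict_eq_self_of_ae_mem ?_)
    (chartBoundaryVolume_restrict g) hs x₀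
  filter_upwards [(isParam_boundary x).ae_mem (boundaryDensity g x)] with z hz using hz.1

end RiemannianMeasures

end

end Rellich

namespace Rellich

noncomputable section

/-! ### Locally bounded measurable functions -/

section LocBdd

open Filter Topology

variable {X E E' E'' : Type*} [TopologicalSpace X] [MeasurableSpace X] {μ : Measure X}
  {U : Set X}

/-- The function is measurable on `U` and almost everywhere locally bounded: near each point of
`U` it has values in a compact set. -/
structure LocBdd [TopologicalSpace E] (μ : Measure X) (U : Set X) (f : X → E) : Prop where
  aesm : AEStronglyMeasurable f (μ.restrict U)
  bdd : ∀ y ∈ U, ∃ N ∈ 𝓝[U] y, ∃ K, IsCompact K ∧ ∀ᵐ z ∂μ.restrict N, f z ∈ K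

namespace LocBdd

theorem congr [TopologicalSpace E] {f f' : X → E} (hf : LocBdd μ U f)
    (h : f =ᵐ[μ.restrict U] f') : LocBdd μ U f' where
  aesm := hf.aesm.congr h
  bdd y hy := by
    obtain ⟨N, hN, K, hK, hNK⟩ := hf.bdd y hy
    refine ⟨N ∩ U, inter_mem hN self_mem_nhdsWithin, K, hK, ?_⟩
    filter_upwards [ae_restrict_of_ae_restrict_of_subset inter_subset_left hNK,
      ae_restrict_of_ae_restrict_of_subset inter_subset_right h] with z h1 h2
    rwa [← h2]

theorem congr_on [TopologicalSpace E] {f f' : X → E} (hf : LocBdd μ U f) (hU : MeasurableSet U)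
    (h : ∀ y ∈ U, f y = f' y) : LocBdd μ U f' :=
  hf.congr ((ae_restrict_mem hU).mono h)

/-- Local boundedness is phrased with compact sets rather than norm bounds so that continuity of `Φ`
suffices here; all the algebraic operations below are instances. -/
theorem comp [TopologicalSpace E] [TopologicalSpace E'] {f : X → E} (hf : LocBdd μ U f)
    {Φ : E → E'} (hΦ : Continuous Φ) : LocBdd μ U fun y => Φ (f y) where
  aesm := hΦ.comp_aestronglyMeasurable hf.aesm
  bdd y hy := by
    obtain ⟨N, hN, K, hK, hNK⟩ := hf.bdd y hy
    exact ⟨N, hN, Φ '' K, hK.image hΦ, hNK.mono fun z hz => mem_image_of_mem Φ hz⟩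

theorem prodMk [TopologicalSpace E] [TopologicalSpace E'] {f : X → E} {f' : X → E'}
    (hf : LocBdd μ U f) (hf' : LocBdd μ U f') : LocBdd μ U fun y => (f y, f' y) where
  aesm := hf.aesm.prodMk hf'.aesm
  bdd y hy := by
    obtain ⟨N, hN, K, hK, hNK⟩ := hf.bdd y hy
    obtain ⟨N', hN', K', hK', hNK'⟩ := hf'.bdd y hy
    refine ⟨N ∩ N', inter_mem hN hN', K ×ˢ K', hK.prod hK', ?_⟩
    filter_upwards [ae_restrict_of_ae_restrict_of_subset inter_subset_left hNK,
      ae_restrict_of_ae_restrict_of_subset inter_subset_right hNK'] with z h1 h2 using ⟨h1, h2⟩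

theorem bilin [NormedAddCommGroup E] [NormedSpace ℝ E] [NormedAddCommGroup E']
    [NormedSpace ℝ E'] [NormedAddCommGroup E''] [NormedSpace ℝ E''] (B : E →L[ℝ] E' →L[ℝ] E'')
    {f : X → E} {f' : X → E'} (hf : LocBdd μ U f) (hf' : LocBdd μ U f') :
    LocBdd μ U fun y => B (f y) (f' y) :=
  (hf.prodMk hf').comp (Φ := fun q : E × E' => B q.1 q.2) (by fun_prop)

theorem mul {f f' : X → ℝ} (hf : LocBdd μ U f) (hf' : LocBdd μ U f') :
    LocBdd μ U fun y => f y * f' y := hf.bilin (ContinuousLinearMap.mul ℝ ℝ) hf'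

theorem smul [NormedAddCommGroup E] [NormedSpace ℝ E] {f : X → ℝ} {f' : X → E}
    (hf : LocBdd μ U f) (hf' : LocBdd μ U f') : LocBdd μ U fun y => f y • f' y :=
  hf.bilin (ContinuousLinearMap.lsmul ℝ ℝ) hf'

theorem add [NormedAddCommGroup E] {f f' : X → E}
    (hf : LocBdd μ U f) (hf' : LocBdd μ U f') : LocBdd μ U fun y => f y + f' y :=
  (hf.prodMk hf').comp continuous_add

theorem const [TopologicalSpace E] (c : E) : LocBdd μ U fun _ => c where
  aesm := aestronglyMeasurable_const
  bdd _ _ := ⟨U, self_mem_nhdsWithin, {c}, isCompact_singleton, ae_of_all _ fun _ => rfl⟩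

theorem sum [NormedAddCommGroup E] {ι : Type*} (s : Finset ι) {f : ι → X → E}
    (hf : ∀ i, LocBdd μ U (f i)) : LocBdd μ U fun y => ∑ i ∈ s, f i y := by
  classical
  induction s using Finset.induction_on with
  | empty => simpa using const (0 : E)
  | insert i s hi ih => simpa [Finset.sum_insert hi] using (hf i).add ih

theorem prod {ι : Type*} (s : Finset ι) {f : ι → X → ℝ}
    (hf : ∀ i, LocBdd μ U (f i)) : LocBdd μ U fun y => ∏ i ∈ s, f i y := by
  classical
  induction s using Finset.induction_on with
  | empty => simpa using const (1 : ℝ)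
  | insert i s hi ih => simpa [Finset.prod_insert hi] using (hf i).mul ih

theorem _root_.ContinuousOn.locBdd [TopologicalSpace E] [WeaklyLocallyCompactSpace E]
    [SecondCountableTopology X] [OpensMeasurableSpace X] [TopologicalSpace.PseudoMetrizableSpace E]
    {f : X → E} (hf : ContinuousOn f U) (hU : MeasurableSet U) : LocBdd μ U f where
  aesm := hf.aestronglyMeasurable hU
  bdd y hy := by
    obtain ⟨K, hK, hKy⟩ := exists_compact_mem_nhds (f y)
    have h := (hf y hy).preimage_mem_nhdsWithin hKy
    obtain ⟨V, hV, hyV, hVK⟩ := mem_nhdsWithin.1 h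
    refine ⟨V ∩ U, inter_mem (mem_nhdsWithin_of_mem_nhds (hV.mem_nhds hyV)) self_mem_nhdsWithin,
      K, hK, ?_⟩
    exact (ae_restrict_mem (hV.measurableSet.inter hU)).mono hVK

theorem exists_integrableOn [OpensMeasurableSpace X] [IsLocallyFiniteMeasure μ]
    [NormedAddCommGroup E] {f : X → E} (hf : LocBdd μ U f) {y : X}
    (hy : y ∈ U) : ∃ V, IsOpen V ∧ y ∈ V ∧ IntegrableOn f (U ∩ V) μ := by
  obtain ⟨N, hN, K, hK, hNK⟩ := hf.bdd y hy
  obtain ⟨V, hV, hyV, hVN⟩ := mem_nhdsWithin.1 hN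
  obtain ⟨V', hyV', hV', hfin⟩ := μ.exists_isOpen_measure_lt_top y
  obtain ⟨C, hC⟩ := hK.isBounded.exists_norm_le
  refine ⟨V ∩ V', hV.inter hV', ⟨hyV, hyV'⟩, ?_⟩
  have hsub : U ∩ (V ∩ V') ⊆ N := fun z hz => hVN ⟨hz.2.1, hz.1⟩
  refine IntegrableOn.of_bound (C := C) ?_ ?_ ?_
  · exact (measure_mono fun z hz => hz.2.2).trans_lt hfin
  · exact hf.aesm.mono_measure (Measure.restrict_mono inter_subset_left le_rfl)
  · exact (ae_restrict_of_ae_restrict_of_subset hsub hNK).mono fun z hz => hC _ hz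

theorem formInner {m k : ℕ} {gi : X → Matrix (Fin (m + 1)) (Fin (m + 1)) ℝ} {α β : X → Frm m k}
    (hgi : ∀ i j, LocBdd μ U fun y => gi y i j) (hα : LocBdd μ U α) (hβ : LocBdd μ U β) :
    LocBdd μ U fun y => Rellich.formInner (gi y) (α y) (β y) := by
  unfold Rellich.formInner
  refine (const _).mul (sum _ fun I => sum _ fun J => ?_)
  exact (prod _ fun l => hgi _ _).mul
    ((hα.comp (evalL _).continuous).mul (hβ.comp (evalL _).continuous))

end LocBdd

end LocBdd

/-! ### Locally Lipschitz functions on the half-space -/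

section Lipschitz

open Filter Topology

variable {m : ℕ} {U : Set (Model m)} {E : Type*} [NormedAddCommGroup E] [NormedSpace ℝ E]
  [FiniteDimensional ℝ E] {f : Model m → E}

theorem volume_boundary : volume {y : Model m | y 0 = 0} = 0 := by
  have h := Measure.addHaar_submodule (volume : Measure (Model m))
    (LinearMap.ker ((coordCovec 0 : Model m →L[ℝ] ℝ) : Model m →ₗ[ℝ] ℝ)) (by
      intro h
      have h1 : (coordVec 0 : Model m) ∈ LinearMap.ker ((coordCovec 0 : Model m →L[ℝ] ℝ) : Model m →ₗ[ℝ] ℝ) := by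
        rw [h]; trivial
      have h2 : (coordVec 0 : Model m) 0 = 0 := h1
      rw [coordVec_apply, if_pos rfl] at h2
      exact one_ne_zero h2)
  exact h

/-- The boundary hyperplane is null, so that derivatives within the half-space are ordinary
derivatives almost everywhere. -/
theorem ae_halfSpace_mem_nhds : ∀ᵐ y : Model m, y ∈ halfSpace m → halfSpace m ∈ 𝓝 y := by
  have h : ∀ᵐ y : Model m, ¬ y 0 = 0 := measure_eq_zero_iff_ae_notMem.1 volume_boundary
  filter_upwards [h] with y hy hyH
  rw [← mem_interior_iff_mem_nhds, interior_range_modelWithCornersEuclideanHalfSpace]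
  exact lt_of_le_of_ne (mem_halfSpace.1 hyH) (Ne.symm hy)

/-- Rademacher's theorem on small pieces of `U` where one Lipschitz constant holds; the exceptional
set is locally null, hence null. -/
theorem ae_differentiableWithinAt_of_locallyLipschitzOn (hU : IsRelOpen (halfSpace m) U)
    (hf : LocallyLipschitzOn U f) :
    ∀ᵐ y : Model m, y ∈ U → DifferentiableWithinAt ℝ f (halfSpace m) y := by
  change volume {z | ¬ (z ∈ U → DifferentiableWithinAt ℝ f (halfSpace m) z)} = 0
  refine measure_null_of_locally_null _ fun y hy => ?_
  have hyU : y ∈ U := by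
    by_contra h
    exact hy fun h' => absurd h' h
  obtain ⟨K, t, ht, hK⟩ := hf hyU
  obtain ⟨V, hV, hyV, hVt⟩ := mem_nhdsWithin.1 ht
  refine ⟨V ∩ {z | ¬ (z ∈ U → DifferentiableWithinAt ℝ f (halfSpace m) z)},
    inter_mem (mem_nhdsWithin_of_mem_nhds (hV.mem_nhds hyV)) self_mem_nhdsWithin, ?_⟩
  refine measure_mono_null ?_ (ae_iff.1 (hK.mono hVt).ae_differentiableWithinAt_of_mem)
  rintro z ⟨hzV, hz⟩ h
  refine hz fun hzU => (h ⟨hzV, hzU⟩).mono_of_mem_nhdsWithin ?_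
  exact inter_mem (mem_nhdsWithin_of_mem_nhds (hV.mem_nhds hzV)) (hU.nhds z hzU)

/-- Off the null boundary the derivative is the ordinary one, which is measurable for any function
and bounded by a local Lipschitz constant. -/
theorem locBdd_fderivWithin (hU : IsRelOpen (halfSpace m) U) (hUm : MeasurableSet U)
    (hf : LocallyLipschitzOn U f) :
    LocBdd volume U fun y => fderivWithin ℝ f (halfSpace m) y := by
  have hae : (fun y => fderiv ℝ f y) =ᵐ[volume.restrict U]
      fun y => fderivWithin ℝ f (halfSpace m) y := by
    filter_upwards [ae_restrict_of_ae ae_halfSpace_mem_nhds, ae_restrict_mem hUm] with y h hy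
    exact (fderivWithin_of_mem_nhds (h (hU.sub hy))).symm
  refine LocBdd.congr ⟨?_, fun y hy => ?_⟩ hae
  · have : FiniteDimensional ℝ (Model m →L[ℝ] E) := inferInstance
    have : ProperSpace (Model m →L[ℝ] E) := FiniteDimensional.proper ℝ _
    have : CompleteSpace E := FiniteDimensional.complete ℝ E
    borelize (Model m →L[ℝ] E)
    exact (measurable_fderiv ℝ f).aestronglyMeasurable
  · obtain ⟨K, t, ht, hK⟩ := hf hy
    have : ProperSpace (Model m →L[ℝ] E) := FiniteDimensional.proper ℝ _
    obtain ⟨V, hV, hyV, hVt⟩ := mem_nhdsWithin.1 ht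
    refine ⟨V ∩ U, inter_mem (mem_nhdsWithin_of_mem_nhds (hV.mem_nhds hyV)) self_mem_nhdsWithin,
      Metric.closedBall 0 K, isCompact_closedBall _ _, ?_⟩
    filter_upwards [ae_restrict_of_ae ae_halfSpace_mem_nhds,
      ae_restrict_mem (hV.measurableSet.inter hUm)] with z h hz
    rw [mem_closedBall_zero_iff]
    refine norm_fderiv_le_of_lipschitzOn ℝ (s := V ∩ U) ?_ (hK.mono hVt)
    have h1 := hU.nhds z hz.2
    rw [nhdsWithin_eq_nhds.2 (h (hU.sub hz.2))] at h1
    exact inter_mem (hV.mem_nhds hz.1) h1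

theorem IsRelOpen.locallyLipschitzOn {E : Type*} [NormedAddCommGroup E] [NormedSpace ℝ E]
    {f : Model m → E} (hU : IsRelOpen (halfSpace m) U)
    (hf : ContDiffOn ℝ ∞ f U) : LocallyLipschitzOn U f := fun y hy => by
  obtain ⟨K, t, ht, hK⟩ := ((hU.contDiffWithinAt hf hy).of_le (m := 1)
    (by simp)).exists_lipschitzOnWith convex_halfSpace
  exact ⟨K, t, nhdsWithin_mono _ hU.sub ht, hK⟩

theorem _root_.LocallyLipschitzOn.comp_locallyLipschitz {α β γ : Type*} [PseudoEMetricSpace α]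
    [PseudoEMetricSpace β] [PseudoEMetricSpace γ] {U : Set α} {f : α → β} {Φ : β → γ}
    (hΦ : LocallyLipschitz Φ) (hf : LocallyLipschitzOn U f) :
    LocallyLipschitzOn U fun y => Φ (f y) := fun y hy => by
  obtain ⟨K, t, ht, hK⟩ := hΦ (f y)
  obtain ⟨K', t', ht', hK'⟩ := hf hy
  have h := hf.continuousOn y hy ht
  refine ⟨K * K', t' ∩ f ⁻¹' t, inter_mem ht' h, ?_⟩
  exact hK.comp (hK'.mono inter_subset_left) fun z hz => hz.2

theorem _root_.LocallyLipschitzOn.prodMk {α β γ : Type*} [PseudoEMetricSpace α]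
    [PseudoEMetricSpace β] [PseudoEMetricSpace γ] {U : Set α} {f : α → β} {f' : α → γ}
    (hf : LocallyLipschitzOn U f) (hf' : LocallyLipschitzOn U f') :
    LocallyLipschitzOn U fun y => (f y, f' y) := fun y hy => by
  obtain ⟨K, t, ht, hK⟩ := hf hy
  obtain ⟨K', t', ht', hK'⟩ := hf' hy
  exact ⟨max K K', t ∩ t', inter_mem ht ht',
    (hK.mono inter_subset_left).prodMk (hK'.mono inter_subset_right)⟩

theorem _root_.LocallyLipschitzOn.fun_mul {α : Type*} [PseudoEMetricSpace α]
    {U : Set α} {f f' : α → ℝ} (hf : LocallyLipschitzOn U f) (hf' : LocallyLipschitzOn U f') :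
    LocallyLipschitzOn U fun y => f y * f' y :=
  (hf.prodMk hf').comp_locallyLipschitz (Φ := fun q : ℝ × ℝ => q.1 * q.2)
    (ContDiff.mul (𝕜 := ℝ) contDiff_fst contDiff_snd).locallyLipschitz

theorem _root_.LocallyLipschitzOn.fun_sum {α ι : Type*} [PseudoEMetricSpace α]
    {U : Set α} (s : Finset ι) {f : ι → α → ℝ} (hf : ∀ i, LocallyLipschitzOn U (f i)) :
    LocallyLipschitzOn U fun y => ∑ i ∈ s, f i y := by
  classical
  induction s using Finset.induction_on with
  | empty => simpa using (LocallyLipschitz.const (0 : ℝ)).locallyLipschitzOn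
  | insert i s hi ih =>
    simp only [Finset.sum_insert hi]
    exact ((hf i).prodMk ih).comp_locallyLipschitz (Φ := fun q : ℝ × ℝ => q.1 + q.2)
      (ContDiff.add (𝕜 := ℝ) contDiff_fst contDiff_snd).locallyLipschitz

theorem _root_.LocallyLipschitzOn.congr_on {α β : Type*} [PseudoEMetricSpace α]
    [PseudoEMetricSpace β] {U : Set α} {f f' : α → β} (hf : LocallyLipschitzOn U f)
    (h : ∀ y ∈ U, f y = f' y) : LocallyLipschitzOn U f' := fun y hy => by
  obtain ⟨K, t, ht, hK⟩ := hf hy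
  refine ⟨K, t ∩ U, inter_mem ht self_mem_nhdsWithin, fun z hz w hw => ?_⟩
  rw [← h z hz.2, ← h w hw.2]
  exact hK hz.1 hw.1

end Lipschitz

/-! ### Integrals in charts -/

section ChartIntegrals

open Filter Topology

theorem IsParam.integrableOn {E X : Type*} [MeasurableSpace X] [TopologicalSpace E] [MeasureSpace E]
    [BorelSpace E] [SecondCountableTopology E] [TopologicalSpace.PseudoMetrizableSpace E]
    [TopologicalSpace X] [BorelSpace X] {S : Set E} {d : E → ℝ} {e : E → X} {φ : X → E}
    {W O V : Set X} (h : IsParam S e φ W) (hd : ContinuousOn d S) (hd0 : ∀ y ∈ S, 0 ≤ d y)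
    {μ : Measure X} (hμ : μ.restrict O = paramMeasure S d e) (hV : MeasurableSet V) (hVO : V ⊆ O)
    {f : X → ℝ} (hf : IntegrableOn (fun y => d y * f (e y)) (S ∩ e ⁻¹' V)) :
    IntegrableOn f V μ := by
  have hm := measurableSet_inter_preimage_of_continuousOn h.measurable h.continuousOn hV
  rw [IntegrableOn, ← Measure.restrict_restrict_of_subset hVO, hμ, ← IntegrableOn,
    ← integrable_indicator_iff hV, (h.integrable_iff hd hd0 _).1]
  refine ((hf.integrable_indicator hm).integrableOn).congr_fun (fun y hy => ?_) h.measurable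
  by_cases hyV : e y ∈ V
  · rw [indicator_of_mem (show y ∈ S ∩ e ⁻¹' V from ⟨hy, hyV⟩), indicator_of_mem hyV]
  · rw [indicator_of_notMem (fun h' : y ∈ S ∩ e ⁻¹' V => hyV h'.2), indicator_of_notMem hyV,
      mul_zero]

variable {m : ℕ} {M : Type*} [TopologicalSpace M] [ChartedSpace (EuclideanHalfSpace (m + 1)) M]
  [IsManifold (𝓡∂ (m + 1)) ∞ M] (g : RiemMetric m M)

theorem continuousOn_volDensity (x₀ : M) : ContinuousOn (volDensity g x₀) (chart m x₀).target :=
  (isMetricOn_localMetric g x₀).contDiffOn_sqrt_det.continuousOn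

theorem continuousOn_boundaryDensity (x₀ : M) :
    ContinuousOn (boundaryDensity g x₀) (boundaryTarget m x₀) := by
  refine Real.continuous_sqrt.comp_continuousOn ?_
  have h : ∀ i j, ContinuousOn (fun z : EuclideanSpace ℝ (Fin m) =>
      localGram g x₀ (boundaryInclusion z) i j) (boundaryTarget m x₀) := fun i j =>
    ((isMetricOn_localMetric g x₀).contDiffOn_gram i j).continuousOn.comp
      continuous_boundaryInclusion.continuousOn fun _ h => h
  simp only [Matrix.det_apply']
  exact continuousOn_finsetSum _ fun σ _ => continuousOn_const.mul
    (continuousOn_finsetProd _ fun i _ => h _ _)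

omit [IsManifold (𝓡∂ (m + 1)) ∞ M] in
-- The boundary measure lives on all of `M`; near interior points its local integrability is trivial
-- because the boundary parametrization misses a neighbourhood.
theorem exists_isOpen_disjoint_boundary (x₀ : M) {x : M} (hx : x ∈ (chart m x₀).source)
    (hx0 : chart m x₀ x 0 ≠ 0) : ∃ V, IsOpen V ∧ x ∈ V ∧ V ⊆ (chart m x₀).source ∧
      boundaryTarget m x₀ ∩ boundaryParam m x₀ ⁻¹' V = ∅ := by
  have hc : Continuous fun y : Model m => y 0 := PiLp.continuous_apply 2 _ (0 : Fin (m + 1))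
  refine ⟨(chart m x₀).source ∩ (fun x => chart m x₀ x 0) ⁻¹' {0}ᶜ, ?_, ⟨hx, hx0⟩,
    inter_subset_left, ?_⟩
  · exact (hc.comp_continuousOn (continuousOn_extChartAt x₀)).isOpen_inter_preimage
      (isOpen_extChartAt_source x₀) isOpen_compl_singleton
  · refine eq_empty_of_forall_notMem fun z hz => hz.2.2 ?_
    change chart m x₀ ((chart m x₀).symm _) 0 = 0
    rw [(chart m x₀).right_inv hz.1]
    rfl

variable [MeasurableSpace M] [BorelSpace M] [CompactSpace M]

/-- Local boundedness in charts gives local integrability, and compactness of `M` makes it global.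
-/
theorem integrable_riemVolume {f : M → ℝ} (hf : ∀ x₀ : M, LocBdd volume (chart m x₀).target
    fun y => f ((chart m x₀).symm y)) : Integrable f (riemVolume g) := by
  rw [← integrableOn_univ]
  refine LocallyIntegrable.integrableOn_isCompact (fun x => ?_) isCompact_univ
  have hd := continuousOn_volDensity g x
  obtain ⟨V, hV, hyV, hint⟩ := ((hd.locBdd (measurableSet_target x)).mul
    (hf x)).exists_integrableOn (mem_extChartAt_target x)
  have hO := (continuousOn_extChartAt (I := 𝓡∂ (m + 1)) x).isOpen_inter_preimage
    (isOpen_extChartAt_source x) hV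
  refine ⟨_, hO.mem_nhds ⟨mem_extChartAt_source x, hyV⟩, ?_⟩
  refine (isParam_chart x).integrableOn hd (fun y _ => Real.sqrt_nonneg _)
    ((riemVolume_restrict g x).trans (chartVolume_eq g x)) hO.measurableSet inter_subset_left ?_
  refine hint.mono_set fun y hy => ⟨hy.1, ?_⟩
  have := hy.2.2
  rwa [mem_preimage, (chart m x).right_inv hy.1] at this

theorem integrable_boundaryVolume {f : M → ℝ}
    (hf : ∀ x₀ : M, LocBdd volume (boundaryTarget m x₀) fun z => f (boundaryParam m x₀ z)) :
    Integrable f (boundaryVolume g) := by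
  rw [← integrableOn_univ]
  refine LocallyIntegrable.integrableOn_isCompact (fun x => ?_) isCompact_univ
  have hd := continuousOn_boundaryDensity g x
  have hP := isParam_boundary (m := m) x
  have hμ := (boundaryVolume_restrict g x).trans (chartBoundaryVolume_eq g x)
  by_cases hx0 : chart m x x 0 = 0
  · have hmem : tailL m (chart m x x) ∈ boundaryTarget m x := by
      rw [boundaryTarget, mem_preimage, boundaryInclusion_tailL hx0]
      exact mem_extChartAt_target x
    obtain ⟨V, hV, hyV, hint⟩ := ((hd.locBdd hP.measurable).mul
      (hf x)).exists_integrableOn hmem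
    have hO := (continuousOn_extChartAt (I := 𝓡∂ (m + 1)) x).isOpen_inter_preimage
      (isOpen_extChartAt_source x) (hV.preimage (tailL m).continuous)
    refine ⟨_, hO.mem_nhds ⟨mem_extChartAt_source x, hyV⟩, ?_⟩
    refine hP.integrableOn hd (fun y _ => Real.sqrt_nonneg _) hμ hO.measurableSet
      inter_subset_left ?_
    refine hint.mono_set fun y hy => ⟨hy.1, ?_⟩
    have := hy.2.2
    rwa [mem_preimage, mem_preimage, boundaryParam, (chart m x).right_inv hy.1] at this
  · obtain ⟨V, hV, hxV, hVs, he⟩ := exists_isOpen_disjoint_boundary x (mem_extChartAt_source x) hx0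
    refine ⟨V, hV.mem_nhds hxV, hP.integrableOn hd (fun y _ => Real.sqrt_nonneg _) hμ
      hV.measurableSet hVs ?_⟩
    rw [he]
    exact integrableOn_empty

theorem integral_riemVolume (x₀ : M) {f : M → ℝ} (hf : ∀ x, x ∉ (chart m x₀).source → f x = 0) :
    ∫ x, f x ∂riemVolume g =
      ∫ y in (chart m x₀).target, volDensity g x₀ y * f ((chart m x₀).symm y) := by
  rw [← setIntegral_eq_integral_of_forall_compl_eq_zero hf, riemVolume_restrict, chartVolume_eq,
    ((isParam_chart x₀).integrable_iff (continuousOn_volDensity g x₀)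
      (fun y _ => Real.sqrt_nonneg _) f).2]

theorem integral_boundaryVolume (x₀ : M) {f : M → ℝ}
    (hf : ∀ x, x ∉ (chart m x₀).source → f x = 0) :
    ∫ x, f x ∂boundaryVolume g =
      ∫ z in boundaryTarget m x₀, boundaryDensity g x₀ z * f (boundaryParam m x₀ z) := by
  rw [← setIntegral_eq_integral_of_forall_compl_eq_zero hf, boundaryVolume_restrict,
    chartBoundaryVolume_eq, ((isParam_boundary x₀).integrable_iff
      (continuousOn_boundaryDensity g x₀) (fun y _ => Real.sqrt_nonneg _) f).2]

theorem ae_riemVolume {p : M → Prop}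
    (hp : ∀ x₀ : M, ∀ᵐ y ∂volume.restrict (chart m x₀).target, p ((chart m x₀).symm y)) :
    ∀ᵐ x ∂riemVolume g, p x := by
  cases isEmpty_or_nonempty M with
  | inl h => exact ae_of_all _ fun x => (h.false x).elim
  | inr h =>
    obtain ⟨s, hs⟩ := exists_source_cover (m := m) (M := M)
    rw [← Measure.restrict_univ (μ := riemVolume g), ← hs, ae_restrict_iUnion_iff]
    intro n
    rw [riemVolume_restrict, chartVolume_eq]
    exact (isParam_chart (s n)).ae_of_ae _ (hp (s n))

end ChartIntegrals

end

end Rellich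

namespace Rellich

noncomputable section

/-! ### The geometry at the boundary in a chart -/

section BoundaryGeometry

variable {m p : ℕ} {M : Type*} [TopologicalSpace M] [ChartedSpace (EuclideanHalfSpace (m + 1)) M]
  [IsManifold (𝓡∂ (m + 1)) ∞ M] (g : RiemMetric m M) {x₀ : M} {y : Model m}

theorem exists_frame_zero (hy : y ∈ (chart m x₀).target) (hy0 : y 0 = 0) :
    ∃ c : ℝ, 0 < c ∧ ∀ v : Model m, frame x₀ y v 0 = c * v 0 := by
  rw [frame_eq hy rfl]
  exact exists_fderivWithin_transition_zero (mem_overlap_self hy) hy0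

/-- Only the coordinate vector `∂_0` has an image with nonzero coordinate `0`, so one of the two
sums in the transformation law collapses. -/
theorem gInv_zero_right (hy : y ∈ (chart m x₀).target) {c : ℝ}
    (hc : ∀ v : Model m, frame x₀ y v 0 = c * v 0) (a : Fin (m + 1)) :
    gInv g ((chart m x₀).symm y) a 0 =
      c * ∑ i, localInv g x₀ y i 0 * frame x₀ y (coordVec i) a := by
  rw [giRel_frame g hy a 0, Finset.mul_sum]
  refine Finset.sum_congr rfl fun i _ => ?_
  rw [Finset.sum_eq_single 0]
  · rw [hc, coordVec_apply, if_pos rfl]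
    ring
  · intro j _ hj
    rw [hc, coordVec_apply, if_neg (Ne.symm hj)]
    ring
  · exact fun h => (h (Finset.mem_univ _)).elim

theorem sqrt_gInv_zero (hy : y ∈ (chart m x₀).target) {c : ℝ} (hc0 : 0 < c)
    (hc : ∀ v : Model m, frame x₀ y v 0 = c * v 0) :
    Real.sqrt (gInv g ((chart m x₀).symm y) 0 0) = c * Real.sqrt (localInv g x₀ y 0 0) := by
  rw [gInv_zero_right g hy hc, Finset.sum_eq_single 0]
  · rw [hc, coordVec_apply, if_pos rfl, ← Real.sqrt_sq hc0.le, ← Real.sqrt_mul (sq_nonneg c),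
      Real.sqrt_sq hc0.le]
    ring_nf
  · intro j _ hj
    rw [hc, coordVec_apply, if_neg (Ne.symm hj)]
    ring
  · exact fun h => (h (Finset.mem_univ _)).elim

/-- The gradient of the coordinate `0` and the square root that normalizes it are both scaled by the
factor `c > 0` of the transition, so the quotient has the same form in every chart. -/
theorem localVField_unitNormal (hy : y ∈ (chart m x₀).target) (hy0 : y 0 = 0) :
    localVField (unitNormal g) x₀ y = (Real.sqrt (localInv g x₀ y 0 0))⁻¹ •
      ∑ i, localInv g x₀ y i 0 • coordVec i := by
  obtain ⟨c, hc0, hc⟩ := exists_frame_zero hy hy0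
  apply frame_injective hy
  rw [frame_localVField _ hy, map_smul, map_sum]
  have h : vecAt (unitNormal g) ((chart m x₀).symm y) =
    (Real.sqrt (gInv g ((chart m x₀).symm y) 0 0))⁻¹ •
      ∑ i, gInv g ((chart m x₀).symm y) i 0 • coordVec i := rfl
  rw [h, sqrt_gInv_zero g hy hc0 hc, mul_inv, mul_comm, mul_smul]
  congr 1
  ext a
  have h1 := sum_smul_coordVec_apply (fun i => gInv g ((chart m x₀).symm y) i 0) a
  rw [PiLp.smul_apply, h1, gInv_zero_right g hy hc, smul_eq_mul, inv_mul_cancel_left₀ hc0.ne']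
  simp [map_smul]

theorem rellichFlux_symm (F : VField m M) (η : DForm m M p) (hy : y ∈ (chart m x₀).target)
    (hy0 : y 0 = 0) : rellichFlux g F η ((chart m x₀).symm y) =
      (Real.sqrt (localInv g x₀ y 0 0))⁻¹ * localVField (rellichV g F η) x₀ y 0 := by
  obtain ⟨c, hc0, hc⟩ := exists_frame_zero hy hy0
  rw [rellichFlux_eq, ← frame_localVField _ hy, hc, sqrt_gInv_zero g hy hc0 hc, mul_inv]
  field_simp

/-- The cofactor formula for the entry `(0, 0)` of the inverse. It relates the boundary density to
the volume density. -/
theorem det_submatrix_gram {G : Model m →L[ℝ] Model m →L[ℝ] ℝ} (hG : IsMetric G) :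
    ((gram G).submatrix Fin.succ Fin.succ).det = (gram G)⁻¹ 0 0 * (gram G).det := by
  rw [Matrix.inv_def, Matrix.smul_apply, Matrix.adjugate_fin_succ_eq_det_submatrix,
    Ring.inverse_eq_inv', smul_eq_mul]
  have h := hG.det_pos.ne'
  simp only [Fin.succAbove_zero]
  field_simp
  simp

theorem boundaryDensity_eq {z : EuclideanSpace ℝ (Fin m)} (hz : z ∈ boundaryTarget m x₀) :
    boundaryDensity g x₀ z = Real.sqrt (localInv g x₀ (boundaryInclusion z) 0 0) *
      volDensity g x₀ (boundaryInclusion z) := by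
  have hG := isMetric_localMetric g hz
  rw [volDensity, ← Real.sqrt_mul (hG.inv_diag_pos 0).le]
  exact congrArg Real.sqrt (det_submatrix_gram hG)

/-- The factor `√g^{00}` of the boundary density cancels the normalization of the normal. What
remains is the boundary value that the divergence theorem on the half-space produces. -/
theorem boundaryDensity_mul_rellichFlux (F : VField m M) (η : DForm m M p)
    {z : EuclideanSpace ℝ (Fin m)} (hz : z ∈ boundaryTarget m x₀) :
    boundaryDensity g x₀ z * rellichFlux g F η (boundaryParam m x₀ z) =
      volDensity g x₀ (boundaryInclusion z) *
        localVField (rellichV g F η) x₀ (boundaryInclusion z) 0 := by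
  have h := Real.sqrt_pos.2 ((isMetric_localMetric g hz).inv_diag_pos 0)
  rw [boundaryDensity_eq g hz, boundaryParam, rellichFlux_symm g F η hz rfl]
  change _ * _ * ((Real.sqrt ((gram _)⁻¹ 0 0))⁻¹ * _) = _
  field_simp

theorem innerForm_tangentialPart {k : ℕ} (γ : DForm m M (k - 1)) (α : DForm m M k) (x : M) :
    innerForm g (tangentialPart g γ) (contract (unitNormal g) α) x =
      innerForm g γ (contract (unitNormal g) α) x :=
  formInner_pull_projection (isMetric_metricAt g x) (vecAt (unitNormal g) x) (formAt γ x)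
    (interiorProd (vecAt (unitNormal g) x) (formAt α x)) (interiorProd_self _ _)

theorem innerForm_wedge_tangentialPart (F : VField m M) (β : DForm m M (p - 1))
    (α : DForm m M (p + 1)) (x : M) :
    innerForm g (wedge g F (tangentialPart g β)) (contract (unitNormal g) α) x =
      innerForm g β (contract F (contract (unitNormal g) α)) x := by
  have hG := isMetric_metricAt g x
  have h1 := formInner_wedge_projection (k := p) hG (vecAt (unitNormal g) x)
    (metricAt g x (vecAt F x)) (formAt β x)
    (interiorProd (vecAt (unitNormal g) x) (formAt α x)) (interiorProd_self _ _)
  refine Eq.trans h1 ((formInner_wedgeCovector _ _ _ _).trans ?_)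
  rw [hG.sharp_flat]
  rfl

end BoundaryGeometry

/-! ### Integrability of the integrands -/

section Integrability

variable {m p k : ℕ} {M : Type*} [TopologicalSpace M] [ChartedSpace (EuclideanHalfSpace (m + 1)) M]
  [IsManifold (𝓡∂ (m + 1)) ∞ M] (g : RiemMetric m M) {F : VField m M} {x₀ : M}

/-! ### Local boundedness along a map into a chart, for interior and boundary points alike. -/

section Local

variable {X : Type*} [TopologicalSpace X] [MeasurableSpace X] [OpensMeasurableSpace X]
  [SecondCountableTopology X] {μ : Measure X} {U : Set X} {ψ : X → Model m}

theorem locBdd_localInv (hU : MeasurableSet U) (hψ : ContinuousOn ψ U)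
    (hm : MapsTo ψ U (chart m x₀).target) (i j : Fin (m + 1)) :
    LocBdd μ U fun z => localInv g x₀ (ψ z) i j :=
  (((isMetricOn_localMetric g x₀).contDiffOn_gramInv i j).continuousOn.comp hψ hm).locBdd hU

theorem LocBdd.innerForm (hU : MeasurableSet U) (hψ : ContinuousOn ψ U)
    (hm : MapsTo ψ U (chart m x₀).target) {α β : DForm m M k}
    (hα : LocBdd μ U fun z => localForm α x₀ (ψ z)) (hβ : LocBdd μ U fun z => localForm β x₀ (ψ z)) :
    LocBdd μ U fun z => Rellich.innerForm g α β ((chart m x₀).symm (ψ z)) :=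
  (LocBdd.formInner (locBdd_localInv g hU hψ hm) hα hβ).congr_on hU
    fun _ hz => (innerForm_symm g α β (hm hz)).symm

omit [OpensMeasurableSpace X] [SecondCountableTopology X] in
theorem LocBdd.contract (hU : MeasurableSet U) (hm : MapsTo ψ U (chart m x₀).target)
    {α : DForm m M k} (hF : LocBdd μ U fun z => localVField F x₀ (ψ z))
    (hα : LocBdd μ U fun z => localForm α x₀ (ψ z)) :
    LocBdd μ U fun z => localForm (Rellich.contract F α) x₀ (ψ z) :=
  (hF.bilin (interiorL m k) hα).congr_on hU fun _ hz => (localForm_contract F α (hm hz)).symm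

omit [IsManifold (𝓡∂ (m + 1)) ∞ M] in
theorem IsSmoothForm.locBdd {α : DForm m M k} (h : IsSmoothForm α) (hU : MeasurableSet U)
    (hψ : ContinuousOn ψ U) (hm : MapsTo ψ U (chart m x₀).target) :
    LocBdd μ U fun z => localForm α x₀ (ψ z) :=
  ((h x₀).continuousOn.comp hψ hm).locBdd hU

omit [IsManifold (𝓡∂ (m + 1)) ∞ M] in
theorem IsLipschitzVField.locBdd (h : IsLipschitzVField F) (hU : MeasurableSet U)
    (hψ : ContinuousOn ψ U) (hm : MapsTo ψ U (chart m x₀).target) :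
    LocBdd μ U fun z => localVField F x₀ (ψ z) :=
  ((h x₀).continuousOn.comp hψ hm).locBdd hU

end Local

omit [IsManifold (𝓡∂ (m + 1)) ∞ M] in
theorem IsLipschitzVField.ae_differentiableWithinAt (hF : IsLipschitzVField F) (x₀ : M) :
    ∀ᵐ y ∂volume.restrict (chart m x₀).target,
      DifferentiableWithinAt ℝ (localVField F x₀) (halfSpace m) y :=
  (ae_restrict_iff' (measurableSet_target x₀)).2
    (ae_differentiableWithinAt_of_locallyLipschitzOn (isRelOpen_target x₀) (hF x₀))

theorem locBdd_localNabla (hF : IsLipschitzVField F) (x₀ : M) :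
    LocBdd volume (chart m x₀).target fun y => localNabla g F x₀ y := by
  have hm := measurableSet_target (m := m) x₀
  have h1 := locBdd_fderivWithin (isRelOpen_target x₀) hm (hF x₀)
  have : FiniteDimensional ℝ (Model m →L[ℝ] Model m →L[ℝ] Model m) := inferInstance
  have : ProperSpace (Model m →L[ℝ] Model m →L[ℝ] Model m) :=
    FiniteDimensional.proper ℝ (Model m →L[ℝ] Model m →L[ℝ] Model m)
  have h2 := ((isMetricOn_localMetric g x₀).contDiffOn_christoffelL.continuousOn.locBdd
    (μ := volume) hm).prodMk (hF.locBdd (x₀ := x₀) hm continuousOn_id (mapsTo_id _))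
  exact h1.add (h2.comp (Φ := fun q : (Model m →L[ℝ] Model m →L[ℝ] Model m) × Model m =>
    q.1.flip q.2) (((ContinuousLinearMap.flipₗᵢ ℝ (Model m) (Model m)
      (Model m)).continuous.comp continuous_fst).clm_apply continuous_snd))

theorem locBdd_divergence (hF : IsLipschitzVField F) (x₀ : M) :
    LocBdd volume (chart m x₀).target fun y => divergence g F ((chart m x₀).symm y) := by
  have h : LocBdd volume (chart m x₀).target fun y =>
      LinearMap.trace ℝ (Model m) (localNabla g F x₀ y) := by
    simp only [trace_eq_sum]
    exact LocBdd.sum _ fun i => (locBdd_localNabla g hF x₀).comp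
      (Φ := fun A : Model m →L[ℝ] Model m => A (coordVec i) i) (by fun_prop)
  refine h.congr ?_
  filter_upwards [hF.ae_differentiableWithinAt x₀,
    ae_restrict_mem (measurableSet_target x₀)] with y hd hy
  exact (divergence_symm g F hy hd).symm

theorem locBdd_opT (hF : IsLipschitzVField F) {α : DForm m M k} (hα : IsSmoothForm α) (x₀ : M) :
    LocBdd volume (chart m x₀).target fun y => localForm (opT g F α) x₀ y := by
  refine ((locBdd_localNabla g hF x₀).bilin (derivationL m k) (hα.locBdd
    (measurableSet_target x₀) continuousOn_id (mapsTo_id _))).congr ?_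
  filter_upwards [hF.ae_differentiableWithinAt x₀,
    ae_restrict_mem (measurableSet_target x₀)] with y hd hy
  exact (localForm_opT g F α hy hd).symm

theorem locBdd_contractDF (hF : IsLipschitzVField F) {α : DForm m M k} (hα : IsSmoothForm α)
    (x₀ : M) : LocBdd volume (chart m x₀).target fun y => localForm (contractDF g F α) x₀ y := by
  have hm := measurableSet_target (m := m) x₀
  have h : LocBdd volume (chart m x₀).target fun y => ∑ i, ∑ j, localInv g x₀ y i j •
      interiorProd (localNabla g F x₀ y (coordVec j))
        (interiorProd (coordVec i) (localForm α x₀ y)) :=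
    LocBdd.sum _ fun i => LocBdd.sum _ fun j =>
      (locBdd_localInv g hm continuousOn_id (mapsTo_id _) i j).smul
        (((locBdd_localNabla g hF x₀).comp
          (Φ := fun A : Model m →L[ℝ] Model m => A (coordVec j)) (by fun_prop)).bilin
          (interiorL m (k - 1)) ((hα.locBdd hm continuousOn_id (mapsTo_id _)).comp
            (interiorL m k (coordVec i)).continuous))
  refine h.congr ?_
  filter_upwards [hF.ae_differentiableWithinAt x₀, ae_restrict_mem hm] with y hd hy
  exact (localForm_contractDF g F α hy hd).symm

theorem locBdd_unitNormal (x₀ : M) : LocBdd volume (boundaryTarget m x₀) fun z =>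
    localVField (unitNormal g) x₀ (boundaryInclusion z) := by
  have hm := measurableSet_boundaryTarget (m := m) x₀
  have hψ := (continuous_boundaryInclusion (m := m)).continuousOn (s := boundaryTarget m x₀)
  have hψm : MapsTo boundaryInclusion (boundaryTarget m x₀) (chart m x₀).target := fun _ h => h
  have h1 : ContinuousOn (fun z => (Real.sqrt (localInv g x₀ (boundaryInclusion z) 0 0))⁻¹)
      (boundaryTarget m x₀) := by
    refine (Real.continuous_sqrt.comp_continuousOn ((((isMetricOn_localMetric g x₀
      ).contDiffOn_gramInv 0 0).continuousOn).comp hψ hψm)).inv₀ fun z hz => ?_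
    exact (Real.sqrt_pos.2 ((isMetric_localMetric g (hψm hz)).inv_diag_pos 0)).ne'
  refine ((h1.locBdd hm).smul (LocBdd.sum Finset.univ fun i =>
    (locBdd_localInv g hm hψ hψm i 0).smul (LocBdd.const (coordVec i)))).congr_on hm fun z hz => ?_
  exact (localVField_unitNormal g (hψm hz) rfl).symm

/-! ### Integrability of the individual integrands. -/

variable [MeasurableSpace M] [BorelSpace M] [CompactSpace M] {η : DForm m M p}

theorem ae_isDifferentiableVFieldAt (hF : IsLipschitzVField F) :
    ∀ᵐ x ∂riemVolume g, IsDifferentiableVFieldAt F x := by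
  refine ae_riemVolume g fun x₀ => ?_
  filter_upwards [hF.ae_differentiableWithinAt x₀,
    ae_restrict_mem (measurableSet_target x₀)] with y hd hy
  exact isDifferentiableVFieldAt_symm F hy hd

theorem integrable_innerForm {α β : DForm m M k}
    (hα : ∀ x₀ : M, LocBdd volume (chart m x₀).target fun y => localForm α x₀ y)
    (hβ : ∀ x₀ : M, LocBdd volume (chart m x₀).target fun y => localForm β x₀ y) :
    Integrable (innerForm g α β) (riemVolume g) :=
  integrable_riemVolume g fun x₀ => LocBdd.innerForm g (measurableSet_target x₀) continuousOn_id
    (mapsTo_id _) (hα x₀) (hβ x₀)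

theorem integrable_innerForm_contract (hF : IsLipschitzVField F) {α : DForm m M (k - 1)}
    {β : DForm m M k} (hα : IsSmoothForm α) (hβ : IsSmoothForm β) :
    Integrable (innerForm g α (contract F β)) (riemVolume g) :=
  integrable_innerForm g
    (fun x₀ => hα.locBdd (measurableSet_target x₀) continuousOn_id (mapsTo_id _))
    (fun x₀ => LocBdd.contract (measurableSet_target x₀) (mapsTo_id _)
      (hF.locBdd (measurableSet_target x₀) continuousOn_id (mapsTo_id _))
      (hβ.locBdd (measurableSet_target x₀) continuousOn_id (mapsTo_id _)))

theorem integrable_normSq_mul_divergence {l : ℕ} (hF : IsLipschitzVField F) {α : DForm m M k}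
    {β : DForm m M l} (hα : IsSmoothForm α) (hβ : IsSmoothForm β) :
    Integrable (fun x => (normSq g α x + normSq g β x) * divergence g F x) (riemVolume g) :=
  integrable_riemVolume g fun x₀ => by
    have hm := measurableSet_target (m := m) x₀
    have h : ∀ {k : ℕ} {α : DForm m M k}, IsSmoothForm α → LocBdd volume (chart m x₀).target
        fun y => normSq g α ((chart m x₀).symm y) := fun hα =>
      LocBdd.innerForm g hm continuousOn_id (mapsTo_id _)
        (hα.locBdd hm continuousOn_id (mapsTo_id _)) (hα.locBdd hm continuousOn_id (mapsTo_id _))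
    exact ((h hα).add (h hβ)).mul (locBdd_divergence g hF x₀)

theorem integrable_innerForm_contractDF (hF : IsLipschitzVField F) {α : DForm m M (k - 1 - 1)}
    {β : DForm m M k} (hα : IsSmoothForm α) (hβ : IsSmoothForm β) :
    Integrable (innerForm g α (contractDF g F β)) (riemVolume g) :=
  integrable_innerForm g
    (fun x₀ => hα.locBdd (measurableSet_target x₀) continuousOn_id (mapsTo_id _))
    (locBdd_contractDF g hF hβ)

theorem integrable_innerForm_opT (hF : IsLipschitzVField F) {α : DForm m M k}
    (hα : IsSmoothForm α) : Integrable (innerForm g (opT g F α) α) (riemVolume g) :=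
  integrable_innerForm g (locBdd_opT g hF hα)
    (fun x₀ => hα.locBdd (measurableSet_target x₀) continuousOn_id (mapsTo_id _))

theorem integrable_normSq_mul_innerV {l : ℕ} (hF : IsLipschitzVField F) {α : DForm m M k}
    {β : DForm m M l} (hα : IsSmoothForm α) (hβ : IsSmoothForm β) :
    Integrable (fun x => (normSq g α x + normSq g β x) * innerV g F (unitNormal g) x)
      (boundaryVolume g) :=
  integrable_boundaryVolume g fun x₀ => by
    have hm := measurableSet_boundaryTarget (m := m) x₀
    have hψ := (continuous_boundaryInclusion (m := m)).continuousOn (s := boundaryTarget m x₀)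
    have hψm : MapsTo boundaryInclusion (boundaryTarget m x₀) (chart m x₀).target := fun _ h => h
    have h : ∀ {k : ℕ} {α : DForm m M k}, IsSmoothForm α → LocBdd volume (boundaryTarget m x₀)
        fun z => normSq g α (boundaryParam m x₀ z) := fun hα =>
      LocBdd.innerForm g hm hψ hψm (hα.locBdd hm hψ hψm) (hα.locBdd hm hψ hψm)
    have h2 : LocBdd volume (boundaryTarget m x₀) fun z =>
        innerV g F (unitNormal g) (boundaryParam m x₀ z) := by
      refine ((((((contDiffOn_localMetric g x₀).continuousOn.comp hψ hψm).locBdd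
        (μ := volume) hm).bilin (ContinuousLinearMap.id ℝ _) (hF.locBdd (x₀ := x₀) hm hψ hψm)
        ).bilin (ContinuousLinearMap.id ℝ _) (locBdd_unitNormal g x₀))).congr_on hm fun z hz => ?_
      exact (innerV_symm g F (unitNormal g) (hψm hz)).symm
    exact ((h hα).add (h hβ)).mul h2

theorem integrable_innerForm_wedge_boundary (hF : IsLipschitzVField F) {β : DForm m M (p - 1)}
    {α : DForm m M (p + 1)} (hβ : IsSmoothForm β) (hα : IsSmoothForm α) :
    Integrable (innerForm g (wedge g F (tangentialPart g β)) (contract (unitNormal g) α))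
      (boundaryVolume g) := by
  rw [funext (innerForm_wedge_tangentialPart g F β α)]
  refine integrable_boundaryVolume g fun x₀ => ?_
  have hm := measurableSet_boundaryTarget (m := m) x₀
  have hψ := (continuous_boundaryInclusion (m := m)).continuousOn (s := boundaryTarget m x₀)
  have hψm : MapsTo boundaryInclusion (boundaryTarget m x₀) (chart m x₀).target := fun _ h => h
  exact LocBdd.innerForm g hm hψ hψm (hβ.locBdd hm hψ hψm)
    (LocBdd.contract (k := p) hm hψm (hF.locBdd hm hψ hψm)
      (LocBdd.contract (k := p + 1) hm hψm (locBdd_unitNormal g x₀) (hα.locBdd hm hψ hψm)))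

theorem integrable_innerForm_contract_boundary (hF : IsLipschitzVField F) {α : DForm m M k}
    (hα : IsSmoothForm α) :
    Integrable (innerForm g (tangentialPart g (contract F α)) (contract (unitNormal g) α))
      (boundaryVolume g) := by
  rw [funext (innerForm_tangentialPart g (contract F α) α)]
  refine integrable_boundaryVolume g fun x₀ => ?_
  have hm := measurableSet_boundaryTarget (m := m) x₀
  have hψ := (continuous_boundaryInclusion (m := m)).continuousOn (s := boundaryTarget m x₀)
  have hψm : MapsTo boundaryInclusion (boundaryTarget m x₀) (chart m x₀).target := fun _ h => h
  exact LocBdd.innerForm g hm hψ hψm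
    (LocBdd.contract hm hψm (hF.locBdd hm hψ hψm) (hα.locBdd hm hψ hψm))
    (LocBdd.contract hm hψm (locBdd_unitNormal g x₀) (hα.locBdd hm hψ hψm))

theorem integrable_rellichDensity (hF : IsLipschitzVField F) (hη : IsSmoothForm η) :
    Integrable (rellichDensity g F η) (riemVolume g) := by
  have hα := isSmoothForm_extD g hη
  have hβ := isSmoothForm_codiff g hη
  have hΔ := isSmoothForm_hodgeLaplacian g hη
  exact (((((integrable_innerForm_contract (k := p + 1) g hF hΔ hα).add
    (integrable_innerForm_contract g hF hβ hΔ)).add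
    ((integrable_normSq_mul_divergence g hF hα hβ).const_mul _)).sub
    (integrable_innerForm_contractDF (k := p + 1) g hF hβ hα)).sub
    (integrable_innerForm_opT g hF hα)).sub (integrable_innerForm_opT g hF hβ)

theorem integrable_rellichFlux (hF : IsLipschitzVField F) (hη : IsSmoothForm η) :
    Integrable (rellichFlux g F η) (boundaryVolume g) := by
  have hα := isSmoothForm_extD g hη
  have hβ := isSmoothForm_codiff g hη
  exact ((((integrable_normSq_mul_innerV g hF hα hβ).const_mul _).sub
    (integrable_innerForm_wedge_boundary g hF hβ hα)).sub
    (integrable_innerForm_contract_boundary g hF hα)).sub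
    (integrable_innerForm_contract_boundary g hF hβ)

end Integrability

end

end Rellich

namespace Rellich

noncomputable section

/-! ### The Rellich field is Lipschitz -/

section RellichLipschitz

variable {m p k : ℕ}

/-- The components are linear in `v`; thus those of the field on `M` are sums of Lipschitz
components of `F` times smooth coefficients. -/
theorem exists_rellichField_apply (gi : Matrix (Fin (m + 1)) (Fin (m + 1)) ℝ)
    (B : Model m →L[ℝ] Model m →L[ℝ] ℝ) (α : Frm m (p + 1)) (β : Frm m (p - 1))
    (a : Fin (m + 1)) : ∃ L : Model m →L[ℝ] ℝ, ∀ v, rellichField gi B α β v a = L v := by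
  have h1 : ∀ {k : ℕ} (γ : Frm m k), ∃ L : Model m →L[ℝ] ℝ, ∀ v,
      ((2⁻¹ * formInner gi γ γ) • v - pairField gi (interiorProd v γ) γ) a = L v := by
    intro k γ
    refine ⟨(2⁻¹ * formInner gi γ γ) • coordCovec a - ((formInnerL gi k).flip γ).comp
      ((wedgeL m k (coordCovec a)).comp ((interiorL m k).flip γ)), fun v => ?_⟩
    rw [PiLp.sub_apply, pairField_apply]
    rfl
  obtain ⟨L₁, hL₁⟩ := h1 α
  obtain ⟨L₂, hL₂⟩ := h1 β
  refine ⟨L₁ + L₂ - ((formInnerL gi (p + 1)).flip α).comp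
    ((wedgeL m (p + 1) (coordCovec a)).comp (((wedgeL m p).flip β).comp B)), fun v => ?_⟩
  rw [rellichField, PiLp.sub_apply, PiLp.add_apply, hL₁, hL₂, pairField_apply]
  rfl

theorem rellichField_apply_eq_sum (gi : Matrix (Fin (m + 1)) (Fin (m + 1)) ℝ)
    (B : Model m →L[ℝ] Model m →L[ℝ] ℝ) (α : Frm m (p + 1)) (β : Frm m (p - 1)) (v : Model m)
    (a : Fin (m + 1)) : rellichField gi B α β v a =
      ∑ i, v i * rellichField gi B α β (coordVec i) a := by
  obtain ⟨L, hL⟩ := exists_rellichField_apply gi B α β a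
  simp only [hL]
  exact (sum_coord_mul_map L v).symm

theorem contDiffOn_rellichField_apply {U : Set (Model m)}
    {gi : Model m → Matrix (Fin (m + 1)) (Fin (m + 1)) ℝ}
    {B : Model m → Model m →L[ℝ] Model m →L[ℝ] ℝ} {α : Model m → Frm m (p + 1)}
    {β : Model m → Frm m (p - 1)} (hgi : ∀ i j, ContDiffOn ℝ ∞ (fun z => gi z i j) U)
    (hB : ContDiffOn ℝ ∞ B U) (hα : ContDiffOn ℝ ∞ α U) (hβ : ContDiffOn ℝ ∞ β U) (v : Model m)
    (a : Fin (m + 1)) :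
    ContDiffOn ℝ ∞ (fun z => rellichField (gi z) (B z) (α z) (β z) v a) U := by
  have h1 : ∀ {k : ℕ} {γ : Model m → Frm m k}, ContDiffOn ℝ ∞ γ U → ContDiffOn ℝ ∞ (fun z =>
      ((2⁻¹ * formInner (gi z) (γ z) (γ z)) • v -
        pairField (gi z) (interiorProd v (γ z)) (γ z)) a) U := by
    intro k γ hγ
    simp only [PiLp.sub_apply, PiLp.smul_apply, pairField_apply, smul_eq_mul]
    exact ((contDiffOn_const.mul (contDiffOn_formInner hgi hγ hγ)).mul contDiffOn_const).sub
      (contDiffOn_formInner hgi (contDiffOn_bilin (wedgeL m k) contDiffOn_const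
        (contDiffOn_bilin (interiorL m k) contDiffOn_const hγ)) hγ)
  have h2 : ContDiffOn ℝ ∞ (fun z => pairField (k := p + 1) (gi z)
      (wedgeCovector (k := p) (B z v) (β z)) (α z) a) U := by
    simp only [pairField_apply]
    exact contDiffOn_formInner hgi (contDiffOn_bilin (wedgeL m (p + 1)) contDiffOn_const
      (contDiffOn_bilin (wedgeL m p) (hB.clm_apply contDiffOn_const) hβ)) hα
  exact ((h1 hα).add (h1 hβ)).sub h2

variable {M : Type*} [TopologicalSpace M] [ChartedSpace (EuclideanHalfSpace (m + 1)) M]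
  [IsManifold (𝓡∂ (m + 1)) ∞ M] (g : RiemMetric m M) {F : VField m M} {η : DForm m M p}

theorem locallyLipschitzOn_rellichV_apply (hF : IsLipschitzVField F) (hη : IsSmoothForm η) (x₀ : M)
    (a : Fin (m + 1)) :
    LocallyLipschitzOn (chart m x₀).target fun y => localVField (rellichV g F η) x₀ y a := by
  have hU := isRelOpen_target (m := m) x₀
  have h : LocallyLipschitzOn (chart m x₀).target fun y => ∑ i, localVField F x₀ y i *
      rellichField (localInv g x₀ y) (localMetric g x₀ y) (localForm (extD η) x₀ y)
        (localForm (codiff g η) x₀ y) (coordVec i) a := by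
    refine LocallyLipschitzOn.fun_sum _ fun i => LocallyLipschitzOn.fun_mul ?_ ?_
    · exact (hF x₀).comp_locallyLipschitz (coordCovec i).contDiff.locallyLipschitz
    · exact hU.locallyLipschitzOn (contDiffOn_rellichField_apply
        (isMetricOn_localMetric g x₀).contDiffOn_gramInv (contDiffOn_localMetric g x₀)
        (isSmoothForm_extD g hη x₀) (isSmoothForm_codiff g hη x₀) _ _)
  refine h.congr_on fun y hy => ?_
  rw [localVField_rellichV g F η hy, ← rellichField_apply_eq_sum]

theorem continuousOn_rellichV (hF : IsLipschitzVField F) (hη : IsSmoothForm η) (x₀ : M) :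
    ContinuousOn (localVField (rellichV g F η) x₀) (chart m x₀).target := by
  have h : ContinuousOn (fun y => ∑ a, localVField (rellichV g F η) x₀ y a • (coordVec a : Model m))
      (chart m x₀).target := continuousOn_finsetSum _ fun a _ =>
    (locallyLipschitzOn_rellichV_apply g hF hη x₀ a).continuousOn.smul continuousOn_const
  simpa only [sum_coord_smul] using h

end RellichLipschitz

/-! ### Localization by a cutoff function -/

section Cutoff

open Filter Topology

variable {m p : ℕ} {M : Type*} [TopologicalSpace M] [ChartedSpace (EuclideanHalfSpace (m + 1)) M]

/-- The derivative of a function along a vector field. -/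
def dirDeriv (ρ : M → ℝ) (V : VField m M) (x : M) : ℝ :=
  mfderiv (𝓡∂ (m + 1)) 𝓘(ℝ, ℝ) ρ x (V x)

variable [IsManifold (𝓡∂ (m + 1)) ∞ M] {ρ : M → ℝ} {x₀ : M}

theorem contDiffOn_comp_symm (hρ : ContMDiff (𝓡∂ (m + 1)) 𝓘(ℝ, ℝ) ∞ ρ) (x₀ : M) :
    ContDiffOn ℝ ∞ (fun y => ρ ((chart m x₀).symm y)) (chart m x₀).target :=
  contMDiffOn_iff_contDiffOn.1 (hρ.comp_contMDiffOn (contMDiffOn_extChartAt_symm x₀))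

theorem dirDeriv_symm (hρ : ContMDiff (𝓡∂ (m + 1)) 𝓘(ℝ, ℝ) ∞ ρ) (V : VField m M) {y : Model m}
    (hy : y ∈ (chart m x₀).target) : dirDeriv ρ V ((chart m x₀).symm y) =
      fderivWithin ℝ (fun z => ρ ((chart m x₀).symm z)) (halfSpace m) y (localVField V x₀ y) := by
  have hH := (isRelOpen_target x₀).sub hy
  have h := mfderiv_comp_mfderivWithin (I := 𝓘(ℝ, Model m)) (I' := 𝓡∂ (m + 1))
    (I'' := 𝓘(ℝ, ℝ)) (f := (chart m x₀).symm) (g := ρ) y (s := halfSpace m)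
    (hρ.mdifferentiableAt (by simp)) (mdifferentiableWithinAt_extChartAt_symm hy)
    ((isRelOpen_target x₀).uniq y hH).uniqueMDiffWithinAt
  rw [mfderivWithin_eq_fderivWithin] at h
  have h2 := congrArg (fun L : Model m →L[ℝ] ℝ => L (localVField V x₀ y)) h
  refine Eq.trans ?_ h2.symm
  exact congrArg (fun v : Model m => (mfderiv (𝓡∂ (m + 1)) 𝓘(ℝ, ℝ) ρ ((chart m x₀).symm y) :
    Model m →L[ℝ] ℝ) v) (frame_localVField V hy).symm

omit [IsManifold (𝓡∂ (m + 1)) ∞ M] in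
theorem dirDeriv_of_notMem_tsupport (V : VField m M) {x : M} (hx : x ∉ tsupport ρ) :
    dirDeriv ρ V x = 0 := by
  have h := notMem_tsupport_iff_eventuallyEq.1 hx
  have h2 : mfderiv (𝓡∂ (m + 1)) 𝓘(ℝ, ℝ) ρ x = mfderiv (𝓡∂ (m + 1)) 𝓘(ℝ, ℝ) (fun _ => (0 : ℝ)) x :=
    h.mfderiv_eq
  rw [dirDeriv, h2, mfderiv_const]
  rfl

/-- The sum is the derivative of the constant `1`. This removes the cutoff terms when the localized
identities are added. -/
theorem sum_dirDeriv {ι : Type*} (s : Finset ι) {ρ : ι → M → ℝ}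
    (hρ : ∀ i, ContMDiff (𝓡∂ (m + 1)) 𝓘(ℝ, ℝ) ∞ (ρ i)) (h1 : ∀ x, ∑ i ∈ s, ρ i x = 1)
    (V : VField m M) (x : M) : ∑ i ∈ s, dirDeriv (ρ i) V x = 0 := by
  have hy := mem_extChartAt_target (I := 𝓡∂ (m + 1)) x
  have hU := isRelOpen_target (m := m) x
  have hx : (chart m x).symm (chart m x x) = x := extChartAt_to_inv x
  have h2 : ∀ i, dirDeriv (ρ i) V x = fderivWithin ℝ (fun z => ρ i ((chart m x).symm z))
      (halfSpace m) (chart m x x) (localVField V x (chart m x x)) := fun i => by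
    rw [← dirDeriv_symm (hρ i) V hy, hx]
  simp only [h2]
  rw [← sum_apply, ← fderivWithin_fun_sum (hU.uniq _ (hU.sub hy))
    fun i _ => hU.differentiableWithinAt (contDiffOn_comp_symm (hρ i) x) hy]
  simp only [h1, fderivWithin_const_apply]
  rfl

variable (g : RiemMetric m M) {F : VField m M} {η : DForm m M p}

/-- The product rule `div(ρX) = dρ(X) + ρ div X`, multiplied by the volume density. -/
theorem sum_fderivWithin_cutoff (hρ : ContMDiff (𝓡∂ (m + 1)) 𝓘(ℝ, ℝ) ∞ ρ) (hη : IsSmoothForm η)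
    {y : Model m} (hy : y ∈ (chart m x₀).target)
    (hF : DifferentiableWithinAt ℝ (localVField F x₀) (halfSpace m) y) :
    ∑ a, fderivWithin ℝ (fun z => ρ ((chart m x₀).symm z) *
      (volDensity g x₀ z * localVField (rellichV g F η) x₀ z a)) (halfSpace m) y (coordVec a) =
      volDensity g x₀ y * (dirDeriv ρ (rellichV g F η) ((chart m x₀).symm y) +
        ρ ((chart m x₀).symm y) * rellichDensity g F η ((chart m x₀).symm y)) := by
  have hU := isRelOpen_target (m := m) x₀
  have hs := hU.uniq y (hU.sub hy)
  have hu := hU.differentiableWithinAt (contDiffOn_comp_symm hρ x₀) hy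
  have hv := hU.differentiableWithinAt (isMetricOn_localMetric g x₀).contDiffOn_sqrt_det hy
  have hV := differentiableWithinAt_rellichV g F hη hy hF
  have hVa : ∀ a, DifferentiableWithinAt ℝ (fun z => volDensity g x₀ z *
      localVField (rellichV g F η) x₀ z a) (halfSpace m) y := fun a =>
    hv.fun_mul ((coordCovec a).differentiableAt.comp_differentiableWithinAt y hV)
  have h1 := sum_fderivWithin_rellichV g F hη hy hF
  rw [dirDeriv_symm hρ _ hy, ← sum_coord_mul_map (fderivWithin ℝ _ _ _), mul_add,
    mul_left_comm _ (ρ _), volDensity, ← h1, Finset.mul_sum, Finset.mul_sum,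
    ← Finset.sum_add_distrib]
  refine Finset.sum_congr rfl fun a _ => ?_
  rw [fderivWithin_fun_mul hs hu (hVa a), add_apply, smul_apply, smul_apply, smul_eq_mul,
    smul_eq_mul, volDensity, mul_assoc]
  exact add_comm _ _

variable [MeasurableSpace M] [BorelSpace M] [CompactSpace M]

theorem integrable_dirDeriv (hρ : ContMDiff (𝓡∂ (m + 1)) 𝓘(ℝ, ℝ) ∞ ρ) (hF : IsLipschitzVField F)
    (hη : IsSmoothForm η) : Integrable (dirDeriv ρ (rellichV g F η)) (riemVolume g) :=
  integrable_riemVolume g fun x₀ => by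
    have h := (((isRelOpen_target x₀).fderivWithin (contDiffOn_comp_symm hρ x₀)
      ).continuousOn.clm_apply (continuousOn_rellichV g hF hη x₀)).locBdd (μ := volume)
        (measurableSet_target x₀)
    exact h.congr_on (measurableSet_target x₀) fun y hy => (dirDeriv_symm hρ _ hy).symm

/-- The divergence theorem for the product of the Rellich field with a cutoff function. -/
theorem integral_cutoff (hF : IsLipschitzVField F) (hη : IsSmoothForm η)
    (hρ : ContMDiff (𝓡∂ (m + 1)) 𝓘(ℝ, ℝ) ∞ ρ) (hs : tsupport ρ ⊆ (chart m x₀).source) :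
    ∫ x, (dirDeriv ρ (rellichV g F η) x + ρ x * rellichDensity g F η x) ∂riemVolume g =
      -∫ x, ρ x * rellichFlux g F η x ∂boundaryVolume g := by
  have hU := isRelOpen_target (m := m) x₀
  have hUm := measurableSet_target (m := m) x₀
  have h0 : ∀ x, x ∉ tsupport ρ → ρ x = 0 := fun x hx => image_eq_zero_of_notMem_tsupport hx
  rw [integral_riemVolume g x₀ fun x hx => by
      rw [dirDeriv_of_notMem_tsupport _ (mt (@hs x) hx), h0 x (mt (@hs x) hx), zero_mul, add_zero],
    integral_boundaryVolume g x₀ fun x hx => by rw [h0 x (mt (@hs x) hx), zero_mul]]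
  set ψ : Fin (m + 1) → Model m → ℝ := fun a z => ρ ((chart m x₀).symm z) *
    (volDensity g x₀ z * localVField (rellichV g F η) x₀ z a) with hψ
  -- Outside its target the inverse chart has arbitrary values, so the densitized components are
  -- extended by zero; they already vanish off the compact image of the support.
  set φ : Fin (m + 1) → Model m → ℝ := fun a => (chart m x₀).target.indicator (ψ a) with hφ
  set K := chart m x₀ '' tsupport ρ with hK
  have hKc : IsCompact K := (isClosed_tsupport ρ).isCompact.image_of_continuousOn
    ((continuousOn_extChartAt x₀).mono hs)
  have hKU : K ⊆ (chart m x₀).target := by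
    rintro _ ⟨x, hx, rfl⟩
    exact (chart m x₀).map_source (hs hx)
  have hφ0 : ∀ a y, y ∉ K → φ a y = 0 := fun a y hyK => by
    by_cases hy : y ∈ (chart m x₀).target
    · rw [hφ]
      simp only [indicator_of_mem hy, hψ]
      rw [h0, zero_mul]
      exact fun h => hyK ⟨_, h, (chart m x₀).right_inv hy⟩
    · exact indicator_of_notMem hy _
  have hlip : ∀ a, LocallyLipschitzOn (chart m x₀).target (φ a) := fun a => by
    refine LocallyLipschitzOn.congr_on (f := ψ a) ?_ fun y hy => (indicator_of_mem hy _).symm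
    exact (hU.locallyLipschitzOn (contDiffOn_comp_symm hρ x₀)).fun_mul
      ((hU.locallyLipschitzOn (isMetricOn_localMetric g x₀).contDiffOn_sqrt_det).fun_mul
        (locallyLipschitzOn_rellichV_apply g hF hη x₀ a))
  have hdiv := fun a => integral_fderivWithin_halfSpace hU (hlip a) hKc hKU
    (fun y _ hy => hφ0 a y hy) a
  have hsum : ∫ y in halfSpace m, ∑ a, fderivWithin ℝ (φ a) (halfSpace m) y (coordVec a) =
      -∫ z, φ 0 (boundaryInclusion z) := by
    rw [integral_finsetSum _ fun a _ => (hdiv a).1]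
    simp only [fun a => (hdiv a).2]
    rw [Finset.sum_ite_eq' Finset.univ (0 : Fin (m + 1)) fun a => -∫ z, φ a (boundaryInclusion z),
      if_pos (Finset.mem_univ _)]
  -- Such points have a neighbourhood avoiding the compact set `K`, on which the extension is
  -- identically zero, so the integral over the half-space reduces to the target.
  have hzero : ∀ y ∈ halfSpace m \ (chart m x₀).target,
      ∑ a, fderivWithin ℝ (φ a) (halfSpace m) y (coordVec a) = 0 := fun y hy => by
    refine Finset.sum_eq_zero fun a _ => ?_
    have h : φ a =ᶠ[𝓝[halfSpace m] y] fun _ => (0 : ℝ) := by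
      refine mem_nhdsWithin_of_mem_nhds (Filter.mem_of_superset
        (hKc.isClosed.isOpen_compl.mem_nhds fun h => hy.2 (hKU h)) fun z hz => hφ0 a z hz)
    rw [h.fderivWithin_eq_of_mem hy.1, fderivWithin_const_apply]
    rfl
  rw [setIntegral_eq_of_subset_of_forall_sdiff_eq_zero measurableSet_halfSpace hU.sub hzero]
    at hsum
  have hleft : ∫ y in (chart m x₀).target, volDensity g x₀ y *
      (dirDeriv ρ (rellichV g F η) ((chart m x₀).symm y) +
        ρ ((chart m x₀).symm y) * rellichDensity g F η ((chart m x₀).symm y)) =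
      ∫ y in (chart m x₀).target,
        ∑ a, fderivWithin ℝ (φ a) (halfSpace m) y (coordVec a) := by
    refine integral_congr_ae ?_
    filter_upwards [hF.ae_differentiableWithinAt x₀, ae_restrict_mem hUm] with y hd hy
    rw [← sum_fderivWithin_cutoff g hρ hη hy hd]
    refine Finset.sum_congr rfl fun a _ => ?_
    have h : φ a =ᶠ[𝓝[halfSpace m] y] ψ a :=
      Filter.mem_of_superset (hU.nhds y hy) fun z hz => indicator_of_mem hz _
    rw [h.fderivWithin_eq_of_mem (hU.sub hy)]
  have hright : ∫ z, φ 0 (boundaryInclusion z) = ∫ z in boundaryTarget m x₀,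
      boundaryDensity g x₀ z * (ρ (boundaryParam m x₀ z) *
        rellichFlux g F η (boundaryParam m x₀ z)) := by
    rw [← integral_indicator (measurableSet_boundaryTarget x₀)]
    congr 1
    funext z
    by_cases hz : z ∈ boundaryTarget m x₀
    · have h := boundaryDensity_mul_rellichFlux g F η hz
      rw [indicator_of_mem hz, mul_left_comm, h]
      exact indicator_of_mem (s := (chart m x₀).target) hz _
    · rw [indicator_of_notMem hz]
      exact indicator_of_notMem (s := (chart m x₀).target) hz _
  rw [hleft, hsum, hright]

/-- The Rellich identity before the integrals are split. -/
theorem integral_rellichDensity [T2Space M] (hF : IsLipschitzVField F) (hη : IsSmoothForm η) :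
    ∫ x, rellichDensity g F η x ∂riemVolume g = -∫ x, rellichFlux g F η x ∂boundaryVolume g := by
  -- Finitely many chart domains suffice, which makes the partition of unity a finite sum.
  obtain ⟨t, ht⟩ := isCompact_univ.elim_nhds_subcover (fun x : M => (chart m x).source)
    fun x _ => extChartAt_source_mem_nhds x
  obtain ⟨f, hf⟩ := SmoothPartitionOfUnity.exists_isSubordinate (𝓡∂ (m + 1)) isClosed_univ
    (fun x : t => (chart m (x : M)).source) (fun x => isOpen_extChartAt_source _)
    (fun x _ => by
      obtain ⟨i, hi, hx⟩ := mem_iUnion₂.1 (ht.2 (mem_univ x))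
      exact mem_iUnion.2 ⟨⟨i, hi⟩, hx⟩)
  have h1 : ∀ x, ∑ i, f i x = 1 := fun x => by
    rw [← finsum_eq_sum_of_fintype]
    exact f.sum_eq_one (mem_univ x)
  have hb : ∀ i x, ‖f i x‖ ≤ 1 := fun i x => by
    rw [Real.norm_of_nonneg (f.nonneg i x)]
    exact f.le_one i x
  have hsm : ∀ i, ContMDiff (𝓡∂ (m + 1)) 𝓘(ℝ, ℝ) ∞ (f i) := fun i => (f i).contMDiff
  have hE := fun i => (integrable_rellichDensity g hF hη).bdd_mul
    (hsm i).continuous.aestronglyMeasurable (ae_of_all _ (hb i))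
  have hS := fun i => (integrable_rellichFlux g hF hη).bdd_mul
    (hsm i).continuous.aestronglyMeasurable (ae_of_all _ (hb i))
  have hD : ∀ i, Integrable (fun x => dirDeriv (f i) (rellichV g F η) x +
      f i x * rellichDensity g F η x) (riemVolume g) := fun i =>
    (integrable_dirDeriv g (hsm i) hF hη).add (hE i)
  -- The derivatives of the cutoffs sum to zero and the cutoffs themselves to one, so inserting the
  -- former changes nothing.
  have e1 : ∫ x, rellichDensity g F η x ∂riemVolume g =
      ∑ i, ∫ x, (dirDeriv (f i) (rellichV g F η) x + f i x * rellichDensity g F η x)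
        ∂riemVolume g := by
    rw [← integral_finsetSum _ fun i _ => hD i]
    congr 1
    funext x
    rw [Finset.sum_add_distrib, sum_dirDeriv _ hsm h1, ← Finset.sum_mul, h1, one_mul, zero_add]
  have e2 : ∫ x, rellichFlux g F η x ∂boundaryVolume g =
      ∑ i, ∫ x, f i x * rellichFlux g F η x ∂boundaryVolume g := by
    rw [← integral_finsetSum _ fun i _ => hS i]
    congr 1
    funext x
    rw [← Finset.sum_mul, h1, one_mul]
  rw [e1, e2, ← Finset.sum_neg_distrib]
  exact Finset.sum_congr rfl fun i _ => integral_cutoff g hF hη (hsm i) (hf i)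

end Cutoff

end

end Rellich

/-! ### The Rellich identity. -/

theorem mainTheorem4 {m : ℕ} {M : Type*} [TopologicalSpace M] [T2Space M] [CompactSpace M]
    [ChartedSpace (EuclideanHalfSpace (m + 1)) M] [IsManifold (𝓡∂ (m + 1)) ∞ M]
    [MeasurableSpace M] [BorelSpace M] (g : RiemMetric m M)
    (F : VField m M) (hF : IsLipschitzVField F)
    (p : ℕ) (η : DForm m M p) (hη : IsSmoothForm η) :
    -- the vector field is differentiable almost everywhere and all the integrals exist
    ((∀ᵐ x ∂riemVolume g, IsDifferentiableVFieldAt F x) ∧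
      Integrable (innerForm g (hodgeLaplacian g η) (contract F (extD η))) (riemVolume g) ∧
      Integrable (innerForm g (codiff g η) (contract F (hodgeLaplacian g η))) (riemVolume g) ∧
      Integrable (fun x => (normSq g (extD η) x + normSq g (codiff g η) x) *
        innerV g F (unitNormal g) x) (boundaryVolume g) ∧
      Integrable (innerForm g (wedge g F (tangentialPart g (codiff g η)))
        (contract (unitNormal g) (extD η))) (boundaryVolume g) ∧
      Integrable (innerForm g (tangentialPart g (contract F (extD η)))
        (contract (unitNormal g) (extD η))) (boundaryVolume g) ∧
      Integrable (innerForm g (tangentialPart g (contract F (codiff g η)))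
        (contract (unitNormal g) (codiff g η))) (boundaryVolume g) ∧
      Integrable (fun x => (normSq g (extD η) x + normSq g (codiff g η) x) *
        divergence g F x) (riemVolume g) ∧
      Integrable (innerForm g (codiff g η) (contractDF g F (extD η))) (riemVolume g) ∧
      Integrable (innerForm g (opT g F (extD η)) (extD η)) (riemVolume g) ∧
      Integrable (innerForm g (opT g F (codiff g η)) (codiff g η)) (riemVolume g)) ∧
    -- the Rellich identity
    (∫ x, innerForm g (hodgeLaplacian g η) (contract F (extD η)) x ∂riemVolume g) +
        (∫ x, innerForm g (codiff g η) (contract F (hodgeLaplacian g η)) x ∂riemVolume g) =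
      -(1 / 2 : ℝ) * (∫ x, (normSq g (extD η) x + normSq g (codiff g η) x) *
          innerV g F (unitNormal g) x ∂boundaryVolume g) +
        (∫ x, innerForm g (wedge g F (tangentialPart g (codiff g η)))
          (contract (unitNormal g) (extD η)) x ∂boundaryVolume g) +
        (∫ x, innerForm g (tangentialPart g (contract F (extD η)))
          (contract (unitNormal g) (extD η)) x ∂boundaryVolume g) +
        (∫ x, innerForm g (tangentialPart g (contract F (codiff g η)))
          (contract (unitNormal g) (codiff g η)) x ∂boundaryVolume g) -
        (1 / 2 : ℝ) * (∫ x, (normSq g (extD η) x + normSq g (codiff g η) x) *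
          divergence g F x ∂riemVolume g) +
        (∫ x, innerForm g (codiff g η) (contractDF g F (extD η)) x ∂riemVolume g) +
        (∫ x, innerForm g (opT g F (extD η)) (extD η) x ∂riemVolume g) +
        (∫ x, innerForm g (opT g F (codiff g η)) (codiff g η) x ∂riemVolume g) := by
  have hα := isSmoothForm_extD g hη
  have hβ := isSmoothForm_codiff g hη
  have hΔ := isSmoothForm_hodgeLaplacian g hη
  have i1 : Integrable (innerForm g (hodgeLaplacian g η) (contract F (extD η))) (riemVolume g) :=
    integrable_innerForm_contract (k := p + 1) g hF hΔ hα
  have i2 := integrable_innerForm_contract g hF hβ hΔ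
  have i3 := integrable_normSq_mul_divergence g hF hα hβ
  have i4 : Integrable (innerForm g (codiff g η) (contractDF g F (extD η))) (riemVolume g) :=
    integrable_innerForm_contractDF (k := p + 1) g hF hβ hα
  have i5 := integrable_innerForm_opT g hF hα
  have i6 := integrable_innerForm_opT g hF hβ
  have b1 := integrable_normSq_mul_innerV g hF hα hβ
  have b2 : Integrable (innerForm g (wedge g F (tangentialPart g (codiff g η)))
    (contract (unitNormal g) (extD η))) (boundaryVolume g) :=
    integrable_innerForm_wedge_boundary g hF hβ hα
  have b3 : Integrable (innerForm g (tangentialPart g (contract F (extD η)))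
    (contract (unitNormal g) (extD η))) (boundaryVolume g) :=
    integrable_innerForm_contract_boundary g hF hα
  have b4 := integrable_innerForm_contract_boundary g hF hβ
  refine ⟨⟨ae_isDifferentiableVFieldAt g hF, i1, i2, b1, b2, b3, b4, i3, i4, i5, i6⟩, ?_⟩
  have h := integral_rellichDensity g hF hη
  have hl : ∫ x, rellichDensity g F η x ∂riemVolume g = _ :=
    (integral_sub ((((i1.add i2).add (i3.const_mul 2⁻¹)).sub i4).sub i5) i6).trans
      (congrArg (· - _) ((integral_sub (((i1.add i2).add (i3.const_mul 2⁻¹)).sub i4) i5).trans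
        (congrArg (· - _) ((integral_sub ((i1.add i2).add (i3.const_mul 2⁻¹)) i4).trans
          (congrArg (· - _) ((integral_add (i1.add i2) (i3.const_mul 2⁻¹)).trans
            (congrArg₂ (· + ·) (integral_add i1 i2) (integral_const_mul _ _))))))))
  have hr : ∫ x, rellichFlux g F η x ∂boundaryVolume g = _ :=
    (integral_sub (((b1.const_mul 2⁻¹).sub b2).sub b3) b4).trans
      (congrArg (· - _) ((integral_sub ((b1.const_mul 2⁻¹).sub b2) b3).trans
        (congrArg (· - _) ((integral_sub (b1.const_mul 2⁻¹) b2).trans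
          (congrArg (· - _) (integral_const_mul _ _))))))
  rw [hl, hr] at h
  linarith
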